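/- Let $(M^m,g)$ be a closed (compact, without boundary) connected smooth Riemannian manifold with Levi-Civita connection $\nabla$ and curvature tensor $R(X,Y)Z=\nabla_X\nabla_YZ-\nabla_Y\nabla_XZ-\nabla_{[X,Y]}Z$, and let $v$ be a smooth vector field on $M$. For $X\in T_pM$ let $X^{hor},X^{ver}\in T_{(p,v(p))}TM$ be its horizontal and vertical lifts with respect to $\nabla$, let $g_S$ be the Sasaki metric on $TM$, i.e. $g_S(X^{hor}+Y^{ver},X'^{hor}+Y'^{ver})=g(X,X')+g(Y,Y')$, and let $f_v:M\to TM$, $f_v(p)=(p,v(p))$, which is an isometric embedding into $(TM,g_S)$ when $M$ carries the induced metric $g(v)=f_v^*g_S$. Let $H$ be the mean curvature vector of $f_v$ (the trace with respect to $g(v)$ of its second fundamental form in $(TM,g_S)$); $v$ is called minimal if $H\equiv 0$. Let $C_v=\nabla v$ be viewed as the endomorphism $X\mapsto\nabla_Xv$ of $TM$, with $g$-transpose $C_v^t$. Let $\{e_i\}_{i=1}^m$ be any smooth $g$-orthonormal frame of eigenvectors of $C_v^tC_v$ on an open set $U\subseteq M$, and put $c_i=(1+\|\nabla_{e_i}v\|^2)^{-1/2}$.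 Then at every point of $U$ the vectors $c_i\left(e_i^{hor}+(\nabla_{e_i}v)^{ver}\right)$ are tangent to $f_v(M)$ and $g_S$-orthonormal, and $$H=\Big(\sum_i c_i^2\big((\nabla_{e_i}e_i)^{hor}+(\nabla_{e_i}\nabla_{e_i}v)^{ver}+(R(v,\nabla_{e_i}v)e_i)^{hor}\big)\Big)^{\nu},$$ where $\nu$ denotes the component $g_S$-normal to $f_v(M)$; moreover, at each point of $U$, $H=0$ if and only if $$\sum_i c_i^2\big(\nabla_{e_i}\nabla_{e_i}v-\nabla_{\nabla_{e_i}e_i}v-\nabla_{R(v,\nabla_{e_i}v)e_i}v\big)=0.\qquad(*)$$ Consequently, $v$ is minimal if and only if $(*)$ holds for every such local frame, at every point of its domain; and this is the case if and only if $v$ is parallel ($\nabla v\equiv 0$) or identically zero. -/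

import Mathlib

open scoped Manifold ContDiff Bundle
open Bundle

noncomputable section

/-! ### Riemannian geometry in charts

The first definitions concern an arbitrary boundaryless manifold `N` modelled on a
finite-dimensional space `F`, with a field `h` of bilinear forms on its tangent spaces.
They are applied both to a Riemannian manifold and to its tangent bundle with the Sasaki metric. -/

section General

variable {F : Type*} [NormedAddCommGroup F] [NormedSpace ℝ F]
  {H : Type*} [TopologicalSpace H] {N : Type*} [TopologicalSpace N] [ChartedSpace H N]

/-- Fields of bilinear forms on the tangent spaces of a manifold. -/
abbrev MetricField (I : ModelWithCorners ℝ F H) (N : Type*) [TopologicalSpace N]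
    [ChartedSpace H N] : Type _ :=
  (x : N) → TangentSpace I x →L[ℝ] TangentSpace I x →L[ℝ] ℝ

/-- The components of tangent vectors at `q` in the preferred chart at `p`, that is, the
differential at `q` of that chart. -/
def chartCoord (I : ModelWithCorners ℝ F H) (p q : N) : TangentSpace I q →L[ℝ] F :=
  mfderiv I 𝓘(ℝ, F) (extChartAt I p) q

/-- The bilinear form `(x, y) ↦ B (A x) (A y)`. -/
def pullForm {V W : Type*} [TopologicalSpace V] [AddCommGroup V] [Module ℝ V]
    [TopologicalSpace W] [AddCommGroup W] [Module ℝ W] (B : W →L[ℝ] W →L[ℝ] ℝ) (A : V →L[ℝ] W) :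
    V →L[ℝ] V →L[ℝ] ℝ :=
  (ContinuousLinearMap.precomp ℝ A).comp (B.comp A)

theorem pullForm_apply {V W : Type*} [TopologicalSpace V] [AddCommGroup V] [Module ℝ V]
    [TopologicalSpace W] [AddCommGroup W] [Module ℝ W] (B : W →L[ℝ] W →L[ℝ] ℝ) (A : V →L[ℝ] W)
    (x y : V) : pullForm B A x y = B (A x) (A y) := rfl

/-- The matrix `h_{ij}` (as a bilinear form) at the point with coordinates `y` in the preferred
chart at `p`. -/
def chartMetric {I : ModelWithCorners ℝ F H} (h : MetricField I N) (p : N) (y : F) :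
    F →L[ℝ] F →L[ℝ] ℝ :=
  pullForm (h ((extChartAt I p).symm y)) (chartCoord I p ((extChartAt I p).symm y)).inverse

/-- For `D = dh`, the Christoffel symbols of the first kind, as the bilinear form
`(a, c) ↦ (∂_a h(b, c) + ∂_b h(a, c) - ∂_c h(b, a)) / 2` for each `b`. -/
def christoffelFirst (D : F →L[ℝ] F →L[ℝ] F →L[ℝ] ℝ) (b : F) : F →L[ℝ] F →L[ℝ] ℝ :=
  (2⁻¹ : ℝ) • (D.flip b + D b - (D.flip b).flip)

theorem christoffelFirst_apply (D : F →L[ℝ] F →L[ℝ] F →L[ℝ] ℝ) (a b c : F) :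
    christoffelFirst D b a c = 2⁻¹ * (D a b c + D b a c - D c b a) := rfl

set_option synthInstance.maxHeartbeats 200000 in
/-- The Christoffel symbols (of the second kind) of `h` in the preferred chart at `p`, at the point
with coordinates `y`, as the map `a ↦ Γ(a, b)` for each `b`: `Γ(a, b)` is the vector with
`h(Γ(a, b), c) = (∂_a h(b, c) + ∂_b h(a, c) - ∂_c h(b, a)) / 2` for all `c`. -/
def christoffel {I : ModelWithCorners ℝ F H} (h : MetricField I N) (p : N) (y b : F) :
    F →L[ℝ] F :=
  (chartMetric h p y).inverse ∘L christoffelFirst (fderiv ℝ (chartMetric h p) y) b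

/-- The components of a vector field in the preferred chart at `p`. -/
def chartField (I : ModelWithCorners ℝ F H) (Y : (x : N) → TangentSpace I x) (p : N) (y : F) : F :=
  chartCoord I p ((extChartAt I p).symm y) (Y ((extChartAt I p).symm y))

/-- The covariant derivative `X ↦ ∇_X Y` at `p` for the Levi-Civita connection of `h`:
`∂_X Y + Γ(X, Y)` in the preferred chart at `p`. -/
def covDeriv {I : ModelWithCorners ℝ F H} (h : MetricField I N) (Y : (x : N) → TangentSpace I x)
    (p : N) : TangentSpace I p →L[ℝ] TangentSpace I p :=
  (chartCoord I p p).inverse ∘L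
    (fderiv ℝ (chartField I Y p) (extChartAt I p p) +
      christoffel h p (extChartAt I p p) (chartCoord I p p (Y p))) ∘L
    chartCoord I p p

/-- The vector field `∇_X Y`. -/
def nabla {I : ModelWithCorners ℝ F H} (h : MetricField I N) (X Y : (x : N) → TangentSpace I x)
    (p : N) : TangentSpace I p :=
  covDeriv h Y p (X p)

/-- The Riemannian curvature `R(X, Y)Z = ∇_X ∇_Y Z - ∇_Y ∇_X Z - ∇_{[X, Y]} Z`. -/
def riemannCurvature {I : ModelWithCorners ℝ F H} (h : MetricField I N)
    (X Y Z : (x : N) → TangentSpace I x) (p : N) : TangentSpace I p :=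
  nabla h X (nabla h Y Z) p - nabla h Y (nabla h X Z) p -
    nabla h (VectorField.mlieBracket I X Y) Z p

/-- The transpose of an endomorphism `C` of a space with an inner product `B`:
`B (Cᵗ x) y = B x (C y)`. -/
def formTranspose {V : Type*} [TopologicalSpace V] [AddCommGroup V] [Module ℝ V]
    [IsTopologicalAddGroup V] [ContinuousSMul ℝ V]
    (B : V →L[ℝ] V →L[ℝ] ℝ) (C : V →L[ℝ] V) (x : V) : V :=
  B.inverse ((B x).comp C)

end General

section Submanifold

/-- The component of `ξ` normal to the subspace `W` for the inner product `B`: the vector `n` with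
`n ⊥ W` and `ξ - n ∈ W` (unique if `B` is positive definite and `W` finite-dimensional). -/
def normalPart {V : Type*} [TopologicalSpace V] [AddCommGroup V] [Module ℝ V]
    (B : V →L[ℝ] V →L[ℝ] ℝ) (W : Submodule ℝ V) (ξ : V) : V :=
  Classical.epsilon fun n : V => (∀ w ∈ W, B n w = 0) ∧ ξ - n ∈ W

variable {F : Type*} [NormedAddCommGroup F] [NormedSpace ℝ F]
  {H : Type*} [TopologicalSpace H] {I : ModelWithCorners ℝ F H}
  {M : Type*} [TopologicalSpace M] [ChartedSpace H M]
  {F' : Type*} [NormedAddCommGroup F'] [NormedSpace ℝ F']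
  {H' : Type*} [TopologicalSpace H'] {J : ModelWithCorners ℝ F' H'}
  {N : Type*} [TopologicalSpace N] [ChartedSpace H' N]

/-- The field of bilinear forms on `M` induced from `h` by `f : M → N`. -/
def pullbackMetric (I : ModelWithCorners ℝ F H) (h : MetricField J N) (f : M → N) :
    MetricField I M :=
  fun p => pullForm (h (f p)) (mfderiv I J f p)

/-- The covariant derivative, at `p` in the direction `x`, of `df(Y)` along `f` for the Levi-Civita
connection of `h`, where `Y` extends `y` with constant components in the preferred chart at `p`:
`∂_x ∂_y f + Γ(∂_x f, ∂_y f)` in charts. A change of the extension `Y` changes it by a vector that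
is tangent to the image of `f`. -/
def ambientDeriv (h : MetricField J N) (f : M → N) (p : M) (x y : TangentSpace I p) :
    TangentSpace J (f p) :=
  (chartCoord J (f p) (f p)).inverse
    (fderiv ℝ (fderiv ℝ (writtenInExtChartAt I J p f)) (extChartAt I p p)
        (chartCoord I p p x) (chartCoord I p p y) +
      christoffel h (f p) (extChartAt J (f p) (f p))
        (fderiv ℝ (writtenInExtChartAt I J p f) (extChartAt I p p) (chartCoord I p p y))
        (fderiv ℝ (writtenInExtChartAt I J p f) (extChartAt I p p) (chartCoord I p p x)))

/-- The component of `ξ ∈ T_{f(p)} N` normal to the submanifold `f(M)`. -/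
def normalComponent (I : ModelWithCorners ℝ F H) (h : MetricField J N) (f : M → N) (p : M)
    (ξ : TangentSpace J (f p)) : TangentSpace J (f p) :=
  normalPart (h (f p)) (LinearMap.range (mfderiv I J f p).toLinearMap) ξ

/-- The second fundamental form of the immersion `f` into `(N, h)`. -/
def secondFundamentalForm (h : MetricField J N) (f : M → N) (p : M) (x y : TangentSpace I p) :
    TangentSpace J (f p) :=
  normalComponent I h f p (ambientDeriv h f p x y)

/-- The mean curvature vector of the immersion `f` into `(N, h)`: the trace of the second
fundamental form with respect to the induced metric. It is computed as `∑ k^{ij} α(b_i, b_j)` from a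
basis `b` of `T_p M`, with `(k^{ij})` the inverse of the matrix of the induced metric. -/
def meanCurvature [FiniteDimensional ℝ F] (I : ModelWithCorners ℝ F H) (h : MetricField J N)
    (f : M → N) (p : M) : TangentSpace J (f p) :=
  let b : Fin (Module.finrank ℝ F) → TangentSpace I p := fun i => Module.finBasis ℝ F i
  ∑ i, ∑ j, (Matrix.of fun i j => pullbackMetric I h f p (b i) (b j))⁻¹ i j •
    secondFundamentalForm h f p (b i) (b j)

end Submanifold

/-! ### The Sasaki metric -/

section Sasaki

variable {E : Type*} [NormedAddCommGroup E] [NormedSpace ℝ E]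
  {H : Type*} [TopologicalSpace H] {I : ModelWithCorners ℝ E H}
  {M : Type*} [TopologicalSpace M] [ChartedSpace H M] [IsManifold I 1 M]

/-- The fibre coordinates `v^i = dx^i` on `TM` of the preferred chart `x` at `p ∈ M`. -/
def fibreCoord (I : ModelWithCorners ℝ E H) (p : M) (w : TangentBundle I M) : E :=
  chartCoord I p w.1 w.2

/-- The differential `π_*` of the projection `π : TM → M`. -/
def projDeriv (z : TangentBundle I M) : TangentSpace I.tangent z →L[ℝ] TangentSpace I z.1 :=
  mfderiv I.tangent I (TotalSpace.proj : TangentBundle I M → M) z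

/-- The differential at `z = (p, u)` of the fibre coordinates of the preferred chart at `p`. -/
def fibreCoordDeriv (z : TangentBundle I M) : TangentSpace I.tangent z →L[ℝ] E :=
  mfderiv I.tangent 𝓘(ℝ, E) (fibreCoord I z.1) z

/-- The connection operator `K : T_z(TM) → T_p M` at `z = (p, u)` of the Levi-Civita connection:
`K(Ξ) = dv(Ξ) + Γ(dx(Ξ), u)` in the preferred chart `x` at `p`. -/
def connectionMap (g : MetricField I M) (z : TangentBundle I M) :
    TangentSpace I.tangent z →L[ℝ] TangentSpace I z.1 :=
  (chartCoord I z.1 z.1).inverse ∘L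
    (fibreCoordDeriv z +
      christoffel g z.1 (extChartAt I z.1 z.1) (chartCoord I z.1 z.1 z.2) ∘L
        chartCoord I z.1 z.1 ∘L projDeriv z)

/-- The isomorphism `Ξ ↦ (π_* Ξ, K Ξ)` of `T_z(TM)` with `T_p M ⊕ T_p M`. -/
def horVerSplit (g : MetricField I M) (z : TangentBundle I M) :
    TangentSpace I.tangent z →L[ℝ] TangentSpace I z.1 × TangentSpace I z.1 :=
  (projDeriv z).prod (connectionMap g z)

/-- The horizontal lift of `X ∈ T_p M` to `z = (p, u)`: the vector with `K = 0` that projects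
to `X`. -/
def horLift (g : MetricField I M) (z : TangentBundle I M) (X : TangentSpace I z.1) :
    TangentSpace I.tangent z :=
  (horVerSplit g z).inverse (X, 0)

/-- The vertical lift of `X ∈ T_p M` to `z = (p, u)`: the vector tangent to the fibre with
`K = X`. -/
def verLift (g : MetricField I M) (z : TangentBundle I M) (X : TangentSpace I z.1) :
    TangentSpace I.tangent z :=
  (horVerSplit g z).inverse (0, X)

/-- The Sasaki metric `g_S(Ξ, Ξ') = g(π_* Ξ, π_* Ξ') + g(K Ξ, K Ξ')` on `TM`. -/
def sasakiMetric (g : MetricField I M) : MetricField I.tangent (TangentBundle I M) :=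
  fun z => pullForm (g z.1) (projDeriv z) + pullForm (g z.1) (connectionMap g z)

/-- The embedding `p ↦ (p, v(p))` of `M` into `TM` defined by a vector field. -/
def sectionMap (v : (p : M) → TangentSpace I p) (p : M) : TangentBundle I M := ⟨p, v p⟩

/-- The mean curvature vector at `(p, v(p))` of the section `p ↦ (p, v(p))` in `(TM, g_S)`. -/
def sectionMeanCurvature [FiniteDimensional ℝ E] (g : MetricField I M)
    (v : (p : M) → TangentSpace I p) (p : M) :
    TangentSpace I.tangent (sectionMap v p) :=
  meanCurvature I (sasakiMetric g) (sectionMap v) p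

/-- `v` is minimal: the section it defines has null mean curvature vector in `(TM, g_S)`. -/
def IsMinimalField [FiniteDimensional ℝ E] (g : MetricField I M)
    (v : (p : M) → TangentSpace I p) : Prop :=
  ∀ p, sectionMeanCurvature g v p = 0

/-- `c_i = (1 + ‖∇_{e_i} v‖²)^{-1/2}` for the vector field `e = e_i`. -/
def frameWeight (g : MetricField I M) (v e : (p : M) → TangentSpace I p) (p : M) : ℝ :=
  (Real.sqrt (1 + g p (nabla g e v p) (nabla g e v p)))⁻¹

/-- The vector `c_i (e_i^{hor} + (∇_{e_i} v)^{ver})` at `(p, v(p))` for the vector field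
`e = e_i`. -/
def tangentLift (g : MetricField I M) (v e : (p : M) → TangentSpace I p) (p : M) :
    TangentSpace I.tangent (sectionMap v p) :=
  frameWeight g v e p •
    (horLift g (sectionMap v p) (e p) + verLift g (sectionMap v p) (nabla g e v p))

end Sasaki

/-! ### Eigenframes -/

section Frame

variable {m : ℕ} {M : Type*} [TopologicalSpace M] [ChartedSpace (EuclideanSpace ℝ (Fin m)) M]
  [IsManifold (𝓡 m) 1 M]

/-- `e` is a smooth orthonormal frame on the open set `U` that consists of eigenvectors of
`C_vᵗ C_v`, where `C_v = ∇v`. -/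
structure IsEigenframeOn (g : MetricField (𝓡 m) M) (v : (p : M) → TangentSpace (𝓡 m) p)
    (U : Set M) (e : Fin m → (p : M) → TangentSpace (𝓡 m) p) : Prop where
  isOpen : IsOpen U
  smooth : ∀ i, ContMDiffOn (𝓡 m) (𝓡 m).tangent ∞
    (fun p => (⟨p, e i p⟩ : TangentBundle (𝓡 m) M)) U
  orthonormal : ∀ p ∈ U, ∀ i j, g p (e i p) (e j p) = if i = j then 1 else 0
  eigen : ∀ p ∈ U, ∀ i, ∃ μ : ℝ,
    formTranspose (g p) (covDeriv g v p) (covDeriv g v p (e i p)) = μ • e i p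

/-- `∑ c_i² ((∇_{e_i} e_i)^{hor} + (∇_{e_i} ∇_{e_i} v)^{ver} + (R(v, ∇_{e_i} v) e_i)^{hor})` at
`(p, v(p))`. -/
def frameCurvatureSum (g : MetricField (𝓡 m) M) (v : (p : M) → TangentSpace (𝓡 m) p)
    (e : Fin m → (p : M) → TangentSpace (𝓡 m) p) (p : M) :
    TangentSpace (𝓡 m).tangent (sectionMap v p) :=
  ∑ i, frameWeight g v (e i) p ^ 2 •
    (horLift g (sectionMap v p) (nabla g (e i) (e i) p) +
      verLift g (sectionMap v p) (nabla g (e i) (nabla g (e i) v) p) +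
      horLift g (sectionMap v p) (riemannCurvature g v (nabla g (e i) v) (e i) p))

/-- `∑ c_i² (∇_{e_i} ∇_{e_i} - ∇_{∇_{e_i} e_i} - ∇_{R(v, ∇_{e_i} v) e_i}) v` at `p`. -/
def weightedLaplacian (g : MetricField (𝓡 m) M) (v : (p : M) → TangentSpace (𝓡 m) p)
    (e : Fin m → (p : M) → TangentSpace (𝓡 m) p) (p : M) : TangentSpace (𝓡 m) p :=
  ∑ i, frameWeight g v (e i) p ^ 2 •
    (nabla g (e i) (nabla g (e i) v) p - nabla g (nabla g (e i) (e i)) v p -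
      nabla g (riemannCurvature g v (nabla g (e i) v) (e i)) v p)

/-- `v` satisfies the equation `∑ c_i² (∇_{e_i} ∇_{e_i} - ∇_{∇_{e_i} e_i} -
∇_{R(v, ∇_{e_i} v) e_i}) v = 0` in every local orthonormal frame of eigenvectors of `C_vᵗ C_v`. -/
def SatisfiesMinimalEquation (g : MetricField (𝓡 m) M)
    (v : (p : M) → TangentSpace (𝓡 m) p) : Prop :=
  ∀ (U : Set M) (e : Fin m → (p : M) → TangentSpace (𝓡 m) p), IsEigenframeOn g v U e →
    ∀ p ∈ U, weightedLaplacian g v e p = 0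

end Frame

end

/-! Geometry of the section. In the splitting of T(TM) by π_* and K, the tangent space of the image
of v at (p, v(p)) is the graph of C_v = ∇v (`lift_mem_range_iff`). The Christoffel symbols of the
Sasaki metric on the diagonal follow from the Koszul formula and the pair symmetry of the curvature
(`IsMetricOn.leviCivita_coordSasaki`). They show that differentiating the section twice along e
gives the lift with horizontal part ∇_e e + R(v, ∇_e v)e and vertical part ∇_e ∇_e v, up to a
tangent vector (`lift_sub_ambientDeriv_mem`). The vectors c_i e_i of an eigenframe are orthonormal
for the induced metric, so the trace of the second fundamental form is the weighted sum over the
frame. Its normal part vanishes exactly when its vertical part is C_v of its horizontal part, which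
is (*).

Rigidity. Put u = g(v, v). By (*), the operator L = ∑ c_i² (∇²_{e_i, e_i} - ∂_{R(v, ∇_{e_i} v)
e_i}), which has no zeroth order term, satisfies Lu = 2 ∑ c_i² |∇_{e_i} v|² ≥ 0
(`ellipticOp_sq_norm`). If u is constant, this forces ∇v = 0 wherever an eigenframe exists.
Constancy of u should come from the strong maximum principle at a maximum of u on the compact
connected M.

The difficulty is that smooth eigenframes need not exist near points where eigenvalues of C_vᵗ C_v
cross, and that L depends on the frame. Three facts overcome it. Eigenframes exist on some nonempty
open subset of every nonempty open set (`exists_isDiagonalFrameOn`). In coordinates the coefficients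
of L contain no derivative of the frame, so they are bounded locally, uniformly over all orthonormal
frames (`eventually_coefficient_bounds`). Finally, the barrier proof of the maximum principle works
if the differential inequality is known only on a dense set, with bounded coefficients that may be
discontinuous (`eventually_eq_of_subsolution`). The last step from a dense set to all of M is
continuity of ∇v.

Conversely, ∇v = 0 makes every term of (*) vanish. It also gives H = 0 at every point directly,
since any orthonormal basis can then replace an eigenframe. -/

noncomputable section

set_option maxSynthPendingDepth 3
set_option synthInstance.maxHeartbeats 400000
set_option linter.unusedSectionVars false

/-! ### Levi-Civita connection and curvature of a metric on an open subset of a vector space. -/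

section Coordinates

open Filter Topology

variable {E : Type*} [NormedAddCommGroup E] [NormedSpace ℝ E]

/-- `leviCivita G y b a` is the Christoffel symbol `Γ(a, b)` at `y` of the metric `G`. -/
def leviCivita (G : E → E →L[ℝ] E →L[ℝ] ℝ) (y b : E) : E →L[ℝ] E :=
  (G y).inverse ∘L christoffelFirst (fderiv ℝ G y) b

/-- `G` is a smooth Riemannian metric on the open subset `s` of a vector space. -/
structure IsMetricOn (G : E → E →L[ℝ] E →L[ℝ] ℝ) (s : Set E) : Prop where
  isOpen : IsOpen s
  smooth : ContDiffOn ℝ ∞ G s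
  symm : ∀ y ∈ s, ∀ a b, G y a b = G y b a
  pos : ∀ y ∈ s, ∀ a, a ≠ 0 → 0 < G y a a

theorem two_le_infty : (2 : WithTop ℕ∞) ≤ ∞ := WithTop.coe_le_coe.2 le_top

theorem isInvertible_of_pos [FiniteDimensional ℝ E] {B : E →L[ℝ] E →L[ℝ] ℝ}
    (h : ∀ a, a ≠ 0 → 0 < B a a) : B.IsInvertible := by
  have hinj : Function.Injective B.toLinearMap := by
    rw [← LinearMap.ker_eq_bot, LinearMap.ker_eq_bot']
    intro a ha
    by_contra h0
    have := h a h0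
    have h2 : B a a = 0 := by
      have : B a = 0 := ha
      rw [this]; rfl
    linarith
  have hd : Module.finrank ℝ E = Module.finrank ℝ (E →L[ℝ] ℝ) := by
    rw [← (LinearMap.toContinuousLinearMap (𝕜 := ℝ) (E := E) (F' := ℝ)).finrank_eq]
    exact (Subspace.dual_finrank_eq).symm
  exact ⟨(LinearEquiv.ofInjectiveOfFinrankEq B.toLinearMap hinj hd).toContinuousLinearEquiv, by
    ext a b; rfl⟩

namespace IsMetricOn

variable {G : E → E →L[ℝ] E →L[ℝ] ℝ} {s : Set E} {y : E}

theorem contDiffAt (hG : IsMetricOn G s) (hy : y ∈ s) : ContDiffAt ℝ ∞ G y :=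
  hG.smooth.contDiffAt (hG.isOpen.mem_nhds hy)

theorem fderiv_apply (hG : IsMetricOn G s) (hy : y ∈ s) (a b c : E) :
    fderiv ℝ G y a b c = fderiv ℝ (fun z => G z b c) y a := by
  have h : DifferentiableAt ℝ G y := (hG.contDiffAt hy).differentiableAt (by simp)
  have h1 := ((h.hasFDerivAt.clm_apply (hasFDerivAt_const b y)).clm_apply
    (hasFDerivAt_const c y)).fderiv
  rw [h1]; simp

theorem fderiv_symm (hG : IsMetricOn G s) (hy : y ∈ s) (a b c : E) :
    fderiv ℝ G y a b c = fderiv ℝ G y a c b := by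
  rw [hG.fderiv_apply hy, hG.fderiv_apply hy]
  congr 1
  apply EventuallyEq.fderiv_eq
  filter_upwards [hG.isOpen.mem_nhds hy] with z hz using hG.symm z hz b c

theorem ext_right (hG : IsMetricOn G s) (hy : y ∈ s) {a b : E}
    (h : ∀ c, G y a c = G y b c) : a = b := by
  by_contra h0
  have h1 := hG.pos y hy (a - b) (sub_ne_zero.2 h0)
  rw [map_sub] at h1
  simp [h] at h1

variable [FiniteDimensional ℝ E]

theorem isInvertible (hG : IsMetricOn G s) (hy : y ∈ s) : (G y).IsInvertible :=
  isInvertible_of_pos (hG.pos y hy)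

theorem apply_inverse (hG : IsMetricOn G s) (hy : y ∈ s) (φ : E →L[ℝ] ℝ) :
    G y ((G y).inverse φ) = φ :=
  (hG.isInvertible hy).self_apply_inverse φ

theorem leviCivita_spec (hG : IsMetricOn G s) (hy : y ∈ s) (a b c : E) :
    G y (leviCivita G y b a) c =
      2⁻¹ * (fderiv ℝ G y a b c + fderiv ℝ G y b a c - fderiv ℝ G y c b a) := by
  rw [← christoffelFirst_apply]
  have : leviCivita G y b a = (G y).inverse (christoffelFirst (fderiv ℝ G y) b a) := rfl
  rw [this, hG.apply_inverse hy]

theorem leviCivita_comm (hG : IsMetricOn G s) (hy : y ∈ s) (a b : E) :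
    leviCivita G y b a = leviCivita G y a b := by
  apply hG.ext_right hy
  intro c
  rw [hG.leviCivita_spec hy, hG.leviCivita_spec hy, hG.fderiv_symm hy c b a]
  ring

theorem leviCivita_add_right (hG : IsMetricOn G s) (hy : y ∈ s) (a b c : E) :
    leviCivita G y (b + c) a = leviCivita G y b a + leviCivita G y c a := by
  rw [hG.leviCivita_comm hy, map_add, hG.leviCivita_comm hy, hG.leviCivita_comm hy c]

/-- The Levi-Civita connection is metric. -/
theorem fderiv_eq (hG : IsMetricOn G s) (hy : y ∈ s) (a b c : E) :
    fderiv ℝ G y a b c = G y (leviCivita G y b a) c + G y b (leviCivita G y c a) := by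
  rw [hG.symm y hy b, hG.leviCivita_spec hy, hG.leviCivita_spec hy, hG.fderiv_symm hy a c b,
    hG.fderiv_symm hy c b a, hG.fderiv_symm hy b a c]
  ring

/-- Inversion is smooth near an invertible operator, and the first-kind symbols are linear in the
derivative of `G`. -/
theorem contDiffOn_leviCivita (hG : IsMetricOn G s) (b : E) :
    ContDiffOn ℝ ∞ (fun y => leviCivita G y b) s := by
  intro y hy
  have hD : ContDiffOn ℝ ∞ (fderiv ℝ G) s :=
    hG.smooth.fderiv_of_isOpen hG.isOpen (by simp)
  have h1 : ContDiffOn ℝ ∞ (fun y => christoffelFirst (fderiv ℝ G y) b) s := by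
    rw [contDiffOn_clm_apply]; intro a
    rw [contDiffOn_clm_apply]; intro c
    simp only [christoffelFirst_apply]
    have h (a b c : E) : ContDiffOn ℝ ∞ (fun y => fderiv ℝ G y a b c) s :=
      ((hD.clm_apply contDiffOn_const).clm_apply contDiffOn_const).clm_apply contDiffOn_const
    exact contDiffOn_const.mul (((h a b c).add (h b a c)).sub (h c b a))
  obtain ⟨e, he⟩ := hG.isInvertible hy
  have h2 : ContDiffAt ℝ ∞ (fun y => (G y).inverse) y := by
    have := contDiffAt_map_inverse (n := ∞) e
    rw [he] at this
    exact this.comp y (hG.contDiffAt hy)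
  exact (h2.contDiffWithinAt).clm_comp (h1 y hy)

end IsMetricOn

/-- The Christoffel symbols as a bilinear map. -/
def leviCivitaL [FiniteDimensional ℝ E] (G : E → E →L[ℝ] E →L[ℝ] ℝ) (y : E) : E →L[ℝ] E →L[ℝ] E :=
  LinearMap.toContinuousLinearMap
    { toFun := leviCivita G y
      map_add' := by
        intro b c
        rw [leviCivita, leviCivita, leviCivita, ← ContinuousLinearMap.comp_add]
        congr 1
        ext a d
        simp only [christoffelFirst_apply, map_add, add_apply]
        ring
      map_smul' := by
        intro t b
        rw [leviCivita, leviCivita, RingHom.id_apply, ← ContinuousLinearMap.comp_smul]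
        congr 1
        ext a d
        simp only [christoffelFirst_apply, map_smul, smul_apply, smul_eq_mul]
        ring }

theorem leviCivitaL_apply [FiniteDimensional ℝ E] (G : E → E →L[ℝ] E →L[ℝ] ℝ) (y b : E) :
    leviCivitaL G y b = leviCivita G y b := rfl

/-- The curvature `R(a, b) w` in coordinates. -/
def coordCurvature [FiniteDimensional ℝ E] (G : E → E →L[ℝ] E →L[ℝ] ℝ) (y a b w : E) : E :=
  fderiv ℝ (leviCivitaL G) y a w b - fderiv ℝ (leviCivitaL G) y b w a +
    leviCivita G y (leviCivita G y w b) a - leviCivita G y (leviCivita G y w a) b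

namespace IsMetricOn

variable {G : E → E →L[ℝ] E →L[ℝ] ℝ} {s : Set E} {y : E} [FiniteDimensional ℝ E]

theorem contDiffOn_leviCivitaL (hG : IsMetricOn G s) : ContDiffOn ℝ ∞ (leviCivitaL G) s := by
  rw [contDiffOn_clm_apply]
  exact hG.contDiffOn_leviCivita

theorem differentiableAt_leviCivitaL (hG : IsMetricOn G s) (hy : y ∈ s) :
    DifferentiableAt ℝ (leviCivitaL G) y :=
  (hG.contDiffOn_leviCivitaL.contDiffAt (hG.isOpen.mem_nhds hy)).differentiableAt (by simp)

theorem fderiv_leviCivitaL_comm (hG : IsMetricOn G s) (hy : y ∈ s) (a b c : E) :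
    fderiv ℝ (leviCivitaL G) y a b c = fderiv ℝ (leviCivitaL G) y a c b := by
  have h (b c : E) : fderiv ℝ (fun z => leviCivitaL G z b c) y a =
      fderiv ℝ (leviCivitaL G) y a b c := by
    rw [(((hG.differentiableAt_leviCivitaL hy).hasFDerivAt.clm_apply
      (hasFDerivAt_const b y)).clm_apply (hasFDerivAt_const c y)).fderiv]
    simp
  rw [← h, ← h]
  congr 1
  apply EventuallyEq.fderiv_eq
  filter_upwards [hG.isOpen.mem_nhds hy] with z hz using hG.leviCivita_comm hz c b

/-- The connection is torsion-free: both the derivative terms and the quadratic terms cancel in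
pairs once Γ is symmetrized. -/
theorem coordCurvature_bianchi (hG : IsMetricOn G s) (hy : y ∈ s) (a b w : E) :
    coordCurvature G y a b w + coordCurvature G y b w a + coordCurvature G y w a b = 0 := by
  simp only [coordCurvature]
  rw [hG.fderiv_leviCivitaL_comm hy a w b, hG.fderiv_leviCivitaL_comm hy b w a,
    hG.fderiv_leviCivitaL_comm hy w b a, hG.leviCivita_comm hy b w, hG.leviCivita_comm hy a w,
    hG.leviCivita_comm hy a b]
  abel

theorem coordCurvature_swap (G : E → E →L[ℝ] E →L[ℝ] ℝ) (y a b w : E) :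
    coordCurvature G y b a w = -coordCurvature G y a b w := by
  simp only [coordCurvature]; abel

/-- Differentiate the metric identity ∂_b G(w, k) = G(Γ(b, w), k) + G(w, Γ(b, k)) once more in the
direction a. The second derivative of `G` is symmetric in a and b, and antisymmetrizing the
right-hand side leaves G(R(a, b)w, k) + G(w, R(a, b)k) = 0. -/
theorem coordCurvature_antisymm (hG : IsMetricOn G s) (hy : y ∈ s) (a b w k : E) :
    G y (coordCurvature G y a b w) k = -G y w (coordCurvature G y a b k) := by
  have hGd : DifferentiableAt ℝ G y := (hG.contDiffAt hy).differentiableAt (by simp)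
  have hL := (hG.differentiableAt_leviCivitaL hy).hasFDerivAt
  have key (a b : E) : fderiv ℝ (fun z => fderiv ℝ G z) y a b w k =
      fderiv ℝ G y a (leviCivita G y w b) k + G y (fderiv ℝ (leviCivitaL G) y a w b) k +
      fderiv ℝ G y a w (leviCivita G y k b) + G y w (fderiv ℝ (leviCivitaL G) y a k b) := by
    have hD : DifferentiableAt ℝ (fderiv ℝ G) y :=
      ((hG.contDiffAt hy).fderiv_right (m := 1) (by norm_cast)).differentiableAt (by simp)
    have h1 : fderiv ℝ (fun z => fderiv ℝ G z b w k) y a =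
        fderiv ℝ (fun z => fderiv ℝ G z) y a b w k := by
      rw [(((hD.hasFDerivAt.clm_apply (hasFDerivAt_const b y)).clm_apply
        (hasFDerivAt_const w y)).clm_apply (hasFDerivAt_const k y)).fderiv]
      simp
    have h2 : (fun z => fderiv ℝ G z b w k) =ᶠ[𝓝 y] fun z =>
        G z (leviCivitaL G z w b) k + G z w (leviCivitaL G z k b) := by
      filter_upwards [hG.isOpen.mem_nhds hy] with z hz using hG.fderiv_eq hz b w k
    rw [← h1, h2.fderiv_eq]
    have e1 := (hGd.hasFDerivAt.clm_apply ((hL.clm_apply (hasFDerivAt_const w y)).clm_apply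
      (hasFDerivAt_const b y))).clm_apply (hasFDerivAt_const k y)
    have e2 := (hGd.hasFDerivAt.clm_apply (hasFDerivAt_const w y)).clm_apply
      ((hL.clm_apply (hasFDerivAt_const k y)).clm_apply (hasFDerivAt_const b y))
    rw [(e1.fun_add e2).fderiv]
    simp [leviCivitaL_apply]
    ring
  have hs : fderiv ℝ (fun z => fderiv ℝ G z) y a b w k =
      fderiv ℝ (fun z => fderiv ℝ G z) y b a w k := by
    have := (((hG.contDiffAt hy).of_le two_le_infty).isSymmSndFDerivAt (by simp)).eq a b
    rw [this]
  rw [key, key] at hs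
  rw [hG.fderiv_eq hy, hG.fderiv_eq hy, hG.fderiv_eq hy, hG.fderiv_eq hy] at hs
  simp only [coordCurvature, map_add, map_sub, add_apply,
    sub_apply]
  linarith

/-- Pure linear algebra: four instances of the Bianchi identity combined with antisymmetry in each
of the two pairs. This is what later moves the curvature into the horizontal part of the Sasaki
connection. -/
theorem coordCurvature_pair_symm (hG : IsMetricOn G s) (hy : y ∈ s) (a b w k : E) :
    G y (coordCurvature G y a b w) k = G y (coordCurvature G y w k a) b := by
  have B (a b c d : E) : G y (coordCurvature G y a b c) d + G y (coordCurvature G y b c a) d +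
      G y (coordCurvature G y c a b) d = 0 := by
    have := congrArg (fun u => G y u d) (hG.coordCurvature_bianchi hy a b c)
    simpa using this
  have A (a b c d : E) : G y (coordCurvature G y a b c) d = -G y (coordCurvature G y a b d) c := by
    rw [hG.coordCurvature_antisymm hy, hG.symm y hy]
  have S (a b c d : E) : G y (coordCurvature G y a b c) d = -G y (coordCurvature G y b a c) d := by
    rw [coordCurvature_swap G y b a]; simp
  linarith [B a b w k, B b w k a, B w k a b, B k a b w, A a b w k, A a b k w, A b w a k, A b w k a,
    A w a b k, A w a k b, A w k a b, A w k b a, A k b w a, A k b a w, A k a b w, A k a w b,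
    A w b a k, A a k b w, S a b w k, S b w a k, S w a b k, S w k a b, S k b w a, S k a b w,
    S a w k b, S b k a w, S b w k a, S w b a k, S k b a w, S k a w b, S a w b k]

/-- Change of variables in the Christoffel symbols. -/
theorem leviCivita_pull {s' : Set E} {G' : E → E →L[ℝ] E →L[ℝ] ℝ} {τ : E → E}
    (hG : IsMetricOn G s) (hG' : IsMetricOn G' s') (hy : y ∈ s') (hτy : τ y ∈ s)
    (hτ : ContDiffAt ℝ 2 τ y) (hinv : (fderiv ℝ τ y).IsInvertible)
    (h : ∀ᶠ z in 𝓝 y, ∀ a b, G' z a b = G (τ z) (fderiv ℝ τ z a) (fderiv ℝ τ z b)) (a b : E) :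
    fderiv ℝ τ y (leviCivita G' y b a) =
      leviCivita G (τ y) (fderiv ℝ τ y b) (fderiv ℝ τ y a) + fderiv ℝ (fderiv ℝ τ) y a b := by
  have hd : DifferentiableAt ℝ τ y := hτ.differentiableAt (by simp)
  have hdd : DifferentiableAt ℝ (fderiv ℝ τ) y :=
    (hτ.fderiv_right (m := 1) (by norm_num)).differentiableAt (by simp)
  have hGd : DifferentiableAt ℝ G (τ y) := (hG.contDiffAt hτy).differentiableAt (by simp)
  have hs := (hτ.isSymmSndFDerivAt (by simp)).eq
  have D (a b c : E) : fderiv ℝ G' y a b c =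
      fderiv ℝ G (τ y) (fderiv ℝ τ y a) (fderiv ℝ τ y b) (fderiv ℝ τ y c) +
      G (τ y) (fderiv ℝ (fderiv ℝ τ) y a b) (fderiv ℝ τ y c) +
      G (τ y) (fderiv ℝ τ y b) (fderiv ℝ (fderiv ℝ τ) y a c) := by
    have h1 : (fun z => G' z b c) =ᶠ[𝓝 y]
        fun z => G (τ z) (fderiv ℝ τ z b) (fderiv ℝ τ z c) := by
      filter_upwards [h] with z hz using hz b c
    rw [hG'.fderiv_apply hy, h1.fderiv_eq]
    have e0 : HasFDerivAt (fun z => G (τ z)) (fderiv ℝ G (τ y) ∘L fderiv ℝ τ y) y :=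
      hGd.hasFDerivAt.comp y hd.hasFDerivAt
    have e := (e0.clm_apply
      (hdd.hasFDerivAt.clm_apply (hasFDerivAt_const b y))).clm_apply
      (hdd.hasFDerivAt.clm_apply (hasFDerivAt_const c y))
    have e' := e.fderiv
    rw [e']
    simp
    ring
  apply hG.ext_right hτy
  intro d
  obtain ⟨c, rfl⟩ := hinv.surjective d
  -- Both sides are tested by the Koszul formula against τ'(c). Of the six terms with a second
  -- derivative of `τ`, four cancel by symmetry and the other two add up to twice G(D²τ(a, b),
  -- τ'(c)).
  have h0 := h.self_of_nhds
  rw [← h0, hG'.leviCivita_spec hy, map_add, add_apply, hG.leviCivita_spec hτy,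
    D, D, D, hs b a, hs c a, hs c b, hG.symm _ hτy (fderiv ℝ τ y a) (fderiv ℝ (fderiv ℝ τ) y b c),
    hG.symm _ hτy (fderiv ℝ τ y b)]
  ring

end IsMetricOn
end Coordinates

/-! ### The Sasaki metric and its Christoffel symbols in coordinates. -/

section SasakiCoordinates

open Filter Topology

variable {E : Type*} [NormedAddCommGroup E] [NormedSpace ℝ E]

/-- The covariant derivative `∂_a Y + Γ(a, Y)` in coordinates. -/
def coordCov (G : E → E →L[ℝ] E →L[ℝ] ℝ) (Y : E → E) (y : E) : E →L[ℝ] E :=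
  fderiv ℝ Y y + leviCivita G y (Y y)

/-- The connection operator `(a, α) ↦ α + Γ(a, w)` in coordinates. -/
def coordConnection (G : E → E →L[ℝ] E →L[ℝ] ℝ) (y w : E) : E × E →L[ℝ] E :=
  ContinuousLinearMap.snd ℝ E E + leviCivita G y w ∘L ContinuousLinearMap.fst ℝ E E

@[simp]
theorem coordConnection_apply (G : E → E →L[ℝ] E →L[ℝ] ℝ) (y w : E) (ξ : E × E) :
    coordConnection G y w ξ = ξ.2 + leviCivita G y w ξ.1 := rfl

/-- The Sasaki metric in coordinates. -/
def coordSasaki (G : E → E →L[ℝ] E →L[ℝ] ℝ) (z : E × E) : E × E →L[ℝ] E × E →L[ℝ] ℝ :=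
  pullForm (G z.1) (ContinuousLinearMap.fst ℝ E E) + pullForm (G z.1) (coordConnection G z.1 z.2)

theorem coordSasaki_apply (G : E → E →L[ℝ] E →L[ℝ] ℝ) (z ξ η : E × E) :
    coordSasaki G z ξ η = G z.1 ξ.1 η.1 +
      G z.1 (ξ.2 + leviCivita G z.1 z.2 ξ.1) (η.2 + leviCivita G z.1 z.2 η.1) := rfl

namespace IsMetricOn

variable {G : E → E →L[ℝ] E →L[ℝ] ℝ} {s : Set E} [FiniteDimensional ℝ E]

theorem coordSasaki (hG : IsMetricOn G s) : IsMetricOn (coordSasaki G) (s ×ˢ Set.univ) where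
  isOpen := hG.isOpen.prod isOpen_univ
  smooth := by
    rw [contDiffOn_clm_apply]; intro ξ
    rw [contDiffOn_clm_apply]; intro η
    simp only [coordSasaki_apply]
    have h1 : ContDiffOn ℝ ∞ (fun z : E × E => G z.1) (s ×ˢ Set.univ) :=
      hG.smooth.comp contDiffOn_fst fun z hz => hz.1
    have h2 (a : E) : ContDiffOn ℝ ∞ (fun z : E × E => leviCivita G z.1 z.2 a) (s ×ˢ Set.univ) :=
      ((hG.contDiffOn_leviCivitaL.comp contDiffOn_fst fun z hz => hz.1).clm_apply
        contDiffOn_snd).clm_apply contDiffOn_const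
    exact ((h1.clm_apply contDiffOn_const).clm_apply contDiffOn_const).add
      ((h1.clm_apply (contDiffOn_const.add (h2 _))).clm_apply (contDiffOn_const.add (h2 _)))
  symm := by
    intro z hz ξ η
    rw [coordSasaki_apply, coordSasaki_apply, hG.symm _ hz.1, hG.symm _ hz.1 (ξ.2 + _)]
  pos := by
    intro z hz ξ hξ
    rw [coordSasaki_apply]
    have nn (a : E) : 0 ≤ G z.1 a a := by
      by_cases h : a = 0
      · simp [h]
      · exact (hG.pos _ hz.1 a h).le
    by_cases h : ξ.1 = 0
    · have h2 : ξ.2 ≠ 0 := fun h2 => hξ (Prod.ext h h2)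
      simpa [h] using hG.pos _ hz.1 _ h2
    · exact add_pos_of_pos_of_nonneg (hG.pos _ hz.1 _ h) (nn _)

theorem fderiv_coordSasaki (hG : IsMetricOn G s) {y : E} (hy : y ∈ s) (w : E) (ζ ξ η : E × E) :
    fderiv ℝ (_root_.coordSasaki G) (y, w) ζ ξ η =
      fderiv ℝ G y ζ.1 ξ.1 η.1 +
      fderiv ℝ G y ζ.1 (ξ.2 + leviCivita G y w ξ.1) (η.2 + leviCivita G y w η.1) +
      G y (fderiv ℝ (leviCivitaL G) y ζ.1 w ξ.1 + leviCivita G y ζ.2 ξ.1)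
        (η.2 + leviCivita G y w η.1) +
      G y (ξ.2 + leviCivita G y w ξ.1)
        (fderiv ℝ (leviCivitaL G) y ζ.1 w η.1 + leviCivita G y ζ.2 η.1) := by
  rw [hG.coordSasaki.fderiv_apply (y := (y, w)) ⟨hy, trivial⟩]
  have hGd : HasFDerivAt (fun z : E × E => G z.1)
      (fderiv ℝ G y ∘L ContinuousLinearMap.fst ℝ E E) (y, w) :=
    HasFDerivAt.comp (g := G) (x := (y, w)) (f := Prod.fst)
      ((hG.contDiffAt hy).differentiableAt (by simp)).hasFDerivAt hasFDerivAt_fst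
  have hLd : HasFDerivAt (fun z : E × E => leviCivitaL G z.1)
      (fderiv ℝ (leviCivitaL G) y ∘L ContinuousLinearMap.fst ℝ E E) (y, w) :=
    HasFDerivAt.comp (g := leviCivitaL G) (x := (y, w)) (f := Prod.fst)
      (hG.differentiableAt_leviCivitaL hy).hasFDerivAt hasFDerivAt_fst
  have hk (ξ : E × E) : HasFDerivAt (fun z : E × E => ξ.2 + leviCivita G z.1 z.2 ξ.1) _ (y, w) :=
    ((hLd.clm_apply hasFDerivAt_snd).clm_apply (hasFDerivAt_const ξ.1 (y, w))).const_add ξ.2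
  have e1 := (hGd.clm_apply (hasFDerivAt_const ξ.1 (y, w))).clm_apply
    (hasFDerivAt_const η.1 (y, w))
  have e2 := (hGd.clm_apply (hk ξ)).clm_apply (hk η)
  have e3 := (e1.fun_add e2).fderiv
  simp only [coordSasaki_apply]
  rw [e3]
  simp [leviCivitaL_apply]
  ring

/-- The Christoffel symbols of the Sasaki metric on the diagonal. -/
theorem leviCivita_coordSasaki (hG : IsMetricOn G s) {y : E} (hy : y ∈ s) (w : E) (ξ : E × E) :
    leviCivita (_root_.coordSasaki G) (y, w) ξ ξ =
      (leviCivita G y ξ.1 ξ.1 + coordCurvature G y w (coordConnection G y w ξ) ξ.1,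
        leviCivita G y (coordConnection G y w ξ) ξ.1 + fderiv ℝ (leviCivitaL G) y ξ.1 w ξ.1 +
          leviCivita G y ξ.2 ξ.1 - leviCivita G y w (leviCivita G y ξ.1 ξ.1 +
            coordCurvature G y w (coordConnection G y w ξ) ξ.1)) := by
  have hz : ((y, w) : E × E) ∈ s ×ˢ (Set.univ : Set E) := ⟨hy, trivial⟩
  apply hG.coordSasaki.ext_right hz
  intro η
  rw [hG.coordSasaki.leviCivita_spec hz, hG.fderiv_coordSasaki hy, hG.fderiv_coordSasaki hy,
    coordSasaki_apply]
  obtain ⟨x, ζ⟩ := ξ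
  obtain ⟨c, γ⟩ := η
  simp only [coordConnection_apply]
  -- `k` and `l` are the images of ξ and η under K. Eliminating the raw fibre components `ζ` and `γ`
  -- in their favour makes every term of the Koszul formula tensorial or a Christoffel term that
  -- cancels.
  obtain ⟨k, hk⟩ : ∃ k, k = ζ + leviCivita G y w x := ⟨_, rfl⟩
  obtain ⟨l, hl⟩ : ∃ l, l = γ + leviCivita G y w c := ⟨_, rfl⟩
  have hζ : leviCivita G y ζ c = leviCivita G y k c - leviCivita G y (leviCivita G y w x) c := by
    rw [hk, hG.leviCivita_add_right hy, add_sub_cancel_right]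
  have hγ : leviCivita G y γ x = leviCivita G y l x - leviCivita G y (leviCivita G y w c) x := by
    rw [hl, hG.leviCivita_add_right hy, add_sub_cancel_right]
  -- The Koszul formula produces G(R(x, c)w, k), where c is the horizontal part of the test vector.
  -- Pair symmetry rewrites it as G(R(w, k)x, c), from which the horizontal component of the
  -- Christoffel symbol can be read off.
  have hR := hG.coordCurvature_pair_symm hy x c w k
  simp only [coordCurvature, map_add, map_sub, add_apply, sub_apply] at hR
  rw [← hk, ← hl, sub_add_cancel]
  rw [hζ, hγ, hG.fderiv_eq hy, hG.fderiv_eq hy, hG.fderiv_eq hy, hG.fderiv_eq hy]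
  simp only [coordCurvature, map_add, map_sub, add_apply, sub_apply]
  rw [hG.leviCivita_comm hy x c]
  have q1 := hG.symm y hy x (leviCivita G y x c)
  have q2 := hG.symm y hy k (leviCivita G y k c)
  have q3 := hG.symm y hy k (leviCivita G y l x)
  have q4 := hG.symm y hy x (leviCivita G y c x)
  have q5 := hG.symm y hy k (fderiv ℝ (leviCivitaL G) y c w x)
  have q6 := hG.symm y hy k (fderiv ℝ (leviCivitaL G) y x w c)
  have q7 := hG.symm y hy k (leviCivita G y (leviCivita G y w x) c)
  have q8 := hG.symm y hy k (leviCivita G y (leviCivita G y w c) x)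
  linarith

/-- The covariant derivative does not depend on the coordinates. -/
theorem coordCov_pull {s' : Set E} {G' : E → E →L[ℝ] E →L[ℝ] ℝ} {τ : E → E} {Y Y' : E → E} {y : E}
    (hG : IsMetricOn G s) (hG' : IsMetricOn G' s') (hy : y ∈ s') (hτy : τ y ∈ s)
    (hτ : ContDiffAt ℝ 2 τ y) (hinv : (fderiv ℝ τ y).IsInvertible)
    (h : ∀ᶠ z in 𝓝 y, ∀ a b, G' z a b = G (τ z) (fderiv ℝ τ z a) (fderiv ℝ τ z b))
    (hY : DifferentiableAt ℝ Y (τ y)) (hY' : DifferentiableAt ℝ Y' y)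
    (hYY' : ∀ᶠ z in 𝓝 y, Y (τ z) = fderiv ℝ τ z (Y' z)) (a : E) :
    fderiv ℝ τ y (coordCov G' Y' y a) = coordCov G Y (τ y) (fderiv ℝ τ y a) := by
  have hd : DifferentiableAt ℝ τ y := hτ.differentiableAt (by simp)
  have hdd : DifferentiableAt ℝ (fderiv ℝ τ) y :=
    (hτ.fderiv_right (m := 1) (by norm_num)).differentiableAt (by simp)
  have e1 : HasFDerivAt (fun z => Y (τ z)) (fderiv ℝ Y (τ y) ∘L fderiv ℝ τ y) y :=
    hY.hasFDerivAt.comp y hd.hasFDerivAt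
  have e2 := hdd.hasFDerivAt.clm_apply hY'.hasFDerivAt
  have e3 : fderiv ℝ (fun z => Y (τ z)) y a = fderiv ℝ (fun z => fderiv ℝ τ z (Y' z)) y a := by
    rw [Filter.EventuallyEq.fderiv_eq hYY']
  rw [e1.fderiv, e2.fderiv] at e3
  simp only [ContinuousLinearMap.comp_apply, add_apply, ContinuousLinearMap.flip_apply] at e3
  simp only [coordCov, add_apply, map_add]
  rw [hG.leviCivita_pull hG' hy hτy hτ hinv h, e3, hYY'.self_of_nhds]
  abel

end IsMetricOn
end SasakiCoordinates

/-! ### Passage between a manifold and its preferred charts. -/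

section Charts

open Filter Topology

variable {F : Type*} [NormedAddCommGroup F] [NormedSpace ℝ F]
  {H : Type*} [TopologicalSpace H] {I : ModelWithCorners ℝ F H} [I.Boundaryless]
  {N : Type*} [TopologicalSpace N] [ChartedSpace H N]

theorem chartMetric_extChartAt (h : MetricField I N) {p q : N} (hq : q ∈ (extChartAt I p).source) :
    chartMetric h p (extChartAt I p q) = pullForm (h q) (chartCoord I p q).inverse := by
  rw [chartMetric, (extChartAt I p).left_inv hq]

theorem chartField_extChartAt (Y : (x : N) → TangentSpace I x) {p q : N}
    (hq : q ∈ (extChartAt I p).source) :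
    chartField I Y p (extChartAt I p q) = chartCoord I p q (Y q) := by
  rw [chartField, (extChartAt I p).left_inv hq]

section

variable [IsManifold I 1 N]

theorem chartCoord_self (p : N) : chartCoord I p p = ContinuousLinearMap.id ℝ F :=
  mfderiv_extChartAt_self

theorem chartCoord_self_apply (p : N) (x : TangentSpace I p) : chartCoord I p p x = x := by
  rw [chartCoord_self]; rfl

theorem chartCoord_self_inverse (p : N) :
    (chartCoord I p p).inverse = ContinuousLinearMap.id ℝ F := by
  rw [chartCoord_self]
  exact ContinuousLinearMap.inverse_id

theorem isInvertible_chartCoord {p q : N} (hq : q ∈ (extChartAt I p).source) :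
    (chartCoord I p q).IsInvertible :=
  isInvertible_mfderiv_extChartAt hq

theorem chartMetric_chartCoord (h : MetricField I N) {p q : N}
    (hq : q ∈ (extChartAt I p).source) (x y : TangentSpace I q) :
    chartMetric h p (extChartAt I p q) (chartCoord I p q x) (chartCoord I p q y) = h q x y := by
  rw [chartMetric_extChartAt h hq, pullForm_apply,
    (isInvertible_chartCoord hq).inverse_apply_self, (isInvertible_chartCoord hq).inverse_apply_self]

end

variable (I) in
/-- The change of coordinates from the preferred chart at `p` to the preferred chart at `q`. -/
def chartChange (p q : N) : F → F := extChartAt I q ∘ (extChartAt I p).symm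

theorem chartChange_extChartAt {p q r : N} (hr : r ∈ (extChartAt I p).source) :
    chartChange I p q (extChartAt I p r) = extChartAt I q r := by
  rw [chartChange, Function.comp_apply, (extChartAt I p).left_inv hr]

theorem eventually_extChartAt_symm {p q : N} (hq : q ∈ (extChartAt I p).source) {P : N → Prop}
    (h : ∀ᶠ r in 𝓝 q, P r) : ∀ᶠ y in 𝓝 (extChartAt I p q), P ((extChartAt I p).symm y) := by
  have := continuousAt_extChartAt_symm' hq
  rw [ContinuousAt, (extChartAt I p).left_inv hq] at this
  exact this.eventually h

theorem contDiffAt_chartChange {n : WithTop ℕ∞} [IsManifold I n N] {p q r : N}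
    (hp : r ∈ (extChartAt I p).source) (hq : r ∈ (extChartAt I q).source) :
    ContDiffAt ℝ n (chartChange I p q) (extChartAt I p r) := by
  have h := contDiffWithinAt_ext_coord_change (I := I) (n := n) q p (y := extChartAt I p r) (by
    rw [PartialEquiv.trans_source]
    refine ⟨(extChartAt I p).map_source hp, ?_⟩
    change (extChartAt I p).symm (extChartAt I p r) ∈ (extChartAt I q).source
    rwa [(extChartAt I p).left_inv hp])
  rw [I.range_eq_univ] at h
  exact h.contDiffAt univ_mem

/-- The chain rule for the coordinates of tangent vectors. -/
theorem chartCoord_eq_fderiv_chartChange [IsManifold I 1 N] {p q r : N}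
    (hp : r ∈ (extChartAt I p).source) (hq : r ∈ (extChartAt I q).source)
    (x : TangentSpace I r) :
    chartCoord I q r x = fderiv ℝ (chartChange I p q) (extChartAt I p r) (chartCoord I p r x) := by
  have hτ : DifferentiableAt ℝ (chartChange I p q) (extChartAt I p r) :=
    (contDiffAt_chartChange (n := 1) hp hq).differentiableAt (by simp)
  have h1 : HasMFDerivAt I 𝓘(ℝ, F) (extChartAt I p) r (chartCoord I p r) :=
    (mdifferentiableAt_extChartAt (by simpa using hp)).hasMFDerivAt
  have h2 := hτ.hasFDerivAt.hasMFDerivAt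
  have h3 := h2.comp r h1
  have h4 : extChartAt I q =ᶠ[𝓝 r] chartChange I p q ∘ extChartAt I p := by
    filter_upwards [(isOpen_extChartAt_source p).mem_nhds hp] with z hz
      using (chartChange_extChartAt hz).symm
  have h5 := (h3.congr_of_eventuallyEq h4).mfderiv
  rw [chartCoord, h5]
  rfl

theorem isInvertible_fderiv_chartChange [IsManifold I 1 N] {p q r : N}
    (hp : r ∈ (extChartAt I p).source) (hq : r ∈ (extChartAt I q).source) :
    (fderiv ℝ (chartChange I p q) (extChartAt I p r)).IsInvertible := by
  have h : fderiv ℝ (chartChange I p q) (extChartAt I p r) =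
      chartCoord I q r ∘L (chartCoord I p r).inverse := by
    ext a
    rw [ContinuousLinearMap.comp_apply, chartCoord_eq_fderiv_chartChange hp hq,
      (isInvertible_chartCoord hp).self_apply_inverse]
  rw [h]
  exact (isInvertible_chartCoord hq).comp (isInvertible_chartCoord hp).inverse

section Smooth

variable [IsManifold I ∞ N]

/-- The preferred trivialization of the tangent bundle at `p` is the differential of the preferred
chart, so smoothness of a section may be tested on its components in any chart around the point. -/
theorem contMDiffAt_section_iff_chartCoord (Y : (x : N) → TangentSpace I x) {p q : N}
    (hq : q ∈ (extChartAt I p).source) :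
    ContMDiffAt I I.tangent ∞ (fun r => (⟨r, Y r⟩ : TangentBundle I N)) q ↔
      ContMDiffAt I 𝓘(ℝ, F) ∞ (fun r => chartCoord I p r (Y r)) q := by
  have hq' : q ∈ (trivializationAt F (TangentSpace I) p).baseSet := by simpa using hq
  rw [ModelWithCorners.tangent]
  refine ((trivializationAt F (TangentSpace I) p).contMDiffAt_section_iff hq').trans ?_
  apply EventuallyEq.contMDiffAt_iff
  filter_upwards [(isOpen_extChartAt_source p).mem_nhds hq] with r hr
  have hr' : r ∈ (chartAt H p).source := by simpa using hr
  have h1 := TangentBundle.continuousLinearMapAt_trivializationAt (I := I) hr'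
  rw [chartCoord, ← h1, Trivialization.continuousLinearMapAt_apply,
    Trivialization.coe_linearMapAt_of_mem]
  simpa using hr

theorem contDiffAt_chartField {Y : (x : N) → TangentSpace I x} {p q : N}
    (hq : q ∈ (extChartAt I p).source)
    (hY : ContMDiffAt I I.tangent ∞ (fun r => (⟨r, Y r⟩ : TangentBundle I N)) q) :
    ContDiffAt ℝ ∞ (chartField I Y p) (extChartAt I p q) := by
  rw [contMDiffAt_section_iff_chartCoord Y hq] at hY
  rw [← contMDiffAt_iff_contDiffAt]
  have h1 : ContMDiffAt 𝓘(ℝ, F) I ∞ (extChartAt I p).symm (extChartAt I p q) :=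
    (contMDiffOn_extChartAt_symm p).contMDiffAt
      ((isOpen_extChartAt_target p).mem_nhds ((extChartAt I p).map_source hq))
  exact ContMDiffAt.comp_of_eq hY h1 ((extChartAt I p).left_inv hq)

/-- The vector field with given components in the preferred chart at `p`. -/
def fieldOfChart (I : ModelWithCorners ℝ F H) (p : N) (Y : F → F) (q : N) : TangentSpace I q :=
  (chartCoord I p q).inverse (Y (extChartAt I p q))

theorem chartCoord_fieldOfChart {p q : N} (hq : q ∈ (extChartAt I p).source) (Y : F → F) :
    chartCoord I p q (fieldOfChart I p Y q) = Y (extChartAt I p q) :=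
  (isInvertible_chartCoord hq).self_apply_inverse _

theorem contMDiffAt_fieldOfChart {p q : N} (hq : q ∈ (extChartAt I p).source) {Y : F → F}
    (hY : ContDiffAt ℝ ∞ Y (extChartAt I p q)) :
    ContMDiffAt I I.tangent ∞ (fun r => (⟨r, fieldOfChart I p Y r⟩ : TangentBundle I N)) q := by
  rw [contMDiffAt_section_iff_chartCoord _ hq]
  have h : (fun r => chartCoord I p r (fieldOfChart I p Y r)) =ᶠ[𝓝 q] Y ∘ extChartAt I p := by
    filter_upwards [(isOpen_extChartAt_source p).mem_nhds hq] with r hr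
      using chartCoord_fieldOfChart hr Y
  exact ((contMDiffAt_iff_contDiffAt.2 hY).comp q
    (contMDiffAt_extChartAt' (by simpa using hq))).congr_of_eventuallyEq h

theorem chartMetric_chartChange (h : MetricField I N) {p q r : N}
    (hp : r ∈ (extChartAt I p).source) (hq : r ∈ (extChartAt I q).source) (a b : F) :
    chartMetric h p (extChartAt I p r) a b = chartMetric h q (extChartAt I q r)
      (fderiv ℝ (chartChange I p q) (extChartAt I p r) a)
      (fderiv ℝ (chartChange I p q) (extChartAt I p r) b) := by
  obtain ⟨x, rfl⟩ := (isInvertible_chartCoord hp).surjective a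
  obtain ⟨y, rfl⟩ := (isInvertible_chartCoord hp).surjective b
  rw [← chartCoord_eq_fderiv_chartChange hp hq, ← chartCoord_eq_fderiv_chartChange hp hq,
    chartMetric_chartCoord h hp, chartMetric_chartCoord h hq]

variable [FiniteDimensional ℝ F]

theorem isMetricOn_chartMetric (g : ContMDiffRiemannianMetric I ∞ F
      (fun p : N => TangentSpace I p)) (p : N) :
    IsMetricOn (chartMetric g.inner p) (extChartAt I p).target where
  isOpen := isOpen_extChartAt_target p
  smooth := by
    rw [contDiffOn_clm_apply]; intro a
    rw [contDiffOn_clm_apply]; intro b y hy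
    apply ContDiffAt.contDiffWithinAt
    have hq : (extChartAt I p).symm y ∈ (extChartAt I p).source := (extChartAt I p).map_target hy
    -- A coefficient of the metric is its value on two fields with constant components, which are
    -- smooth sections.
    have ha (c : F) := contMDiffAt_fieldOfChart (I := I) hq (Y := fun _ => c) contDiffAt_const
    have h1 := ContMDiffAt.clm_bundle_apply₂ (IB := I) (F₃ := ℝ) (E₃ := Bundle.Trivial N ℝ)
      (F₁ := F) (F₂ := F) (b := fun r : N => r)
      (g.contMDiff ((extChartAt I p).symm y)) (ha a) (ha b)
    rw [contMDiffAt_totalSpace] at h1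
    have h2 : ContMDiffAt 𝓘(ℝ, F) I ∞ (extChartAt I p).symm y :=
      (contMDiffOn_extChartAt_symm p).contMDiffAt ((isOpen_extChartAt_target p).mem_nhds hy)
    rw [← contMDiffAt_iff_contDiffAt]
    exact ContMDiffAt.comp y h1.2 h2
  symm := by
    intro y hy a b
    exact g.symm _ _ _
  pos := by
    intro y hy a ha
    apply g.pos
    intro h
    have hq : (extChartAt I p).symm y ∈ (extChartAt I p).source := (extChartAt I p).map_target hy
    apply ha
    exact ((isInvertible_chartCoord hq).self_apply_inverse a).symm.trans
      ((congrArg (chartCoord I p _) h).trans (map_zero _))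

end Smooth
end Charts

/-! ### Iterated covariant derivatives in coordinates. -/

section CoordinateDerivatives

open Filter Topology

variable {E : Type*} [NormedAddCommGroup E] [NormedSpace ℝ E]
  {G : E → E →L[ℝ] E →L[ℝ] ℝ} {s : Set E} {y : E} [FiniteDimensional ℝ E]

theorem contDiffAt_coordCov (hG : IsMetricOn G s) (hy : y ∈ s) {Y : E → E}
    (hY : ContDiffAt ℝ ∞ Y y) : ContDiffAt ℝ ∞ (coordCov G Y) y := by
  have h1 : ContDiffAt ℝ ∞ (fderiv ℝ Y) y := hY.fderiv_right (by simp)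
  have h2 : ContDiffAt ℝ ∞ (leviCivitaL G) y :=
    hG.contDiffOn_leviCivitaL.contDiffAt (hG.isOpen.mem_nhds hy)
  exact h1.add (h2.clm_apply hY)

theorem fderiv_coordCov_apply (hG : IsMetricOn G s) (hy : y ∈ s) {Y Z : E → E}
    (hY : ContDiffAt ℝ ∞ Y y) (hZ : ContDiffAt ℝ ∞ Z y) (a : E) :
    fderiv ℝ (fun z => coordCov G Z z (Y z)) y a =
      fderiv ℝ (fderiv ℝ Z) y a (Y y) + fderiv ℝ (leviCivitaL G) y a (Z y) (Y y) +
        leviCivita G y (fderiv ℝ Z y a) (Y y) + coordCov G Z y (fderiv ℝ Y y a) := by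
  have hYd := (hY.differentiableAt (by simp)).hasFDerivAt
  have hZd := (hZ.differentiableAt (by simp)).hasFDerivAt
  have hZdd : DifferentiableAt ℝ (fderiv ℝ Z) y :=
    (hZ.fderiv_right (m := ∞) (by simp)).differentiableAt (by simp)
  have h1 := hZdd.hasFDerivAt.clm_apply hYd
  have h2 := ((hG.differentiableAt_leviCivitaL hy).hasFDerivAt.clm_apply hZd).clm_apply hYd
  have h3 := (h1.fun_add h2).fderiv
  have h4 : (fun z => coordCov G Z z (Y z)) =
      fun z => fderiv ℝ Z z (Y z) + leviCivitaL G z (Z z) (Y z) := rfl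
  rw [h4, h3]
  simp [coordCov, leviCivitaL_apply]
  abel

theorem coordCov_sub_coordCov (hG : IsMetricOn G s) (hy : y ∈ s) (X Y : E → E) :
    coordCov G Y y (X y) - coordCov G X y (Y y) =
      fderiv ℝ Y y (X y) - fderiv ℝ X y (Y y) := by
  simp only [coordCov, add_apply]
  rw [hG.leviCivita_comm hy (X y) (Y y)]
  abel

/-- The second derivatives of `Z` cancel by symmetry. The bracket term, written by torsion-freeness
as a difference of covariant derivatives, removes the first derivatives of `X` and `Y`. What remains
is tensorial in `X`, `Y` and `Z`. -/
theorem coordCov_commutator (hG : IsMetricOn G s) (hy : y ∈ s) {X Y Z : E → E}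
    (hX : ContDiffAt ℝ ∞ X y) (hY : ContDiffAt ℝ ∞ Y y) (hZ : ContDiffAt ℝ ∞ Z y) :
    coordCov G (fun z => coordCov G Z z (Y z)) y (X y) -
      coordCov G (fun z => coordCov G Z z (X z)) y (Y y) -
      coordCov G Z y (coordCov G Y y (X y) - coordCov G X y (Y y)) =
    coordCurvature G y (X y) (Y y) (Z y) := by
  have h1 := fderiv_coordCov_apply hG hy hY hZ (X y)
  have h2 := fderiv_coordCov_apply hG hy hX hZ (Y y)
  have hs := ((hZ.of_le two_le_infty).isSymmSndFDerivAt (by simp)).eq (X y) (Y y)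
  have c (W : E → E) (a : E) : coordCov G W y a = fderiv ℝ W y a + leviCivita G y (W y) a := rfl
  rw [coordCov_sub_coordCov hG hy, c, c (fun z => coordCov G Z z (X z)), h1, h2, hs, map_sub]
  have q (b c : E) : leviCivita G y (coordCov G Z y b) c =
      leviCivita G y (fderiv ℝ Z y b) c + leviCivita G y (leviCivita G y (Z y) b) c := by
    rw [coordCov, add_apply, hG.leviCivita_add_right hy]
  rw [q, q, coordCurvature]
  abel

end CoordinateDerivatives

/-! ### Covariant derivative, bracket and curvature of vector fields in an arbitrary chart. -/

section Fields

open Filter Topology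

variable {F : Type*} [NormedAddCommGroup F] [NormedSpace ℝ F]
  {H : Type*} [TopologicalSpace H] {I : ModelWithCorners ℝ F H} [I.Boundaryless]
  {N : Type*} [TopologicalSpace N] [ChartedSpace H N] [IsManifold I ∞ N]

variable (I) in
/-- A vector field that is smooth on a set. -/
def SmoothFieldOn (Y : (x : N) → TangentSpace I x) (U : Set N) : Prop :=
  ContMDiffOn I I.tangent ∞ (fun r => (⟨r, Y r⟩ : TangentBundle I N)) U

theorem SmoothFieldOn.contMDiffAt {Y : (x : N) → TangentSpace I x} {U : Set N}
    (hY : SmoothFieldOn I Y U) (hU : IsOpen U) {q : N} (hq : q ∈ U) :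
    ContMDiffAt I I.tangent ∞ (fun r => (⟨r, Y r⟩ : TangentBundle I N)) q :=
  ContMDiffOn.contMDiffAt hY (hU.mem_nhds hq)

variable [FiniteDimensional ℝ F]
  (g : ContMDiffRiemannianMetric I ∞ F (fun p : N => TangentSpace I p))

theorem covDeriv_apply_self (Y : (x : N) → TangentSpace I x) (q : N) (x : TangentSpace I q) :
    covDeriv g.inner Y q x =
      coordCov (chartMetric g.inner q) (chartField I Y q) (extChartAt I q q) x := by
  have h1 := chartCoord_self (I := I) q
  have h2 := chartCoord_self_inverse (I := I) q
  rw [covDeriv, h2, h1]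
  rw [coordCov, chartField_extChartAt Y (mem_extChartAt_source q), h1]
  rfl

/-- The covariant derivative in an arbitrary preferred chart. -/
theorem chartCoord_covDeriv {Y : (x : N) → TangentSpace I x} {p q : N}
    (hq : q ∈ (extChartAt I p).source)
    (hY : ContMDiffAt I I.tangent ∞ (fun r => (⟨r, Y r⟩ : TangentBundle I N)) q)
    (x : TangentSpace I q) :
    chartCoord I p q (covDeriv g.inner Y q x) =
      coordCov (chartMetric g.inner p) (chartField I Y p) (extChartAt I p q)
        (chartCoord I p q x) := by
  have hqq := mem_extChartAt_source (I := I) q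
  have h1 (w : F) :
      chartCoord I p q w = fderiv ℝ (chartChange I q p) (extChartAt I q q) w :=
    (chartCoord_eq_fderiv_chartChange hqq hq w).trans (congrArg _ (chartCoord_self_apply q w))
  refine (h1 _).trans (Eq.trans ?_ (congrArg _ (h1 x).symm))
  rw [covDeriv_apply_self]
  have hev : ∀ᶠ r in 𝓝 q, r ∈ (extChartAt I q).source ∩ (extChartAt I p).source :=
    ((isOpen_extChartAt_source q).inter (isOpen_extChartAt_source p)).mem_nhds ⟨hqq, hq⟩
  have hev' := eventually_extChartAt_symm hqq hev
  have htar : ∀ᶠ y in 𝓝 (extChartAt I q q), y ∈ (extChartAt I q).target :=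
    extChartAt_target_mem_nhds q
  have e := chartChange_extChartAt (I := I) (q := p) hqq
  -- The covariant derivative at `q` is defined in the preferred chart at `q`. The invariance of the
  -- coordinate formula, applied to the transition map, carries it to the chart at `p`.
  have key := (isMetricOn_chartMetric g p).coordCov_pull (isMetricOn_chartMetric g q)
    (τ := chartChange I q p) (Y := chartField I Y p) (Y' := chartField I Y q)
    (y := extChartAt I q q)
    ((extChartAt I q).map_source hqq) (by rw [e]; exact (extChartAt I p).map_source hq)
    ((contDiffAt_chartChange (n := ∞) hqq hq).of_le two_le_infty)
    (isInvertible_fderiv_chartChange hqq hq)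
    (by
      filter_upwards [hev', htar] with y hy hyt a b
      have := chartMetric_chartChange g.inner hy.1 hy.2 a b
      rwa [← chartChange_extChartAt (q := p) hy.1, (extChartAt I q).right_inv hyt] at this)
    (by rw [e]; exact (contDiffAt_chartField hq hY).differentiableAt (by simp))
    ((contDiffAt_chartField hqq hY).differentiableAt (by simp))
    (by
      filter_upwards [hev', htar] with y hy hyt
      have := chartCoord_eq_fderiv_chartChange hy.1 hy.2 (Y _)
      rw [← chartField_extChartAt Y hy.1, ← chartField_extChartAt Y hy.2,
        ← chartChange_extChartAt (q := p) hy.1,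
        (extChartAt I q).right_inv hyt] at this
      exact this) x
  rw [e] at key
  exact key

variable {U : Set N} {X Y Z : (x : N) → TangentSpace I x} {p q : N}

/-- The definition of the covariant derivative uses a different chart at each point, so it cannot be
differentiated as it stands. Here it is expressed near `q` in one fixed chart, which makes second
covariant derivatives computable. -/
theorem chartField_nabla (hU : IsOpen U) (X : (x : N) → TangentSpace I x)
    (hY : SmoothFieldOn I Y U) (hq : q ∈ (extChartAt I p).source) (hqU : q ∈ U) :
    chartField I (nabla g.inner X Y) p =ᶠ[𝓝 (extChartAt I p q)]
      fun y => coordCov (chartMetric g.inner p) (chartField I Y p) y (chartField I X p y) := by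
  have hev : ∀ᶠ r in 𝓝 q, r ∈ (extChartAt I p).source ∩ U :=
    ((isOpen_extChartAt_source p).inter hU).mem_nhds ⟨hq, hqU⟩
  filter_upwards [eventually_extChartAt_symm hq hev, extChartAt_target_mem_nhds' 
    ((extChartAt I p).map_source hq)] with y hy hyt
  have h1 := chartCoord_covDeriv g hy.1 (hY.contMDiffAt hU hy.2) (X _)
  rw [(extChartAt I p).right_inv hyt] at h1
  exact h1

theorem SmoothFieldOn.nabla (hU : IsOpen U) (hX : SmoothFieldOn I X U)
    (hY : SmoothFieldOn I Y U) : SmoothFieldOn I (nabla g.inner X Y) U := by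
  intro q hq
  apply ContMDiffAt.contMDiffWithinAt
  have hqq := mem_extChartAt_source (I := I) q
  rw [contMDiffAt_section_iff_chartCoord _ hqq]
  have h1 : ContDiffAt ℝ ∞ (chartField I (_root_.nabla g.inner X Y) q) (extChartAt I q q) := by
    refine ContDiffAt.congr_of_eventuallyEq ?_ (chartField_nabla g hU X hY hqq hq)
    exact (contDiffAt_coordCov (isMetricOn_chartMetric g q) ((extChartAt I q).map_source hqq)
      (contDiffAt_chartField hqq (hY.contMDiffAt hU hq))).clm_apply
      (contDiffAt_chartField hqq (hX.contMDiffAt hU hq))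
  refine ((contMDiffAt_iff_contDiffAt.2 h1).comp q
    (contMDiffAt_extChartAt (I := I))).congr_of_eventuallyEq ?_
  filter_upwards [extChartAt_source_mem_nhds (I := I) q] with r hr
    using (chartField_extChartAt _ hr).symm

/-- The iterated covariant derivative in an arbitrary preferred chart. -/
theorem chartCoord_nabla_nabla (hU : IsOpen U) (X : (x : N) → TangentSpace I x)
    (hY : SmoothFieldOn I Y U) (hZ : SmoothFieldOn I Z U)
    (hq : q ∈ (extChartAt I p).source) (hqU : q ∈ U) :
    chartCoord I p q (nabla g.inner X (nabla g.inner Y Z) q) =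
      coordCov (chartMetric g.inner p)
        (fun y => coordCov (chartMetric g.inner p) (chartField I Z p) y (chartField I Y p y))
        (extChartAt I p q) (chartCoord I p q (X q)) := by
  rw [nabla, chartCoord_covDeriv g hq ((hY.nabla g hU hZ).contMDiffAt hU hqU)]
  have h := chartField_nabla g hU Y hZ hq hqU
  rw [coordCov, coordCov, h.fderiv_eq, h.self_of_nhds]

/-- The Levi-Civita connection is torsion-free. -/
theorem mlieBracket_eq_nabla_sub (q : N) :
    VectorField.mlieBracket I X Y q = nabla g.inner X Y q - nabla g.inner Y X q := by
  have hqq := mem_extChartAt_source (I := I) q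
  have hG := isMetricOn_chartMetric g q
  have hy := (extChartAt I q).map_source hqq
  have e (X Y : (x : N) → TangentSpace I x) : nabla g.inner X Y q =
      coordCov (chartMetric g.inner q) (chartField I Y q) (extChartAt I q q)
        (chartField I X q (extChartAt I q q)) := by
    rw [nabla, covDeriv_apply_self, chartField_extChartAt X hqq, chartCoord_self_apply]
  -- The manifold bracket is defined through the pullback of the fields by the inverse chart. That
  -- pullback is the component function, so the bracket reduces to the one of a vector space.
  have pb (X : (x : N) → TangentSpace I x) :
      VectorField.mpullbackWithin 𝓘(ℝ, F) I (extChartAt I q).symm X (Set.range I)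
        =ᶠ[𝓝 (extChartAt I q q)] chartField I X q := by
    filter_upwards [extChartAt_target_mem_nhds q] with y hy
    rw [VectorField.mpullbackWithin_apply]
    have hr := (extChartAt I q).map_target hy
    have h1 := mfderivWithin_extChartAt_symm_comp_mfderiv_extChartAt' (I := I) hr
    rw [(extChartAt I q).right_inv hy] at h1
    have h2 := isInvertible_mfderivWithin_extChartAt_symm (I := I) hy
    rw [chartField, chartCoord]
    refine (h2.inverse_apply_eq).2 ?_
    exact (congrArg (fun A => A (X ((extChartAt I q).symm y))) h1).symm
  rw [VectorField.mlieBracket, VectorField.mlieBracketWithin_apply]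
  have h0 (w : TangentSpace 𝓘(ℝ, F) (extChartAt I q q)) :
      (mfderiv I 𝓘(ℝ, F) (extChartAt I q) q).inverse w = w :=
    congrArg (fun A => A w) (chartCoord_self_inverse (I := I) q)
  refine (h0 _).trans ?_
  have hu : (extChartAt I q).symm ⁻¹' Set.univ ∩ Set.range I = Set.univ := by
    rw [I.range_eq_univ, Set.preimage_univ, Set.univ_inter]
  rw [hu]
  have h1 : VectorField.lieBracket ℝ
      (VectorField.mpullbackWithin 𝓘(ℝ, F) I (extChartAt I q).symm X (Set.range I))
      (VectorField.mpullbackWithin 𝓘(ℝ, F) I (extChartAt I q).symm Y (Set.range I))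
      (extChartAt I q q) =
      fderiv ℝ (chartField I Y q) (extChartAt I q q) (chartField I X q (extChartAt I q q)) -
      fderiv ℝ (chartField I X q) (extChartAt I q q) (chartField I Y q (extChartAt I q q)) := by
    rw [← (pb X).fderiv_eq, ← (pb Y).fderiv_eq, ← (pb X).self_of_nhds, ← (pb Y).self_of_nhds]
    rfl
  rw [e, e]
  exact ((congrFun VectorField.lieBracketWithin_univ (extChartAt I q q)).trans h1).trans
    (coordCov_sub_coordCov hG hy _ _).symm

/-- The curvature in an arbitrary preferred chart. -/
theorem chartCoord_riemannCurvature (hU : IsOpen U) (hX : SmoothFieldOn I X U)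
    (hY : SmoothFieldOn I Y U) (hZ : SmoothFieldOn I Z U)
    (hq : q ∈ (extChartAt I p).source) (hqU : q ∈ U) :
    chartCoord I p q (riemannCurvature g.inner X Y Z q) =
      coordCurvature (chartMetric g.inner p) (extChartAt I p q) (chartCoord I p q (X q))
        (chartCoord I p q (Y q)) (chartCoord I p q (Z q)) := by
  have hG := isMetricOn_chartMetric g p
  have hy := (extChartAt I p).map_source hq
  have hX' := contDiffAt_chartField hq (hX.contMDiffAt hU hqU)
  have hY' := contDiffAt_chartField hq (hY.contMDiffAt hU hqU)
  have hZ' := contDiffAt_chartField hq (hZ.contMDiffAt hU hqU)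
  rw [riemannCurvature, map_sub, map_sub, chartCoord_nabla_nabla g hU X hY hZ hq hqU,
    chartCoord_nabla_nabla g hU Y hX hZ hq hqU]
  rw [nabla, chartCoord_covDeriv g hq (hZ.contMDiffAt hU hqU), mlieBracket_eq_nabla_sub g, map_sub,
    nabla, nabla, chartCoord_covDeriv g hq (hY.contMDiffAt hU hqU),
    chartCoord_covDeriv g hq (hX.contMDiffAt hU hqU)]
  have := coordCov_commutator hG hy hX' hY' hZ'
  rw [chartField_extChartAt X hq, chartField_extChartAt Y hq, chartField_extChartAt Z hq] at this
  exact this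

end Fields

/-! ### Charts of the tangent bundle, the connection operator and the Sasaki metric. -/

section TangentBundleCoordinates

open Filter Topology

variable {F : Type*} [NormedAddCommGroup F] [NormedSpace ℝ F]
  {H : Type*} [TopologicalSpace H] {I : ModelWithCorners ℝ F H} [I.Boundaryless]
  {N : Type*} [TopologicalSpace N] [ChartedSpace H N] [IsManifold I ∞ N]

instance tangent_boundaryless : (I.tangent).Boundaryless :=
  inferInstanceAs (I.prod 𝓘(ℝ, F)).Boundaryless

theorem trivializationAt_snd_eq_chartCoord {p q : N} (hq : q ∈ (extChartAt I p).source)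
    (x : TangentSpace I q) :
    (trivializationAt F (TangentSpace I) p (⟨q, x⟩ : TangentBundle I N)).2 = chartCoord I p q x := by
  have hr' : q ∈ (chartAt H p).source := by simpa using hq
  have h1 := TangentBundle.continuousLinearMapAt_trivializationAt (I := I) hr'
  rw [chartCoord, ← h1, Trivialization.continuousLinearMapAt_apply,
    Trivialization.coe_linearMapAt_of_mem]
  simpa using hr'

theorem extChartAt_tangent_apply (z : TangentBundle I N) {w : TangentBundle I N}
    (hw : w.1 ∈ (extChartAt I z.1).source) :
    extChartAt I.tangent z w = (extChartAt I z.1 w.1, fibreCoord I z.1 w) := by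
  have h : extChartAt I.tangent z w = (extChartAt I z.1 w.1,
      (trivializationAt F (TangentSpace I) z.1 w).2) := by
    rw [ModelWithCorners.tangent, FiberBundle.extChartAt]
    rfl
  rw [h]
  exact congrArg _ (trivializationAt_snd_eq_chartCoord hw w.2)

theorem mem_extChartAt_tangent_source {z w : TangentBundle I N} :
    w ∈ (extChartAt I.tangent z).source ↔ w.1 ∈ (extChartAt I z.1).source := by
  rw [extChartAt_source, extChartAt_source, TangentBundle.mem_chart_source_iff]

theorem mdifferentiableAt_fibreCoord {p : N} {w : TangentBundle I N}
    (hw : w.1 ∈ (extChartAt I p).source) :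
    MDifferentiableAt I.tangent 𝓘(ℝ, F) (fibreCoord I p) w := by
  have h1 : ContMDiffAt I.tangent (I.prod 𝓘(ℝ, F)) 1 (id : TangentBundle I N → _) w := contMDiffAt_id
  have h2 := ((trivializationAt F (TangentSpace I) p).contMDiffAt_iff (f := id)
    (x₀ := w) (by simpa using hw)).1 h1
  refine (h2.2.mdifferentiableAt (by simp)).congr_of_eventuallyEq ?_
  have : ∀ᶠ w' in 𝓝 w, w'.1 ∈ (extChartAt I p).source :=
    (FiberBundle.continuous_proj F (TangentSpace I : N → Type _)).continuousAt.eventually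
      ((isOpen_extChartAt_source p).mem_nhds hw)
  filter_upwards [this] with w' hw' using (trivializationAt_snd_eq_chartCoord hw' w'.2).symm

theorem eventually_proj_mem_source {p : N} {w : TangentBundle I N}
    (hw : w.1 ∈ (extChartAt I p).source) : ∀ᶠ w' in 𝓝 w, w'.1 ∈ (extChartAt I p).source :=
  (FiberBundle.continuous_proj F (TangentSpace I : N → Type _)).continuousAt.eventually
    ((isOpen_extChartAt_source p).mem_nhds hw)

/-- The components of tangent vectors to the tangent bundle. -/
theorem chartCoord_tangent_apply {z w : TangentBundle I N}
    (hw : w.1 ∈ (extChartAt I z.1).source) (ξ : TangentSpace I.tangent w) :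
    chartCoord I.tangent z w ξ =
      (chartCoord I z.1 w.1 (projDeriv w ξ), mfderiv I.tangent 𝓘(ℝ, F) (fibreCoord I z.1) w ξ) := by
  have h0 : MDifferentiableAt I.tangent I (TotalSpace.proj : TangentBundle I N → N) w :=
    (Bundle.contMDiff_proj (n := 1) (IB := I) (F := F)
      (TangentSpace I : N → Type _)).contMDiffAt.mdifferentiableAt (by simp)
  have h1 : HasMFDerivAt I.tangent 𝓘(ℝ, F) (fun w : TangentBundle I N => extChartAt I z.1 w.1) w
      ((chartCoord I z.1 w.1).comp (projDeriv w)) :=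
    HasMFDerivAt.comp (I' := I) (g := extChartAt I z.1) w
      (mdifferentiableAt_extChartAt (by simpa using hw)).hasMFDerivAt h0.hasMFDerivAt
  have h2 := (mdifferentiableAt_fibreCoord hw).hasMFDerivAt
  have h3 : HasMFDerivAt I.tangent 𝓘(ℝ, F × F)
      (fun w : TangentBundle I N => (extChartAt I z.1 w.1, fibreCoord I z.1 w)) w
      (((chartCoord I z.1 w.1).comp (projDeriv w)).prod
        (mfderiv I.tangent 𝓘(ℝ, F) (fibreCoord I z.1) w)) :=
    ⟨h1.1.prodMk h2.1, h1.2.prodMk h2.2⟩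
  have h4 : extChartAt I.tangent z =ᶠ[𝓝 w]
      fun w => (extChartAt I z.1 w.1, fibreCoord I z.1 w) := by
    filter_upwards [eventually_proj_mem_source hw] with w' hw' using extChartAt_tangent_apply z hw'
  have h5 := (h3.congr_of_eventuallyEq h4).mfderiv
  exact congrArg (fun A => A ξ) h5

theorem fibreCoord_eq_fderiv_chartChange {p q : N} {w : TangentBundle I N}
    (hp : w.1 ∈ (extChartAt I p).source) (hq : w.1 ∈ (extChartAt I q).source) :
    fibreCoord I q w = fderiv ℝ (chartChange I p q) (extChartAt I p w.1) (fibreCoord I p w) :=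
  chartCoord_eq_fderiv_chartChange hp hq w.2

/-- Fibre coordinates change by the differential of the transition map τ, which varies with the base
point. The product rule therefore adds a term with the second derivative of τ. -/
theorem mfderiv_fibreCoord_apply {z w : TangentBundle I N} {q : N}
    (hp : w.1 ∈ (extChartAt I z.1).source) (hq : w.1 ∈ (extChartAt I q).source)
    (ξ : TangentSpace I.tangent w) :
    mfderiv I.tangent 𝓘(ℝ, F) (fibreCoord I q) w ξ =
      fderiv ℝ (fderiv ℝ (chartChange I z.1 q)) (extChartAt I z.1 w.1)
        (chartCoord I.tangent z w ξ).1 (fibreCoord I z.1 w) +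
      fderiv ℝ (chartChange I z.1 q) (extChartAt I z.1 w.1) (chartCoord I.tangent z w ξ).2 := by
  have hτ : DifferentiableAt ℝ (fderiv ℝ (chartChange I z.1 q)) (extChartAt I z.1 w.1) :=
    ((contDiffAt_chartChange (n := ∞) hp hq).fderiv_right (m := ∞) (by simp)).differentiableAt
      (by simp)
  have e := extChartAt_tangent_apply z hp
  have hf : HasFDerivAt (fun c : F × F => fderiv ℝ (chartChange I z.1 q) c.1)
      (fderiv ℝ (fderiv ℝ (chartChange I z.1 q)) (extChartAt I z.1 w.1) ∘L
        ContinuousLinearMap.fst ℝ F F) (extChartAt I.tangent z w) := by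
    rw [e]
    exact HasFDerivAt.comp (x := (extChartAt I z.1 w.1, fibreCoord I z.1 w)) (f := Prod.fst)
      (g := fderiv ℝ (chartChange I z.1 q)) hτ.hasFDerivAt hasFDerivAt_fst
  have h1 := (hf.clm_apply hasFDerivAt_snd).hasMFDerivAt
  have h2 : HasMFDerivAt I.tangent 𝓘(ℝ, F × F) (extChartAt I.tangent z) w
      (chartCoord I.tangent z w) :=
    (mdifferentiableAt_extChartAt (by
      simpa using mem_extChartAt_tangent_source.2 hp)).hasMFDerivAt
  have h3 := h1.comp w h2
  have h4 : fibreCoord I q =ᶠ[𝓝 w] (fun c : F × F => fderiv ℝ (chartChange I z.1 q) c.1 c.2) ∘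
      extChartAt I.tangent z := by
    filter_upwards [eventually_proj_mem_source hp, eventually_proj_mem_source hq] with w' hp' hq'
    rw [Function.comp_apply, extChartAt_tangent_apply z hp']
    exact fibreCoord_eq_fderiv_chartChange hp' hq'
  have h5 := congrArg (fun A => A ξ) (h3.congr_of_eventuallyEq h4).mfderiv
  refine h5.trans ?_
  rw [e]
  exact add_comm _ _

theorem eventually_chartMetric_chartChange (h : MetricField I N) {p q r : N}
    (hp : r ∈ (extChartAt I p).source) (hq : r ∈ (extChartAt I q).source) :
    ∀ᶠ y in 𝓝 (extChartAt I p r), ∀ a b, chartMetric h p y a b =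
      chartMetric h q (chartChange I p q y) (fderiv ℝ (chartChange I p q) y a)
        (fderiv ℝ (chartChange I p q) y b) := by
  filter_upwards [eventually_extChartAt_symm hp
    (((isOpen_extChartAt_source p).inter (isOpen_extChartAt_source q)).mem_nhds ⟨hp, hq⟩),
    extChartAt_target_mem_nhds' ((extChartAt I p).map_source hp)] with y hy hyt a b
  have := chartMetric_chartChange h hy.1 hy.2 a b
  rwa [← chartChange_extChartAt (q := q) hy.1, (extChartAt I p).right_inv hyt] at this

variable [FiniteDimensional ℝ F]
  (g : ContMDiffRiemannianMetric I ∞ F (fun p : N => TangentSpace I p))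

/-- The second derivative of the transition map in the change of fibre coordinates is exactly the
inhomogeneous term in the transformation law of the Christoffel symbols. Hence K, defined pointwise
in the chart at the base point, has the same expression in every chart. -/
theorem chartCoord_connectionMap {z w : TangentBundle I N}
    (hw : w.1 ∈ (extChartAt I z.1).source) (ξ : TangentSpace I.tangent w) :
    chartCoord I z.1 w.1 (connectionMap g.inner w ξ) =
      coordConnection (chartMetric g.inner z.1) (extChartAt I z.1 w.1) (fibreCoord I z.1 w)
        (chartCoord I.tangent z w ξ) := by
  have hww := mem_extChartAt_source (I := I) w.1
  have e := chartChange_extChartAt (I := I) (q := w.1) hw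
  apply (isInvertible_fderiv_chartChange hw hww).injective
  rw [← chartCoord_eq_fderiv_chartChange hw hww]
  obtain ⟨D, hD⟩ : ∃ D : F, D = mfderiv I.tangent 𝓘(ℝ, F) (fibreCoord I w.1) w ξ := ⟨_, rfl⟩
  have h1 : chartCoord I w.1 w.1 (connectionMap g.inner w ξ) =
      D + leviCivita (chartMetric g.inner w.1) (extChartAt I w.1 w.1) (chartCoord I w.1 w.1 w.2)
        (chartCoord I w.1 w.1 (projDeriv w ξ)) := by
    rw [hD]
    exact (isInvertible_chartCoord hww).self_apply_inverse _
  rw [h1, hD.trans (mfderiv_fibreCoord_apply hw hww ξ)]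
  have h3 := (isMetricOn_chartMetric g w.1).leviCivita_pull (isMetricOn_chartMetric g z.1)
    (y := extChartAt I z.1 w.1) (τ := chartChange I z.1 w.1) ((extChartAt I z.1).map_source hw)
    (by rw [e]; exact (extChartAt I w.1).map_source hww)
    ((contDiffAt_chartChange (n := ∞) hw hww).of_le two_le_infty)
    (isInvertible_fderiv_chartChange hw hww) (eventually_chartMetric_chartChange g.inner hw hww)
    (chartCoord I z.1 w.1 (projDeriv w ξ)) (fibreCoord I z.1 w)
  rw [← fibreCoord_eq_fderiv_chartChange hw hww, ← chartCoord_eq_fderiv_chartChange hw hww, e] at h3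
  have h4 := congrArg Prod.fst (chartCoord_tangent_apply hw ξ)
  simp only at h4
  rw [coordConnection_apply, map_add, h4, h3]
  simp only [fibreCoord]
  abel

/-- Identifies the Sasaki metric on a whole chart domain, and not just at the centre. The
derivatives that enter its Christoffel symbols can thus be taken from the coordinate model. -/
theorem chartMetric_sasakiMetric {z : TangentBundle I N} {c : F × F}
    (hc : c ∈ (extChartAt I.tangent z).target) :
    chartMetric (sasakiMetric g.inner) z c = coordSasaki (chartMetric g.inner z.1) c := by
  have hw := (extChartAt I.tangent z).map_target hc
  obtain ⟨w, hwdef⟩ : ∃ w, w = (extChartAt I.tangent z).symm c := ⟨_, rfl⟩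
  rw [← hwdef] at hw
  have hw' := mem_extChartAt_tangent_source.1 hw
  have hcw : c = extChartAt I.tangent z w := by rw [hwdef, (extChartAt I.tangent z).right_inv hc]
  refine ContinuousLinearMap.ext fun a => ContinuousLinearMap.ext fun b => ?_
  obtain ⟨ξ, rfl⟩ := (isInvertible_chartCoord hw).surjective a
  obtain ⟨η, rfl⟩ := (isInvertible_chartCoord hw).surjective b
  rw [hcw, chartMetric_chartCoord _ hw]
  have h1 (ξ : TangentSpace I.tangent w) := congrArg Prod.fst (chartCoord_tangent_apply hw' ξ)
  have h2 (ξ : TangentSpace I.tangent w) := chartCoord_connectionMap g hw' ξ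
  simp only [coordConnection_apply] at h1 h2
  rw [coordSasaki_apply, extChartAt_tangent_apply z hw']
  dsimp only
  rw [← h2, ← h2, h1, h1, chartMetric_chartCoord _ hw', chartMetric_chartCoord _ hw']
  rfl

end TangentBundleCoordinates

/-! ### Normal components, and traces of bilinear maps. -/

section NormalPart

variable {V : Type*} [TopologicalSpace V] [AddCommGroup V] [Module ℝ V] [FiniteDimensional ℝ V]
  {B : V →L[ℝ] V →L[ℝ] ℝ}

/-- Positivity makes the map from `W` to its dual injective, hence bijective, so the functional
defined by `ξ` on `W` is represented by an element of `W`; subtract it from `ξ`. -/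
theorem exists_normalPart (hB : ∀ x, x ≠ 0 → 0 < B x x) (W : Submodule ℝ V) (ξ : V) :
    ∃ n : V, (∀ w ∈ W, B n w = 0) ∧ ξ - n ∈ W := by
  let A : V →ₗ[ℝ] Module.Dual ℝ W :=
    { toFun := fun x => (B x).toLinearMap ∘ₗ W.subtype
      map_add' := by intro x y; ext; simp
      map_smul' := by intro x y; ext; simp }
  have hinj : Function.Injective (A ∘ₗ W.subtype) := by
    rw [← LinearMap.ker_eq_bot, LinearMap.ker_eq_bot']
    intro w hw
    by_contra h0
    have h1 := hB w (by simpa using h0)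
    have h2 : B w w = 0 := congrArg (fun φ => φ w) hw
    linarith
  have hsurj : Function.Surjective (A ∘ₗ W.subtype) :=
    (LinearMap.injective_iff_surjective_of_finrank_eq_finrank
      (Subspace.dual_finrank_eq).symm).1 hinj
  obtain ⟨w, hw⟩ := hsurj (A ξ)
  refine ⟨ξ - w, fun u hu => ?_, by simp⟩
  have h : B w u = B ξ u := congrArg (fun φ => φ ⟨u, hu⟩) hw
  rw [map_sub, sub_apply, h, sub_self]

theorem normalPart_spec (hB : ∀ x, x ≠ 0 → 0 < B x x) (W : Submodule ℝ V) (ξ : V) :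
    (∀ w ∈ W, B (normalPart B W ξ) w = 0) ∧ ξ - normalPart B W ξ ∈ W :=
  Classical.epsilon_spec (exists_normalPart hB W ξ)

/-- Two candidates differ by a vector that lies in `W` and is orthogonal to `W`. As `normalPart` is
an arbitrary choice, this uniqueness is the source of its linearity. -/
theorem normalPart_eq (hB : ∀ x, x ≠ 0 → 0 < B x x) {W : Submodule ℝ V} {ξ n : V}
    (h1 : ∀ w ∈ W, B n w = 0) (h2 : ξ - n ∈ W) : normalPart B W ξ = n := by
  obtain ⟨h3, h4⟩ := normalPart_spec hB W ξ
  have h5 : normalPart B W ξ - n ∈ W := by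
    have := W.sub_mem h2 h4
    rwa [sub_sub_sub_cancel_left] at this
  by_contra h0
  have h6 := hB _ (sub_ne_zero.2 h0)
  rw [show B (normalPart B W ξ - n) = B (normalPart B W ξ) - B n from map_sub _ _ _, sub_apply,
    h3 _ h5, h1 _ h5, sub_zero] at h6
  exact lt_irrefl _ h6

theorem normalPart_add (hB : ∀ x, x ≠ 0 → 0 < B x x) (W : Submodule ℝ V) (ξ η : V) :
    normalPart B W (ξ + η) = normalPart B W ξ + normalPart B W η := by
  obtain ⟨h1, h2⟩ := normalPart_spec hB W ξ
  obtain ⟨h3, h4⟩ := normalPart_spec hB W η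
  refine normalPart_eq hB (fun w hw => ?_) ?_
  · rw [map_add, add_apply, h1 w hw, h3 w hw, add_zero]
  · rw [add_sub_add_comm]
    exact W.add_mem h2 h4

theorem normalPart_smul (hB : ∀ x, x ≠ 0 → 0 < B x x) (W : Submodule ℝ V) (t : ℝ) (ξ : V) :
    normalPart B W (t • ξ) = t • normalPart B W ξ := by
  obtain ⟨h1, h2⟩ := normalPart_spec hB W ξ
  refine normalPart_eq hB (fun w hw => ?_) ?_
  · rw [map_smul, smul_apply, h1 w hw, smul_zero]
  · rw [← smul_sub]
    exact W.smul_mem t h2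

theorem normalPart_eq_zero_iff (hB : ∀ x, x ≠ 0 → 0 < B x x) {W : Submodule ℝ V} {ξ : V} :
    normalPart B W ξ = 0 ↔ ξ ∈ W := by
  refine ⟨fun h => ?_, fun h => normalPart_eq hB (by simp) (by simpa using h)⟩
  have := (normalPart_spec hB W ξ).2
  rwa [h, sub_zero] at this

theorem normalPart_congr (hB : ∀ x, x ≠ 0 → 0 < B x x) {W : Submodule ℝ V} {ξ η : V}
    (h : ξ - η ∈ W) : normalPart B W ξ = normalPart B W η := by
  have h1 := normalPart_add hB W (ξ - η) η
  rwa [sub_add_cancel, (normalPart_eq_zero_iff hB).2 h, zero_add] at h1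

/-- The trace of a bilinear map, computed in an arbitrary basis and in an orthonormal one. -/
theorem sum_inv_gram_smul {n : ℕ} {V W : Type*} [AddCommGroup V] [Module ℝ V] [AddCommGroup W]
    [Module ℝ W] (k : V →ₗ[ℝ] V →ₗ[ℝ] ℝ) (α : V →ₗ[ℝ] V →ₗ[ℝ] W)
    (b : Module.Basis (Fin n) ℝ V) (e : Fin n → V)
    (he : ∀ i j, k (e i) (e j) = if i = j then 1 else 0) :
    ∑ i, ∑ j, (Matrix.of fun i j => k (b i) (b j))⁻¹ i j • α (b i) (b j) =
      ∑ a, α (e a) (e a) := by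
  set K : Matrix (Fin n) (Fin n) ℝ := Matrix.of fun i j => k (b i) (b j) with hK
  let P : Matrix (Fin n) (Fin n) ℝ := Matrix.of fun a j => b.repr (e a) j
  have hP (a : Fin n) : e a = ∑ j, P a j • b j := (b.sum_repr (e a)).symm
  -- Orthonormality in matrix form, with the frame components as the rows of `P`. It gives K⁻¹ = Pᵀ
  -- P, and the trace formula is then a rearrangement of sums.
  have h1 : P * (K * P.transpose) = 1 := by
    ext a c
    rw [Matrix.one_apply, ← he a c, hP a, hP c, Matrix.mul_apply]
    simp only [Matrix.mul_apply, map_sum, map_smul, LinearMap.sum_apply, LinearMap.smul_apply,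
      smul_eq_mul, Matrix.transpose_apply, hK, Matrix.of_apply]
    simp only [Finset.mul_sum, P, Matrix.of_apply]
    rw [Finset.sum_comm]
    refine Finset.sum_congr rfl fun i _ => Finset.sum_congr rfl fun j _ => ?_
    ring
  have h2 : K⁻¹ = P.transpose * P := by
    apply Matrix.inv_eq_right_inv
    rw [← Matrix.mul_assoc]
    exact mul_eq_one_comm.1 h1
  have h3 (a : Fin n) : α (e a) (e a) = ∑ i, ∑ j, (P a i * P a j) • α (b i) (b j) := by
    rw [hP a]
    simp only [map_sum, map_smul, LinearMap.sum_apply, LinearMap.smul_apply, Finset.smul_sum,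
      smul_smul]
    rw [Finset.sum_comm]
    refine Finset.sum_congr rfl fun i _ => Finset.sum_congr rfl fun j _ => ?_
    rw [mul_comm]
  simp only [h2, h3, Matrix.mul_apply, Matrix.transpose_apply, Finset.sum_smul]
  rw [Finset.sum_comm]
  refine Eq.trans (Finset.sum_congr rfl fun i _ => Finset.sum_comm) ?_
  rw [Finset.sum_comm]
  refine Finset.sum_congr rfl fun a _ => ?_
  rw [Finset.sum_comm]

end NormalPart

/-! ### The section of a vector field: its differential and its second derivative. -/

section SectionGeometry

open Filter Topology

variable {F : Type*} [NormedAddCommGroup F] [NormedSpace ℝ F] [FiniteDimensional ℝ F]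
  {H : Type*} [TopologicalSpace H] {I : ModelWithCorners ℝ F H} [I.Boundaryless]
  {N : Type*} [TopologicalSpace N] [ChartedSpace H N] [IsManifold I ∞ N]
  (g : ContMDiffRiemannianMetric I ∞ F (fun p : N => TangentSpace I p))

instance finiteDimensional_tangentSpace (p : N) : FiniteDimensional ℝ (TangentSpace I p) :=
  inferInstanceAs (FiniteDimensional ℝ F)

instance finiteDimensional_tangentSpace_tangent (z : TangentBundle I N) :
    FiniteDimensional ℝ (TangentSpace I.tangent z) :=
  inferInstanceAs (FiniteDimensional ℝ (F × F))

theorem projDeriv_apply (z : TangentBundle I N) (ξ : TangentSpace I.tangent z) :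
    projDeriv z ξ = (show F × F from ξ).1 := by
  have hz := mem_extChartAt_source (I := I) z.1
  have h1 := chartCoord_tangent_apply hz ξ
  have h2 := (chartCoord_self_apply z ξ).symm.trans h1
  exact ((congrArg Prod.fst h2).trans (chartCoord_self_apply z.1 (projDeriv z ξ))).symm

theorem connectionMap_apply (z : TangentBundle I N) (ξ : TangentSpace I.tangent z) :
    connectionMap g.inner z ξ =
      coordConnection (chartMetric g.inner z.1) (extChartAt I z.1 z.1) z.2 ξ := by
  have hz := mem_extChartAt_source (I := I) z.1
  have h1 := chartCoord_connectionMap g hz ξ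
  refine (chartCoord_self_apply z.1 (connectionMap g.inner z ξ)).symm.trans (h1.trans ?_)
  rw [fibreCoord, chartCoord_self_apply]
  exact congrArg _ (chartCoord_self_apply z ξ)

/-- In the preferred chart the map is the shear (a, α) ↦ (a, α + Γ(a, u)), and the opposite shear
inverts it. -/
theorem horVerSplit_bijective (z : TangentBundle I N) :
    (horVerSplit g.inner z).IsInvertible := by
  let Γ := leviCivita (chartMetric g.inner z.1) (extChartAt I z.1 z.1) z.2
  let A : F × F →L[ℝ] F × F := (ContinuousLinearMap.fst ℝ F F).prod
    (ContinuousLinearMap.snd ℝ F F - Γ ∘L ContinuousLinearMap.fst ℝ F F)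
  have h (ξ : TangentSpace I.tangent z) : horVerSplit g.inner z ξ =
      ((show F × F from ξ).1, (show F × F from ξ).2 + Γ (show F × F from ξ).1) :=
    Prod.ext (projDeriv_apply z ξ) (connectionMap_apply g z ξ)
  refine ContinuousLinearMap.IsInvertible.of_inverse (g := A) ?_ ?_
  · refine ContinuousLinearMap.ext fun x => ?_
    refine (h (A x)).trans ?_
    exact Prod.ext rfl (sub_add_cancel (G := F) _ _)
  · refine ContinuousLinearMap.ext fun x => ?_
    refine (congrArg A (h x)).trans ?_
    exact Prod.ext rfl (add_sub_cancel_right (G := F) _ _)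

theorem horLift_add_verLift (z : TangentBundle I N) (X Y : TangentSpace I z.1) :
    horLift g.inner z X + verLift g.inner z Y = (horVerSplit g.inner z).inverse (X, Y) := by
  rw [horLift, verLift, ← map_add]
  simp

theorem horVerSplit_lift (z : TangentBundle I N) (X Y : TangentSpace I z.1) :
    horVerSplit g.inner z (horLift g.inner z X + verLift g.inner z Y) = (X, Y) := by
  rw [horLift_add_verLift, (horVerSplit_bijective g z).self_apply_inverse]

theorem sasakiMetric_apply (z : TangentBundle I N) (ξ η : TangentSpace I.tangent z) :
    sasakiMetric g.inner z ξ η =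
      g.inner z.1 (horVerSplit g.inner z ξ).1 (horVerSplit g.inner z η).1 +
      g.inner z.1 (horVerSplit g.inner z ξ).2 (horVerSplit g.inner z η).2 := rfl

theorem sasakiMetric_pos (z : TangentBundle I N) (ξ : TangentSpace I.tangent z) (hξ : ξ ≠ 0) :
    0 < sasakiMetric g.inner z ξ ξ := by
  have nn (a : TangentSpace I z.1) : 0 ≤ g.inner z.1 a a := by
    by_cases h : a = 0
    · simp [h]
    · exact (g.pos _ a h).le
  rw [sasakiMetric_apply]
  by_cases h : (horVerSplit g.inner z ξ).1 = 0
  · refine add_pos_of_nonneg_of_pos (nn _) (g.pos _ _ fun h2 => hξ ?_)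
    apply (horVerSplit_bijective g z).injective
    rw [map_zero]
    exact Prod.ext h h2
  · exact add_pos_of_pos_of_nonneg (g.pos _ _ h) (nn _)

variable {v : (p : N) → TangentSpace I p}

theorem mdifferentiableAt_sectionMap {p : N}
    (hv : ContMDiffAt I I.tangent ∞ (fun p => (⟨p, v p⟩ : TangentBundle I N)) p) :
    MDifferentiableAt I I.tangent (sectionMap v) p :=
  hv.mdifferentiableAt (by simp)

theorem writtenInExtChartAt_sectionMap (v : (p : N) → TangentSpace I p) (p : N) :
    ∀ᶠ y in 𝓝 (extChartAt I p p),
      writtenInExtChartAt I I.tangent p (sectionMap v) y = (y, chartField I v p y) := by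
  filter_upwards [extChartAt_target_mem_nhds p] with y hy
  have hr := (extChartAt I p).map_target hy
  have h := extChartAt_tangent_apply (sectionMap v p) (w := sectionMap v ((extChartAt I p).symm y)) hr
  refine h.trans ?_
  exact Prod.ext ((extChartAt I p).right_inv hy) rfl

theorem fderiv_writtenInExtChartAt_sectionMap {p : N}
    (hv : ContMDiffAt I I.tangent ∞ (fun p => (⟨p, v p⟩ : TangentBundle I N)) p) :
    fderiv ℝ (writtenInExtChartAt I I.tangent p (sectionMap v)) (extChartAt I p p) =
      (ContinuousLinearMap.id ℝ F).prod (fderiv ℝ (chartField I v p) (extChartAt I p p)) := by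
  have h1 : writtenInExtChartAt I I.tangent p (sectionMap v) =ᶠ[𝓝 (extChartAt I p p)]
    fun y => (y, chartField I v p y) := writtenInExtChartAt_sectionMap v p
  have h2 := (contDiffAt_chartField (mem_extChartAt_source p) hv).differentiableAt (by simp)
  rw [h1.fderiv_eq]
  exact ((hasFDerivAt_id (𝕜 := ℝ) (extChartAt I p p)).prodMk h2.hasFDerivAt).fderiv

theorem mfderiv_sectionMap_apply {p : N}
    (hv : ContMDiffAt I I.tangent ∞ (fun p => (⟨p, v p⟩ : TangentBundle I N)) p)
    (x : TangentSpace I p) :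
    mfderiv I I.tangent (sectionMap v) p x =
      ((show F from x), fderiv ℝ (chartField I v p) (extChartAt I p p) x) := by
  rw [(mdifferentiableAt_sectionMap hv).mfderiv, I.range_eq_univ, fderivWithin_univ,
    fderiv_writtenInExtChartAt_sectionMap hv]
  rfl

theorem horVerSplit_mfderiv_sectionMap {p : N}
    (hv : ContMDiffAt I I.tangent ∞ (fun p => (⟨p, v p⟩ : TangentBundle I N)) p)
    (x : TangentSpace I p) :
    horVerSplit g.inner (sectionMap v p) (mfderiv I I.tangent (sectionMap v) p x) =
      (x, covDeriv g.inner v p x) := by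
  refine Prod.ext ?_ ?_
  · refine (projDeriv_apply _ _).trans ?_
    rw [mfderiv_sectionMap_apply hv]
  · refine (connectionMap_apply g _ _).trans ?_
    rw [mfderiv_sectionMap_apply hv, covDeriv_apply_self, coordCov,
      chartField_extChartAt v (mem_extChartAt_source p), chartCoord_self_apply]
    rfl

theorem leviCivita_congr {E : Type*} [NormedAddCommGroup E] [NormedSpace ℝ E]
    {G G' : E → E →L[ℝ] E →L[ℝ] ℝ} {y : E} (h : G =ᶠ[𝓝 y] G') :
    leviCivita G y = leviCivita G' y := by
  funext b
  rw [leviCivita, leviCivita, h.fderiv_eq, h.self_of_nhds]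

theorem fderiv_fderiv_writtenInExtChartAt_sectionMap {p : N}
    (hv : ContMDiffAt I I.tangent ∞ (fun p => (⟨p, v p⟩ : TangentBundle I N)) p) (a b : F) :
    fderiv ℝ (fderiv ℝ (writtenInExtChartAt I I.tangent p (sectionMap v))) (extChartAt I p p) a b =
      (0, fderiv ℝ (fderiv ℝ (chartField I v p)) (extChartAt I p p) a b) := by
  have hV := contDiffAt_chartField (mem_extChartAt_source p) hv
  have h1 : writtenInExtChartAt I I.tangent p (sectionMap v) =ᶠ[𝓝 (extChartAt I p p)]
    fun y => (y, chartField I v p y) := writtenInExtChartAt_sectionMap v p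
  have h2 : ContDiffAt ℝ ∞ (writtenInExtChartAt I I.tangent p (sectionMap v)) (extChartAt I p p) :=
    (contDiffAt_id.prodMk hV).congr_of_eventuallyEq h1
  have h3 : DifferentiableAt ℝ (fderiv ℝ (writtenInExtChartAt I I.tangent p (sectionMap v)))
      (extChartAt I p p) := (h2.fderiv_right (m := ∞) (by simp)).differentiableAt (by simp)
  have h4 : DifferentiableAt ℝ (fderiv ℝ (chartField I v p)) (extChartAt I p p) :=
    (hV.fderiv_right (m := ∞) (by simp)).differentiableAt (by simp)
  have h5 : (fun y => fderiv ℝ (writtenInExtChartAt I I.tangent p (sectionMap v)) y b)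
      =ᶠ[𝓝 (extChartAt I p p)] fun y => (b, fderiv ℝ (chartField I v p) y b) := by
    have hd : ∀ᶠ y in 𝓝 (extChartAt I p p), DifferentiableAt ℝ (chartField I v p) y := by
      filter_upwards [(hV.of_le (m := 1) (by exact_mod_cast le_top)).eventually (by simp)] with y hy
      exact hy.differentiableAt (by simp)
    filter_upwards [h1.eventually_nhds, hd] with y hy hyd
    rw [Filter.EventuallyEq.fderiv_eq hy]
    have h : fderiv ℝ (fun y => (y, chartField I v p y)) y =
        (ContinuousLinearMap.id ℝ F).prod (fderiv ℝ (chartField I v p) y) :=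
      ((hasFDerivAt_id (𝕜 := ℝ) y).prodMk hyd.hasFDerivAt).fderiv
    exact DFunLike.congr_fun h b
  have h6 := DFunLike.congr_fun (h5.fderiv_eq (𝕜 := ℝ)) a
  rw [(h3.hasFDerivAt.clm_apply (hasFDerivAt_const b _)).fderiv,
    ((hasFDerivAt_const b _).prodMk (h4.hasFDerivAt.clm_apply (hasFDerivAt_const b _))).fderiv] at h6
  simp only [add_apply, ContinuousLinearMap.comp_apply, ContinuousLinearMap.prod_apply,
    ContinuousLinearMap.flip_apply, zero_apply, map_zero, zero_add] at h6
  exact h6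

theorem ambientDeriv_sectionMap_self {p : N}
    (hv : ContMDiffAt I I.tangent ∞ (fun p => (⟨p, v p⟩ : TangentBundle I N)) p) (x : F) :
    ambientDeriv (I := I) (sasakiMetric g.inner) (sectionMap v) p x x =
      ((0, fderiv ℝ (fderiv ℝ (chartField I v p)) (extChartAt I p p) x x) +
        leviCivita (coordSasaki (chartMetric g.inner p)) (extChartAt I p p, chartField I v p (extChartAt I p p))
          (x, fderiv ℝ (chartField I v p) (extChartAt I p p) x)
          (x, fderiv ℝ (chartField I v p) (extChartAt I p p) x) : F × F) := by
  have hpp := mem_extChartAt_source (I := I) p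
  have e : extChartAt I.tangent (sectionMap v p) (sectionMap v p) =
      ((extChartAt I p p, chartField I v p (extChartAt I p p)) : F × F) :=
    (extChartAt_tangent_apply (sectionMap v p) (w := sectionMap v p) hpp).trans
      (Prod.ext rfl (chartField_extChartAt v hpp).symm)
  have h1 : christoffel (sasakiMetric g.inner) (sectionMap v p)
      (extChartAt I.tangent (sectionMap v p) (sectionMap v p)) =
      leviCivita (coordSasaki (chartMetric g.inner p)) (extChartAt I p p, chartField I v p (extChartAt I p p)) := by
    rw [← e]
    refine leviCivita_congr (G := chartMetric (sasakiMetric g.inner) (sectionMap v p)) ?_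
    filter_upwards [extChartAt_target_mem_nhds (I := I.tangent) (sectionMap v p)] with c hc
      using chartMetric_sasakiMetric g hc
  have h2 (w : F × F) : (chartCoord I.tangent (sectionMap v p) (sectionMap v p)).inverse w = w :=
    congrArg (fun A => A w) (chartCoord_self_inverse (I := I.tangent) (sectionMap v p))
  refine (h2 _).trans ?_
  have h3 : fderiv ℝ (writtenInExtChartAt I I.tangent p (sectionMap v)) (extChartAt I p p) x =
      (x, fderiv ℝ (chartField I v p) (extChartAt I p p) x) :=
    congrArg (fun A => A x) (fderiv_writtenInExtChartAt_sectionMap hv)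
  have h4 : chartCoord I p p x = x := chartCoord_self_apply p x
  rw [h1, h4]
  refine (congrArg₂ (· + ·) (fderiv_fderiv_writtenInExtChartAt_sectionMap hv x x)
    (congrArg₂ (fun a b => leviCivita (coordSasaki (chartMetric g.inner p))
      (extChartAt I p p, chartField I v p (extChartAt I p p)) a b) h3 h3))

theorem projDeriv_ambientDeriv {p : N}
    (hv : ContMDiffAt I I.tangent ∞ (fun p => (⟨p, v p⟩ : TangentBundle I N)) p) (x : F) :
    projDeriv (sectionMap v p) (ambientDeriv (I := I) (sasakiMetric g.inner) (sectionMap v) p x x) =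
      leviCivita (chartMetric g.inner p) (extChartAt I p p) x x +
        coordCurvature (chartMetric g.inner p) (extChartAt I p p) (chartField I v p (extChartAt I p p))
          (coordCov (chartMetric g.inner p) (chartField I v p) (extChartAt I p p) x) x := by
  have hpp := mem_extChartAt_source (I := I) p
  have h1 := (projDeriv_apply _ _).trans (congrArg Prod.fst (ambientDeriv_sectionMap_self g hv x))
  refine h1.trans ?_
  rw [(isMetricOn_chartMetric g p).leviCivita_coordSasaki ((extChartAt I p).map_source hpp),
    Prod.fst_add, zero_add, coordConnection_apply]
  rfl

/-- The vertical component of the Sasaki symbol ends with -Γ(w, ·) of its horizontal component,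
which is precisely what K adds back. So no curvature is left in the vertical part. -/
theorem coordConnection_leviCivita_coordSasaki {G : F → F →L[ℝ] F →L[ℝ] ℝ} {s : Set F}
    (hG : IsMetricOn G s) {y : F} (hy : y ∈ s) (Y : F → F) (a x : F) :
    coordConnection G y (Y y)
        ((0, a) + leviCivita (coordSasaki G) (y, Y y) (x, fderiv ℝ Y y x) (x, fderiv ℝ Y y x)) =
      a + fderiv ℝ (leviCivitaL G) y x (Y y) x + leviCivita G y (fderiv ℝ Y y x) x +
        leviCivita G y (coordCov G Y y x) x := by
  have h2 : coordCov G Y y x = coordConnection G y (Y y) (x, fderiv ℝ Y y x) := rfl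
  rw [hG.leviCivita_coordSasaki hy, coordConnection_apply, Prod.fst_add, Prod.snd_add, zero_add,
    ← h2]
  dsimp only
  abel

theorem connectionMap_ambientDeriv {p : N}
    (hv : ContMDiffAt I I.tangent ∞ (fun p => (⟨p, v p⟩ : TangentBundle I N)) p) (x : F) :
    connectionMap g.inner (sectionMap v p)
        (ambientDeriv (I := I) (sasakiMetric g.inner) (sectionMap v) p x x) =
      fderiv ℝ (fderiv ℝ (chartField I v p)) (extChartAt I p p) x x +
        fderiv ℝ (leviCivitaL (chartMetric g.inner p)) (extChartAt I p p) x
          (chartField I v p (extChartAt I p p)) x +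
        leviCivita (chartMetric g.inner p) (extChartAt I p p)
          (fderiv ℝ (chartField I v p) (extChartAt I p p) x) x +
        leviCivita (chartMetric g.inner p) (extChartAt I p p)
          (coordCov (chartMetric g.inner p) (chartField I v p) (extChartAt I p p) x) x := by
  have hpp := mem_extChartAt_source (I := I) p
  have V0 : v p = chartField I v p (extChartAt I p p) :=
    ((chartField_extChartAt v hpp).trans (chartCoord_self_apply p (v p))).symm
  have h1 := connectionMap_apply g (sectionMap v p)
    (ambientDeriv (I := I) (sasakiMetric g.inner) (sectionMap v) p x x)
  have h2 := ambientDeriv_sectionMap_self g hv x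
  refine h1.trans ((congrArg₂ (fun (w : F) (ξ : F × F) => coordConnection (chartMetric g.inner p)
    (extChartAt I p p) w ξ) V0 h2).trans ?_)
  exact coordConnection_leviCivita_coordSasaki (isMetricOn_chartMetric g p)
    ((extChartAt I p).map_source hpp) (chartField I v p) _ x

theorem mfderiv_sectionMap_eq_lift {p : N}
    (hv : ContMDiffAt I I.tangent ∞ (fun p => (⟨p, v p⟩ : TangentBundle I N)) p)
    (x : TangentSpace I p) :
    mfderiv I I.tangent (sectionMap v) p x =
      horLift g.inner (sectionMap v p) x + verLift g.inner (sectionMap v p) (covDeriv g.inner v p x) :=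
  (horVerSplit_bijective g (sectionMap v p)).injective
    ((horVerSplit_mfderiv_sectionMap g hv x).trans (horVerSplit_lift g (sectionMap v p) _ _).symm)

theorem ambientDeriv_eq_lift {p : N}
    (hv : ContMDiffAt I I.tangent ∞ (fun p => (⟨p, v p⟩ : TangentBundle I N)) p) (x : F) :
    ambientDeriv (I := I) (sasakiMetric g.inner) (sectionMap v) p x x =
      horLift g.inner (sectionMap v p)
        (leviCivita (chartMetric g.inner p) (extChartAt I p p) x x +
          coordCurvature (chartMetric g.inner p) (extChartAt I p p) (chartField I v p (extChartAt I p p))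
            (coordCov (chartMetric g.inner p) (chartField I v p) (extChartAt I p p) x) x : F) +
      verLift g.inner (sectionMap v p)
        (fderiv ℝ (fderiv ℝ (chartField I v p)) (extChartAt I p p) x x +
          fderiv ℝ (leviCivitaL (chartMetric g.inner p)) (extChartAt I p p) x (chartField I v p (extChartAt I p p)) x +
          leviCivita (chartMetric g.inner p) (extChartAt I p p)
            (fderiv ℝ (chartField I v p) (extChartAt I p p) x) x +
          leviCivita (chartMetric g.inner p) (extChartAt I p p)
            (coordCov (chartMetric g.inner p) (chartField I v p) (extChartAt I p p) x) x : F) :=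
  (horVerSplit_bijective g (sectionMap v p)).injective
    ((Prod.ext (projDeriv_ambientDeriv g hv x) (connectionMap_ambientDeriv g hv x)).trans
      (horVerSplit_lift g (sectionMap v p) _ _).symm)

theorem lift_sub_lift (z : TangentBundle I N) (X Y X' Y' : TangentSpace I z.1) :
    horLift g.inner z X + verLift g.inner z Y - (horLift g.inner z X' + verLift g.inner z Y') =
      horLift g.inner z (X - X') + verLift g.inner z (Y - Y') := by
  rw [horLift_add_verLift, horLift_add_verLift, horLift_add_verLift, ← map_sub, Prod.mk_sub_mk]

theorem lift_add_horLift (z : TangentBundle I N) (X Y X' : TangentSpace I z.1) :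
    horLift g.inner z X + verLift g.inner z Y + horLift g.inner z X' =
      horLift g.inner z (X + X') + verLift g.inner z Y := by
  rw [horLift_add_verLift, horLift_add_verLift, horLift, ← map_add, Prod.mk_add_mk, add_zero]

/-- The derivative of the section along itself and the frame expression for it differ by a vector
that is tangent to the section. -/
theorem lift_sub_ambientDeriv_mem {U : Set N} (hU : IsOpen U) (hv : SmoothFieldOn I v U)
    {e : (p : N) → TangentSpace I p} (he : SmoothFieldOn I e U) {p : N} (hp : p ∈ U) :
    horLift g.inner (sectionMap v p) (nabla g.inner e e p) +
        verLift g.inner (sectionMap v p) (nabla g.inner e (nabla g.inner e v) p) +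
        horLift g.inner (sectionMap v p) (riemannCurvature g.inner v (nabla g.inner e v) e p) -
      ambientDeriv (I := I) (sasakiMetric g.inner) (sectionMap v) p (e p) (e p) ∈
        LinearMap.range (mfderiv I I.tangent (sectionMap v) p).toLinearMap := by
  have hpp := mem_extChartAt_source (I := I) p
  have hG := isMetricOn_chartMetric g p
  have hy := (extChartAt I p).map_source hpp
  have hV := contDiffAt_chartField hpp (hv.contMDiffAt hU hp)
  have hE := contDiffAt_chartField hpp (he.contMDiffAt hU hp)
  obtain ⟨x, hx⟩ : ∃ x : F, x = e p := ⟨_, rfl⟩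
  have E0 : chartField I e p (extChartAt I p p) = x := by
    rw [chartField_extChartAt e hpp, chartCoord_self_apply, hx]
  have x0 : chartCoord I p p (e p) = x := (chartCoord_self_apply p (e p)).trans hx.symm
  have c4 : chartCoord I p p (nabla g.inner e v p) =
      coordCov (chartMetric g.inner p) (chartField I v p) (extChartAt I p p) x := by
    rw [nabla, chartCoord_covDeriv g hpp (hv.contMDiffAt hU hp), x0]
  have c1 : nabla g.inner e e p =
      fderiv ℝ (chartField I e p) (extChartAt I p p) x +
        leviCivita (chartMetric g.inner p) (extChartAt I p p) x x := by
    refine (chartCoord_self_apply (I := I) p _).symm.trans ?_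
    rw [nabla, chartCoord_covDeriv g hpp (he.contMDiffAt hU hp), x0, coordCov, add_apply, E0]
  have c2 : nabla g.inner e (nabla g.inner e v) p = _ :=
    (chartCoord_self_apply (I := I) p _).symm.trans (chartCoord_nabla_nabla g hU e he hv hpp hp)
  rw [x0, coordCov, add_apply, fderiv_coordCov_apply hG hy hE hV, E0] at c2
  have c3 : riemannCurvature g.inner v (nabla g.inner e v) e p = _ :=
    (chartCoord_self_apply (I := I) p _).symm.trans
      (chartCoord_riemannCurvature g hU hv (he.nabla g hU hv) he hpp hp)
  rw [x0, c4, ← chartField_extChartAt v hpp] at c3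
  have c5 (w : F) : covDeriv g.inner v p w =
      coordCov (chartMetric g.inner p) (chartField I v p) (extChartAt I p p) w :=
    covDeriv_apply_self g v p w
  -- `ambientDeriv` extends `e p` with constant components. Using the field `e` instead changes the
  -- second derivative by the differential of the section applied to the derivative of the
  -- components of `e`.
  refine ⟨fderiv ℝ (chartField I e p) (extChartAt I p p) x, ?_⟩
  refine (mfderiv_sectionMap_eq_lift g (hv.contMDiffAt hU hp) _).trans ?_
  rw [c1, c2, c3, ← hx, c5]
  refine Eq.trans ?_ (congrArg₂ (· - ·) (lift_add_horLift g (sectionMap v p) _ _ _).symm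
    (ambientDeriv_eq_lift g (hv.contMDiffAt hU hp) x).symm)
  refine Eq.trans ?_ (lift_sub_lift g (sectionMap v p) _ _ _ _).symm
  refine congrArg₂ (fun X Y => horLift g.inner (sectionMap v p) X +
    verLift g.inner (sectionMap v p) Y) ?_ ?_
  · exact (by intros; abel : ∀ a b c : F, a = a + b + c - (b + c)) _ _ _
  · exact (by intros; abel : ∀ a b c d e : F, d = a + b + c + d + e - (a + b + c + e)) _ _ _ _ _

end SectionGeometry

/-! ### The mean curvature as a trace over an orthonormal basis. -/

section Trace

variable {F : Type*} [NormedAddCommGroup F] [NormedSpace ℝ F]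
  {H : Type*} [TopologicalSpace H] {I : ModelWithCorners ℝ F H}
  {M : Type*} [TopologicalSpace M] [ChartedSpace H M]
  {F' : Type*} [NormedAddCommGroup F'] [NormedSpace ℝ F']
  {H' : Type*} [TopologicalSpace H'] {J : ModelWithCorners ℝ F' H'}
  {N : Type*} [TopologicalSpace N] [ChartedSpace H' N]

theorem christoffel_add (h : MetricField J N) (q : N) (y b b' : F') :
    christoffel h q y (b + b') = christoffel h q y b + christoffel h q y b' := by
  have h1 : christoffelFirst (fderiv ℝ (chartMetric h q) y) (b + b') =
      christoffelFirst (fderiv ℝ (chartMetric h q) y) b +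
        christoffelFirst (fderiv ℝ (chartMetric h q) y) b' := by
    refine ContinuousLinearMap.ext fun a => ContinuousLinearMap.ext fun c => ?_
    simp only [christoffelFirst_apply, map_add, add_apply]
    ring
  rw [christoffel, h1, ContinuousLinearMap.comp_add]
  rfl

theorem christoffel_smul (h : MetricField J N) (q : N) (y b : F') (t : ℝ) :
    christoffel h q y (t • b) = t • christoffel h q y b := by
  have h1 : christoffelFirst (fderiv ℝ (chartMetric h q) y) (t • b) =
      t • christoffelFirst (fderiv ℝ (chartMetric h q) y) b := by
    refine ContinuousLinearMap.ext fun a => ContinuousLinearMap.ext fun c => ?_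
    simp only [christoffelFirst_apply, map_smul, smul_apply, smul_eq_mul]
    ring
  rw [christoffel, h1, ContinuousLinearMap.comp_smul]
  rfl

theorem ambientDeriv_add_left (h : MetricField J N) (f : M → N) (p : M)
    (x x' y : TangentSpace I p) :
    ambientDeriv h f p (x + x') y = ambientDeriv h f p x y + ambientDeriv h f p x' y := by
  rw [ambientDeriv, ambientDeriv, ambientDeriv, ← map_add]
  congr 1
  simp only [map_add, add_apply]
  abel

theorem ambientDeriv_smul_left (h : MetricField J N) (f : M → N) (p : M) (t : ℝ)
    (x y : TangentSpace I p) :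
    ambientDeriv h f p (t • x) y = t • ambientDeriv h f p x y := by
  simp only [ambientDeriv, map_smul, smul_apply, ← smul_add]

theorem ambientDeriv_add_right (h : MetricField J N) (f : M → N) (p : M)
    (x y y' : TangentSpace I p) :
    ambientDeriv h f p x (y + y') = ambientDeriv h f p x y + ambientDeriv h f p x y' := by
  rw [ambientDeriv, ambientDeriv, ambientDeriv, ← map_add]
  congr 1
  simp only [map_add, christoffel_add, add_apply]
  abel

theorem ambientDeriv_smul_right (h : MetricField J N) (f : M → N) (p : M) (t : ℝ)
    (x y : TangentSpace I p) :
    ambientDeriv h f p x (t • y) = t • ambientDeriv h f p x y := by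
  simp only [ambientDeriv, map_smul, christoffel_smul, smul_apply, ← smul_add]

/-- The second fundamental form as a bilinear map. -/
def sffBilin [FiniteDimensional ℝ F'] (I : ModelWithCorners ℝ F H) (h : MetricField J N) (f : M → N) (p : M)
    (hpos : ∀ ξ, ξ ≠ 0 → 0 < h (f p) ξ ξ) :
    TangentSpace I p →ₗ[ℝ] TangentSpace I p →ₗ[ℝ] TangentSpace J (f p) :=
  haveI : FiniteDimensional ℝ (TangentSpace J (f p)) := inferInstanceAs (FiniteDimensional ℝ F')
  LinearMap.mk₂ ℝ (secondFundamentalForm h f p)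
    (fun x x' y => by
      simp only [secondFundamentalForm, normalComponent, ambientDeriv_add_left]
      exact normalPart_add hpos _ _ _)
    (fun t x y => by
      simp only [secondFundamentalForm, normalComponent, ambientDeriv_smul_left]
      exact normalPart_smul hpos _ _ _)
    (fun x y y' => by
      simp only [secondFundamentalForm, normalComponent, ambientDeriv_add_right]
      exact normalPart_add hpos _ _ _)
    (fun t x y => by
      simp only [secondFundamentalForm, normalComponent, ambientDeriv_smul_right]
      exact normalPart_smul hpos _ _ _)

/-- The definition uses a fixed basis and the inverse Gram matrix. Bilinearity of the second
fundamental form allows any basis that is orthonormal for the induced metric. -/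
theorem meanCurvature_eq_sum [FiniteDimensional ℝ F] [FiniteDimensional ℝ F']
    (h : MetricField J N) (f : M → N) (p : M) (hpos : ∀ ξ, ξ ≠ 0 → 0 < h (f p) ξ ξ) {n : ℕ}
    (hn : Module.finrank ℝ F = n) (e : Fin n → TangentSpace I p)
    (he : ∀ i j, pullbackMetric I h f p (e i) (e j) = if i = j then 1 else 0) :
    meanCurvature I h f p = ∑ i, secondFundamentalForm h f p (e i) (e i) := by
  subst hn
  exact sum_inv_gram_smul
    (LinearMap.mk₂ ℝ (fun x y => pullbackMetric I h f p x y) (by intros; simp) (by intros; simp)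
      (by intros; simp) (by intros; simp))
    (sffBilin I h f p hpos) (Module.finBasis ℝ F) e he

end Trace

theorem formTranspose_spec {F : Type*} [NormedAddCommGroup F] [NormedSpace ℝ F]
    [FiniteDimensional ℝ F] {B : F →L[ℝ] F →L[ℝ] ℝ} (hB : ∀ x, x ≠ 0 → 0 < B x x)
    (C : F →L[ℝ] F) (x y : F) : B (formTranspose B C x) y = B x (C y) := by
  have h := (isInvertible_of_pos hB).self_apply_inverse ((B x).comp C)
  exact DFunLike.congr_fun h y

/-! ### Tangent vectors and second fundamental form of a section in terms of lifts. -/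

section Section

variable {F : Type*} [NormedAddCommGroup F] [NormedSpace ℝ F] [FiniteDimensional ℝ F]
  {H : Type*} [TopologicalSpace H] {I : ModelWithCorners ℝ F H} [I.Boundaryless]
  {N : Type*} [TopologicalSpace N] [ChartedSpace H N] [IsManifold I ∞ N]
  (g : ContMDiffRiemannianMetric I ∞ F (fun p : N => TangentSpace I p))
  {v : (p : N) → TangentSpace I p}

theorem pullbackMetric_sectionMap {p : N}
    (hv : ContMDiffAt I I.tangent ∞ (fun p => (⟨p, v p⟩ : TangentBundle I N)) p)
    (x y : TangentSpace I p) :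
    pullbackMetric I (sasakiMetric g.inner) (sectionMap v) p x y =
      g.inner p x y + g.inner p (covDeriv g.inner v p x) (covDeriv g.inner v p y) := by
  have h1 := horVerSplit_mfderiv_sectionMap g hv x
  have h2 := horVerSplit_mfderiv_sectionMap g hv y
  exact congrArg₂ (· + ·)
    (congrArg₂ (fun a b => g.inner p a b) (congrArg Prod.fst h1) (congrArg Prod.fst h2))
    (congrArg₂ (fun a b => g.inner p a b) (congrArg Prod.snd h1) (congrArg Prod.snd h2))

/-- The tangent space of the section is the graph of ∇v in the horizontal-vertical splitting. This
turns the vanishing of a normal component into an equation on the base. -/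
theorem lift_mem_range_iff {p : N}
    (hv : ContMDiffAt I I.tangent ∞ (fun p => (⟨p, v p⟩ : TangentBundle I N)) p)
    (X Y : TangentSpace I p) :
    horLift g.inner (sectionMap v p) X + verLift g.inner (sectionMap v p) Y ∈
      LinearMap.range (mfderiv I I.tangent (sectionMap v) p).toLinearMap ↔
      Y = covDeriv g.inner v p X := by
  refine ⟨?_, fun h => ⟨X, ?_⟩⟩
  · rintro ⟨x, hx⟩
    have h1 := (horVerSplit_mfderiv_sectionMap g hv x).symm.trans
      ((congrArg (horVerSplit g.inner (sectionMap v p)) hx).trans (horVerSplit_lift g _ X Y))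
    have h2 : x = X := congrArg Prod.fst h1
    have h3 : covDeriv g.inner v p x = Y := congrArg Prod.snd h1
    rw [← h3, h2]
  · rw [h]
    exact mfderiv_sectionMap_eq_lift g hv X

theorem sum_smul_lift {n : ℕ} (z : TangentBundle I N) (w : Fin n → ℝ)
    (a b c : Fin n → TangentSpace I z.1) :
    ∑ i, w i • (horLift g.inner z (a i) + verLift g.inner z (b i) + horLift g.inner z (c i)) =
      horLift g.inner z (∑ i, w i • (a i + c i)) + verLift g.inner z (∑ i, w i • b i) := by
  have h (i : Fin n) : w i • (horLift g.inner z (a i) + verLift g.inner z (b i) +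
      horLift g.inner z (c i)) =
      (horVerSplit g.inner z).inverse (w i • (a i + c i), w i • b i) := by
    rw [lift_add_horLift, horLift_add_verLift, ← map_smul, Prod.smul_mk]
  rw [horLift_add_verLift, Finset.sum_congr rfl fun i _ => h i, ← map_sum]
  refine congrArg _ (Prod.ext ?_ ?_)
  · rw [Prod.fst_sum]
  · rw [Prod.snd_sum]

theorem secondFundamentalForm_sectionMap {U : Set N} (hU : IsOpen U) (hv : SmoothFieldOn I v U)
    {e : (p : N) → TangentSpace I p} (he : SmoothFieldOn I e U) {p : N} (hp : p ∈ U) :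
    secondFundamentalForm (I := I) (sasakiMetric g.inner) (sectionMap v) p (e p) (e p) =
      normalComponent I (sasakiMetric g.inner) (sectionMap v) p
        (horLift g.inner (sectionMap v p) (nabla g.inner e e p) +
          verLift g.inner (sectionMap v p) (nabla g.inner e (nabla g.inner e v) p) +
          horLift g.inner (sectionMap v p) (riemannCurvature g.inner v (nabla g.inner e v) e p)) :=
  (normalPart_congr (sasakiMetric_pos g _) (lift_sub_ambientDeriv_mem g hU hv he hp)).symm

end Section

/-! ### Mean curvature in an eigenframe. -/

section Frame

variable {m : ℕ} {M : Type*} [TopologicalSpace M]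
    [ChartedSpace (EuclideanSpace ℝ (Fin m)) M] [IsManifold (𝓡 m) ∞ M]
    {g : ContMDiffRiemannianMetric (𝓡 m) ∞ (EuclideanSpace ℝ (Fin m))
      (fun p : M => TangentSpace (𝓡 m) p)}
    {v : (p : M) → TangentSpace (𝓡 m) p}
    (hv : ContMDiff (𝓡 m) (𝓡 m).tangent ∞ (fun p => (⟨p, v p⟩ : TangentBundle (𝓡 m) M)))
    {U : Set M} {e : Fin m → (p : M) → TangentSpace (𝓡 m) p}
    (he : IsEigenframeOn g.inner v U e) {p : M} (hp : p ∈ U)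

theorem frameWeight_sq_mul (v e : (p : M) → TangentSpace (𝓡 m) p) (p : M) :
    frameWeight g.inner v e p ^ 2 *
      (1 + g.inner p (nabla g.inner e v p) (nabla g.inner e v p)) = 1 := by
  have h : 0 ≤ g.inner p (nabla g.inner e v p) (nabla g.inner e v p) := by
    by_cases h0 : nabla g.inner e v p = 0
    · rw [h0]; simp
    · exact (g.pos p _ h0).le
  rw [frameWeight, inv_pow, Real.sq_sqrt (by linarith)]
  exact inv_mul_cancel₀ (by linarith)

variable (g v e p) in
theorem weightedLaplacian_eq :
    weightedLaplacian g.inner v e p =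
      ∑ i, frameWeight g.inner v (e i) p ^ 2 • nabla g.inner (e i) (nabla g.inner (e i) v) p -
        covDeriv g.inner v p (∑ i, frameWeight g.inner v (e i) p ^ 2 •
          (nabla g.inner (e i) (e i) p +
            riemannCurvature g.inner v (nabla g.inner (e i) v) (e i) p)) := by
  symm
  rw [map_sum, ← Finset.sum_sub_distrib, weightedLaplacian]
  refine Finset.sum_congr rfl fun i _ => ?_
  rw [map_smul, ← smul_sub, map_add, ← sub_sub]
  rfl

include hv he hp

/-- The eigenvector condition enters here: g(C e_i, C e_j) = g(Cᵗ C e_i, e_j) = μ g(e_i, e_j).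
Together with the weights, it makes the vectors c_i e_i orthonormal for the induced metric. -/
theorem IsEigenframeOn.inner_covDeriv {i j : Fin m} (hij : i ≠ j) :
    g.inner p (covDeriv g.inner v p (e i p)) (covDeriv g.inner v p (e j p)) = 0 := by
  obtain ⟨μ, hμ⟩ := he.eigen p hp i
  have h := formTranspose_spec (F := EuclideanSpace ℝ (Fin m)) (B := g.inner p) (g.pos p)
    (covDeriv g.inner v p) (covDeriv g.inner v p (e i p)) (e j p)
  refine h.symm.trans ((congrArg (fun x => g.inner p x (e j p)) hμ).trans ?_)
  simp [he.orthonormal p hp, hij]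

theorem IsEigenframeOn.pullbackMetric_frame (i j : Fin m) :
    pullbackMetric (𝓡 m) (sasakiMetric g.inner) (sectionMap v) p
      (frameWeight g.inner v (e i) p • e i p) (frameWeight g.inner v (e j) p • e j p) =
      if i = j then 1 else 0 := by
  rw [pullbackMetric_sectionMap g (hv p)]
  simp only [map_smul, smul_apply, smul_eq_mul, he.orthonormal p hp]
  by_cases hij : i = j
  · subst hij
    have h := frameWeight_sq_mul (g := g) v (e i) p
    simp only [if_true]
    refine Eq.trans ?_ h
    rw [nabla]
    ring
  · rw [he.inner_covDeriv hv hp hij, if_neg hij]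
    simp

theorem IsEigenframeOn.mfderiv_frame (i : Fin m) :
    mfderiv (𝓡 m) (𝓡 m).tangent (sectionMap v) p (frameWeight g.inner v (e i) p • e i p) =
      tangentLift g.inner v (e i) p := by
  rw [map_smul, mfderiv_sectionMap_eq_lift g (hv p)]
  rfl

theorem IsEigenframeOn.tangentLift_orthonormal (i j : Fin m) :
    sasakiMetric g.inner (sectionMap v p) (tangentLift g.inner v (e i) p)
      (tangentLift g.inner v (e j) p) = if i = j then 1 else 0 := by
  rw [← he.mfderiv_frame hv hp, ← he.mfderiv_frame hv hp]
  exact he.pullbackMetric_frame hv hp i j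

theorem IsEigenframeOn.sectionMeanCurvature_eq :
    sectionMeanCurvature g.inner v p =
      normalComponent (𝓡 m) (sasakiMetric g.inner) (sectionMap v) p
        (frameCurvatureSum g.inner v e p) := by
  have hpos := sasakiMetric_pos g (sectionMap v p)
  rw [sectionMeanCurvature, meanCurvature_eq_sum _ _ _ hpos finrank_euclideanSpace_fin _
    (he.pullbackMetric_frame hv hp)]
  have h (i : Fin m) : secondFundamentalForm (I := 𝓡 m) (sasakiMetric g.inner) (sectionMap v) p
      (frameWeight g.inner v (e i) p • e i p) (frameWeight g.inner v (e i) p • e i p) =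
      normalComponent (𝓡 m) (sasakiMetric g.inner) (sectionMap v) p
        (frameWeight g.inner v (e i) p ^ 2 •
          (horLift g.inner (sectionMap v p) (nabla g.inner (e i) (e i) p) +
            verLift g.inner (sectionMap v p) (nabla g.inner (e i) (nabla g.inner (e i) v) p) +
            horLift g.inner (sectionMap v p)
              (riemannCurvature g.inner v (nabla g.inner (e i) v) (e i) p))) := by
    have h1 := secondFundamentalForm_sectionMap g he.isOpen (v := v) (fun q _ => (hv q).contMDiffWithinAt) (he.smooth i) hp
    have h2 := normalPart_smul hpos
      (LinearMap.range (mfderiv (𝓡 m) (𝓡 m).tangent (sectionMap v) p).toLinearMap)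
      (frameWeight g.inner v (e i) p ^ 2)
    have h3 : secondFundamentalForm (I := 𝓡 m) (sasakiMetric g.inner) (sectionMap v) p
        (frameWeight g.inner v (e i) p • e i p) (frameWeight g.inner v (e i) p • e i p) =
        frameWeight g.inner v (e i) p ^ 2 •
          secondFundamentalForm (I := 𝓡 m) (sasakiMetric g.inner) (sectionMap v) p
            (e i p) (e i p) := by
      refine (LinearMap.map_smul₂ (sffBilin (𝓡 m) (sasakiMetric g.inner) (sectionMap v) p hpos)
        _ _ _).trans ?_
      rw [map_smul, smul_smul, sq]
      rfl
    rw [h3, h1]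
    exact (h2 _).symm
  refine (Finset.sum_congr rfl fun i _ => h i).trans ?_
  exact (map_sum (AddMonoidHom.mk' (normalComponent (𝓡 m) (sasakiMetric g.inner) (sectionMap v) p)
    (normalPart_add hpos _)) _ _).symm

/-- The normal part vanishes if and only if the frame sum is tangent, that is, its vertical part is
∇v of its horizontal part; the difference of these two is the weighted Laplacian. -/
theorem IsEigenframeOn.sectionMeanCurvature_eq_zero_iff :
    sectionMeanCurvature g.inner v p = 0 ↔ weightedLaplacian g.inner v e p = 0 := by
  rw [he.sectionMeanCurvature_eq hv hp]
  refine (normalPart_eq_zero_iff (sasakiMetric_pos g (sectionMap v p))).trans ?_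
  have h1 : frameCurvatureSum g.inner v e p =
      horLift g.inner (sectionMap v p) (∑ i, frameWeight g.inner v (e i) p ^ 2 •
        (nabla g.inner (e i) (e i) p +
          riemannCurvature g.inner v (nabla g.inner (e i) v) (e i) p)) +
      verLift g.inner (sectionMap v p) (∑ i, frameWeight g.inner v (e i) p ^ 2 •
        nabla g.inner (e i) (nabla g.inner (e i) v) p) :=
    sum_smul_lift g (sectionMap v p) _ _ _ _
  rw [h1]
  refine (lift_mem_range_iff g (hv p) _ _).trans (sub_eq_zero.symm.trans ?_)
  refine iff_of_eq (congrArg (fun x => x = 0) ?_)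
  exact (weightedLaplacian_eq g v e p).symm

end Frame

/-! ### A smooth implicit function theorem. -/

section Implicit

open Filter Topology

variable {X Z Z' : Type*} [NormedAddCommGroup X] [NormedSpace ℝ X] [CompleteSpace X]
  [NormedAddCommGroup Z] [NormedSpace ℝ Z] [CompleteSpace Z]
  [NormedAddCommGroup Z'] [NormedSpace ℝ Z'] [CompleteSpace Z']

/-- The implicit function theorem for smooth equations, with smoothness in a neighbourhood. -/
theorem exists_smooth_implicitFunction {F : X × Z → Z'} {S : Set (X × Z)} (hS : IsOpen S)
    (hF : ContDiffOn ℝ ∞ F S) {u : X × Z} (hu : u ∈ S) (h0 : F u = 0)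
    (hinv : (fderiv ℝ F u ∘L .inr ℝ X Z).IsInvertible) :
    ∃ U : Set X, IsOpen U ∧ u.1 ∈ U ∧ ∃ z : X → Z, z u.1 = u.2 ∧ ContDiffOn ℝ ∞ z U ∧
      ∀ x ∈ U, F (x, z x) = 0 := by
  have hc {w : X × Z} (hw : w ∈ S) : ContDiffAt ℝ ∞ F w := (hF w hw).contDiffAt (hS.mem_nhds hw)
  have pn : (∞ : WithTop ℕ∞) ≠ 0 := by simp
  set z := (hc hu).implicitFunction pn hinv with hz
  have hz0 : z u.1 = u.2 := (hc hu).implicitFunction_apply_self pn hinv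
  have h1 : ∀ᶠ x in 𝓝 u.1, F (x, z x) = 0 := by
    filter_upwards [(hc hu).eventually_apply_implicitFunction pn hinv] with x hx
    rw [hx, h0]
  -- Order one suffices for now and persists nearby, whereas smoothness of infinite order at a point
  -- only gives, for each finite order, a neighbourhood depending on that order.
  have hz1 : ContDiffAt ℝ 1 z u.1 :=
    ((hc hu).contDiffAt_implicitFunction pn hinv).of_le (by exact_mod_cast le_top)
  have h2 : ∀ᶠ x in 𝓝 u.1, ContDiffAt ℝ 1 z x := hz1.eventually (by simp)
  have hg : ContinuousAt (fun x => (x, z x)) u.1 := continuousAt_id.prodMk hz1.continuousAt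
  have hgu : (u.1, z u.1) = u := Prod.ext rfl hz0
  have hgt : Tendsto (fun x => (x, z x)) (𝓝 u.1) (𝓝 u) := by
    have h : Tendsto (fun x => (x, z x)) (𝓝 u.1) (𝓝 (u.1, z u.1)) := hg
    rwa [hgu] at h
  have h3 : ∀ᶠ x in 𝓝 u.1, (x, z x) ∈ S := hgt (hS.mem_nhds hu)
  have h4 : ∀ᶠ x in 𝓝 u.1, (fderiv ℝ F (x, z x) ∘L .inr ℝ X Z).IsInvertible := by
    have hd : ContinuousAt (fun w => fderiv ℝ F w ∘L .inr ℝ X Z) u :=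
      ((((hc hu).fderiv_right (m := 0) (by simp)).continuousAt).clm_comp continuousAt_const)
    have h5 : ∀ᶠ w in 𝓝 u, (fderiv ℝ F w ∘L .inr ℝ X Z).IsInvertible := by
      obtain ⟨e, he⟩ := id hinv
      have h6 : {A : Z →L[ℝ] Z' | A.IsInvertible} ∈ 𝓝 (fderiv ℝ F u ∘L .inr ℝ X Z) := by
        rw [← he]
        exact ContinuousLinearEquiv.nhds e
      exact hd h6
    exact hgt h5
  obtain ⟨U, hU, hUo, huU⟩ := eventually_nhds_iff.1 (h1.and (h2.and (h3.and h4)))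
  refine ⟨U, hUo, huU, z, hz0, fun x hx => ?_, fun x hx => (hU x hx).1⟩
  obtain ⟨e1, e2, e3, e4⟩ := hU x hx
  -- Apply the theorem again at each point of the graph: local uniqueness identifies the new
  -- implicit function with `z`, so `z` is smooth at every point of `U`.
  have h7 := (hc e3).eventually_apply_eq_iff_implicitFunction pn e4
  have h8 : ContinuousAt (fun x => (x, z x)) x := continuousAt_id.prodMk e2.continuousAt
  have h9 : (hc e3).implicitFunction pn e4 =ᶠ[𝓝 x] z := by
    filter_upwards [h8.eventually h7, hUo.mem_nhds hx] with y hy hyU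
    refine hy.1 ?_
    rw [e1]
    exact (hU y hyU).1
  exact (((hc e3).contDiffAt_implicitFunction pn e4).congr_of_eventuallyEq
    h9.symm).contDiffWithinAt

end Implicit

/-! ### Smooth block diagonalization of a pair of symmetric forms. -/

section Split

variable {X V : Type*} [NormedAddCommGroup X] [NormedSpace ℝ X] [FiniteDimensional ℝ X]
  [NormedAddCommGroup V] [NormedSpace ℝ V] [FiniteDimensional ℝ V]

/-- A symmetric form that is not a multiple of a positive definite one has an eigenvalue relative
to it whose eigenspace is a proper nonzero subspace. -/
theorem exists_eigenvalue [Nontrivial V] {G B : V →L[ℝ] V →L[ℝ] ℝ} (hG : ∀ a, a ≠ 0 → 0 < G a a)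
    (hB : ∀ a b, B a b = B b a) (hGs : ∀ a b, G a b = G b a) :
    ∃ t : ℝ, ∃ a : V, a ≠ 0 ∧ ∀ b, B a b = t * G a b := by
  have hcpt : IsCompact (Metric.sphere (0 : V) 1) := isCompact_sphere 0 1
  have hne : (Metric.sphere (0 : V) 1).Nonempty := NormedSpace.sphere_nonempty.2 zero_le_one
  have h0 {a : V} (ha : a ∈ Metric.sphere (0 : V) 1) : a ≠ 0 := ne_zero_of_mem_unit_sphere ⟨a, ha⟩
  -- The eigenvector is a maximum of the Rayleigh quotient on the unit sphere.
  have hcont : ContinuousOn (fun a => B a a / G a a) (Metric.sphere (0 : V) 1) :=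
    ContinuousOn.div (by fun_prop) (by fun_prop) fun a ha => (hG a (h0 ha)).ne'
  obtain ⟨a, ha, hmax⟩ := hcpt.exists_isMaxOn hne hcont
  have hGa := hG a (h0 ha)
  set t := B a a / G a a with ht
  have hq (c : V) : B c c ≤ t * G c c := by
    by_cases hc : c = 0
    · simp [hc]
    · have hn : ‖c‖ ≠ 0 := by simpa using hc
      have h1 : ‖c‖⁻¹ • c ∈ Metric.sphere (0 : V) 1 := by
        simp [norm_smul, hn]
      have h2 := hmax h1
      simp only [Set.mem_ofPred_eq, map_smul, smul_apply, smul_eq_mul] at h2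
      have h3 : ‖c‖⁻¹ * (‖c‖⁻¹ * B c c) / (‖c‖⁻¹ * (‖c‖⁻¹ * G c c)) = B c c / G c c := by
        have := (hG c hc).ne'
        field_simp
      rw [h3] at h2
      exact (div_le_iff₀ (hG c hc)).1 h2
  refine ⟨t, a, h0 ha, fun b => ?_⟩
  have haa : B a a = t * G a a := by rw [ht]; field_simp
  by_contra hne
  -- the quadratic polynomial `s ↦ (t G - B)(a + s b, a + s b)` is nonnegative and vanishes at `0`
  have key (s : ℝ) : 0 ≤ 2 * s * (t * G a b - B a b) + s ^ 2 * (t * G b b - B b b) := by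
    have := hq (a + s • b)
    simp only [map_add, map_smul, add_apply, smul_apply, smul_eq_mul, hB b a, hGs b a, haa] at this
    nlinarith
  have hd : t * G a b - B a b ≠ 0 := fun h => hne (by linarith)
  set d := t * G a b - B a b
  set q := t * G b b - B b b
  have hq0 : 0 ≤ q := by have := hq b; simp only [q]; linarith
  -- The vertex of the parabola would be at -d / q. Replacing `q` by `q + 1` avoids a zero
  -- denominator and still gives a negative value.
  have h5 := key (-d / (q + 1))
  have h6 : 2 * (-d / (q + 1)) * d + (-d / (q + 1)) ^ 2 * q = -(d ^ 2 * (q + 2)) / (q + 1) ^ 2 := by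
    have : q + 1 ≠ 0 := by linarith
    field_simp
    ring
  rw [h6] at h5
  have h7 : 0 < d ^ 2 * (q + 2) / (q + 1) ^ 2 := by
    have := sq_pos_of_ne_zero hd
    have : 0 < q + 1 := by linarith
    positivity
  rw [neg_div] at h5
  linarith

theorem isInvertible_of_injective {S T : Type*} [NormedAddCommGroup S] [NormedSpace ℝ S]
    [FiniteDimensional ℝ S] [NormedAddCommGroup T] [NormedSpace ℝ T] [FiniteDimensional ℝ T]
    (L : S →L[ℝ] T) (hL : ∀ x, L x = 0 → x = 0) (h : Module.finrank ℝ S = Module.finrank ℝ T) :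
    L.IsInvertible := by
  have hinj : Function.Injective L.toLinearMap := by
    rw [← LinearMap.ker_eq_bot, LinearMap.ker_eq_bot']
    exact hL
  exact ⟨(LinearEquiv.ofInjectiveOfFinrankEq L.toLinearMap hinj h).toContinuousLinearEquiv,
    ContinuousLinearMap.ext fun _ => rfl⟩

theorem finrank_continuousLinearMap (S T : Type*) [NormedAddCommGroup S] [NormedSpace ℝ S]
    [FiniteDimensional ℝ S] [NormedAddCommGroup T] [NormedSpace ℝ T] [FiniteDimensional ℝ T] :
    Module.finrank ℝ (S →L[ℝ] T) = Module.finrank ℝ S * Module.finrank ℝ T := by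
  rw [← (LinearMap.toContinuousLinearMap (𝕜 := ℝ) (E := S) (F' := T)).finrank_eq,
    Module.finrank_linearMap]

/-- The graph of a map between two subspaces. -/
def graphMap {V₁ V₂ : Submodule ℝ V} (S : V₁ →L[ℝ] V₂) : V₁ →L[ℝ] V :=
  V₁.subtypeL + V₂.subtypeL ∘L S

theorem graphMap_apply {V₁ V₂ : Submodule ℝ V} (S : V₁ →L[ℝ] V₂) (a : V₁) :
    graphMap S a = (a : V) + S a := rfl

theorem contDiff_graphMap {V₁ V₂ : Submodule ℝ V} :
    ContDiff ℝ ∞ (graphMap : (V₁ →L[ℝ] V₂) → V₁ →L[ℝ] V) :=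
  contDiff_const.add (contDiff_const.clm_comp contDiff_id)

theorem graphMap_eq_zero {V₁ V₂ : Submodule ℝ V} (hV : Disjoint V₁ V₂) (S : V₁ →L[ℝ] V₂) {a : V₁}
    (h : graphMap S a = 0) : a = 0 := by
  rw [graphMap_apply] at h
  have := hV.le_bot (show (a : V) ∈ V₁ ⊓ V₂ from
    ⟨a.2, by rw [eq_neg_of_add_eq_zero_left h]; exact V₂.neg_mem (S a).2⟩)
  simpa using this

/-- The restriction of a bilinear form to the graphs of two maps. -/
def graphForm {V₁ V₂ : Submodule ℝ V} (A : V →L[ℝ] V →L[ℝ] ℝ)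
    (ζ : (V₁ →L[ℝ] V₂) × (V₂ →L[ℝ] V₁)) : V₁ →L[ℝ] V₂ →L[ℝ] ℝ :=
  ((ContinuousLinearMap.compL ℝ V₂ V ℝ).flip (graphMap ζ.2)) ∘L (A ∘L graphMap ζ.1)

theorem graphForm_apply {V₁ V₂ : Submodule ℝ V} (A : V →L[ℝ] V →L[ℝ] ℝ)
    (ζ : (V₁ →L[ℝ] V₂) × (V₂ →L[ℝ] V₁)) (a : V₁) (b : V₂) :
    graphForm A ζ a b = A (graphMap ζ.1 a) (graphMap ζ.2 b) := rfl

theorem contDiffOn_graphForm {V₁ V₂ : Submodule ℝ V} {A : X → V →L[ℝ] V →L[ℝ] ℝ} {W : Set X}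
    (hA : ContDiffOn ℝ ∞ A W) :
    ContDiffOn ℝ ∞ (fun w : X × ((V₁ →L[ℝ] V₂) × (V₂ →L[ℝ] V₁)) => graphForm (A w.1) w.2)
      (W ×ˢ Set.univ) := by
  have a1 : ContDiffOn ℝ ∞ (fun w : X × ((V₁ →L[ℝ] V₂) × (V₂ →L[ℝ] V₁)) => A w.1)
      (W ×ˢ Set.univ) := hA.comp contDiffOn_fst fun w hw => hw.1
  have a2 : ContDiffOn ℝ ∞ (fun w : X × ((V₁ →L[ℝ] V₂) × (V₂ →L[ℝ] V₁)) => graphMap w.2.1)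
      (W ×ˢ Set.univ) := (contDiff_graphMap.comp (contDiff_fst.comp contDiff_snd)).contDiffOn
  have a3 : ContDiffOn ℝ ∞ (fun w : X × ((V₁ →L[ℝ] V₂) × (V₂ →L[ℝ] V₁)) =>
      (ContinuousLinearMap.compL ℝ V₂ V ℝ).flip (graphMap w.2.2)) (W ×ˢ Set.univ) :=
    ((ContinuousLinearMap.contDiff _).comp
      (contDiff_graphMap.comp (contDiff_snd.comp contDiff_snd))).contDiffOn
  exact a3.clm_comp (a1.clm_comp a2)

/-- Along a ray the form is a quadratic polynomial in the parameter, so the derivative is its linear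
coefficient. -/
theorem hasDerivAt_graphForm {V₁ V₂ : Submodule ℝ V} (A : V →L[ℝ] V →L[ℝ] ℝ)
    (ζ : (V₁ →L[ℝ] V₂) × (V₂ →L[ℝ] V₁)) (a : V₁) (b : V₂) :
    HasDerivAt (fun s : ℝ => graphForm A (s • ζ) a b) (A (ζ.1 a) b + A a (ζ.2 b)) 0 := by
  have e : (fun s : ℝ => graphForm A (s • ζ) a b) = fun s : ℝ =>
      A a b + s * (A (ζ.1 a) b + A a (ζ.2 b)) + s ^ 2 * A (ζ.1 a) (ζ.2 b) := by
    funext s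
    rw [graphForm_apply, graphMap_apply, graphMap_apply,
      show ((s • ζ).1 a : V) = s • (ζ.1 a : V) from rfl,
      show ((s • ζ).2 b : V) = s • (ζ.2 b : V) from rfl]
    simp only [map_add, map_smul, add_apply, smul_apply, smul_eq_mul]
    ring
  rw [e]
  have := (((hasDerivAt_id (0 : ℝ)).mul_const (A (ζ.1 a) b + A a (ζ.2 b))).const_add
    (A a b)).add (((hasDerivAt_id (0 : ℝ)).pow 2).mul_const (A (ζ.1 a) (ζ.2 b)))
  refine (this.congr_deriv ?_)
  simp

theorem fderiv_graphForm {V₁ V₂ : Submodule ℝ V} {A : X → V →L[ℝ] V →L[ℝ] ℝ} {W : Set X}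
    (hW : IsOpen W) (hA : ContDiffOn ℝ ∞ A W) {x₀ : X} (hx₀ : x₀ ∈ W)
    (ζ : (V₁ →L[ℝ] V₂) × (V₂ →L[ℝ] V₁)) (a : V₁) (b : V₂) :
    fderiv ℝ (fun w : X × ((V₁ →L[ℝ] V₂) × (V₂ →L[ℝ] V₁)) => graphForm (A w.1) w.2) (x₀, 0)
      (0, ζ) a b = A x₀ (ζ.1 a) b + A x₀ a (ζ.2 b) := by
  have hu : ((x₀, 0) : X × ((V₁ →L[ℝ] V₂) × (V₂ →L[ℝ] V₁))) ∈ W ×ˢ (Set.univ : Set _) :=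
    ⟨hx₀, trivial⟩
  have hF := ((contDiffOn_graphForm (V₁ := V₁) (V₂ := V₂) hA _ hu).contDiffAt
    ((hW.prod isOpen_univ).mem_nhds hu)).differentiableAt (by simp)
  have h1 : HasDerivAt (fun s : ℝ => ((x₀, s • ζ) : X × ((V₁ →L[ℝ] V₂) × (V₂ →L[ℝ] V₁))))
      (0, ζ) 0 := by
    have := (hasDerivAt_const (0 : ℝ) x₀).prodMk ((hasDerivAt_id (0 : ℝ)).smul_const ζ)
    simpa using this
  have h2 := hF.hasFDerivAt
  have h3 := HasFDerivAt.comp_hasDerivAt_of_eq 0 h2 h1 (by simp)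
  have h4 := ((h3.clm_apply (hasDerivAt_const 0 a)).clm_apply (hasDerivAt_const 0 b)).unique
    (hasDerivAt_graphForm (A x₀) ζ a b)
  simpa only [map_zero, add_zero] using h4

/-- Near a point where the pair of forms `G`, `B` is block diagonal with an eigenvalue `t` of `B`
relative to `G` on one of the blocks only, it can be block diagonalized smoothly. -/
theorem exists_smooth_splitting {G B : X → V →L[ℝ] V →L[ℝ] ℝ} {W : Set X} (hW : IsOpen W)
    (hG : ContDiffOn ℝ ∞ G W) (hB : ContDiffOn ℝ ∞ B W) {x₀ : X} (hx₀ : x₀ ∈ W)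
    (hpos : ∀ a, a ≠ 0 → 0 < G x₀ a a)
    {V₁ V₂ : Submodule ℝ V} (t : ℝ) (hV : Disjoint V₁ V₂)
    (h₁ : ∀ a ∈ V₁, ∀ b, B x₀ a b = t * G x₀ a b)
    (h₂ : ∀ a ∈ V₁, ∀ b ∈ V₂, G x₀ a b = 0)
    (h₃ : ∀ b ∈ V₂, (∀ b' ∈ V₂, B x₀ b b' = t * G x₀ b b') → b = 0) :
    ∃ U : Set X, IsOpen U ∧ x₀ ∈ U ∧ U ⊆ W ∧ ∃ (P : X → V₁ →L[ℝ] V) (Q : X → V₂ →L[ℝ] V),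
      ContDiffOn ℝ ∞ P U ∧ ContDiffOn ℝ ∞ Q U ∧ (∀ x a, P x a = 0 → a = 0) ∧
      (∀ x b, Q x b = 0 → b = 0) ∧
      ∀ x ∈ U, ∀ a b, G x (P x a) (Q x b) = 0 ∧ B x (P x a) (Q x b) = 0 := by
  have hGs := contDiffOn_graphForm (V₁ := V₁) (V₂ := V₂) hG
  have hBs := contDiffOn_graphForm (V₁ := V₁) (V₂ := V₂) hB
  have hu : ((x₀, 0) : X × ((V₁ →L[ℝ] V₂) × (V₂ →L[ℝ] V₁))) ∈ W ×ˢ (Set.univ : Set _) :=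
    ⟨hx₀, trivial⟩
  have hSo : IsOpen (W ×ˢ (Set.univ : Set ((V₁ →L[ℝ] V₂) × (V₂ →L[ℝ] V₁)))) :=
    hW.prod isOpen_univ
  have h0 : (graphForm (G x₀) 0, graphForm (B x₀) 0) =
      (0 : (V₁ →L[ℝ] V₂ →L[ℝ] ℝ) × (V₁ →L[ℝ] V₂ →L[ℝ] ℝ)) := by
    refine Prod.ext ?_ ?_
    · ext a b
      simpa [graphForm_apply, graphMap_apply] using h₂ a a.2 b b.2
    · ext a b
      have : B x₀ a b = 0 := by rw [h₁ a a.2, h₂ a a.2 b b.2, mul_zero]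
      simpa [graphForm_apply, graphMap_apply] using this
  have hGd := ((hGs _ hu).contDiffAt (hSo.mem_nhds hu)).differentiableAt (by simp)
  have hBd := ((hBs _ hu).contDiffAt (hSo.mem_nhds hu)).differentiableAt (by simp)
  have hd := (hGd.hasFDerivAt.prodMk hBd.hasFDerivAt).fderiv
  -- The unknowns are the two graph maps and the equations are the vanishing of both cross forms.
  -- Subtracting `t` times the linearized equation for `G` from the one for `B` eliminates the
  -- second unknown; by `h₃` the first is then zero, and positivity kills the second. Unknowns and
  -- equations both have dimension 2 dim V₁ dim V₂.
  have hinv := isInvertible_of_injective (fderiv ℝ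
    (fun w : X × ((V₁ →L[ℝ] V₂) × (V₂ →L[ℝ] V₁)) =>
      (graphForm (G w.1) w.2, graphForm (B w.1) w.2)) (x₀, 0) ∘L .inr ℝ X _) (by
    intro ζ hζ
    rw [hd] at hζ
    have k1 (a : V₁) (b : V₂) : G x₀ (ζ.1 a) b + G x₀ a (ζ.2 b) = 0 := by
      rw [← fderiv_graphForm hW hG hx₀]
      exact DFunLike.congr_fun (DFunLike.congr_fun (congrArg Prod.fst hζ) a) b
    have k2 (a : V₁) (b : V₂) : B x₀ (ζ.1 a) b + t * G x₀ a (ζ.2 b) = 0 := by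
      rw [← h₁ a a.2, ← fderiv_graphForm hW hB hx₀]
      exact DFunLike.congr_fun (DFunLike.congr_fun (congrArg Prod.snd hζ) a) b
    have k3 (a : V₁) : ζ.1 a = 0 := by
      apply Subtype.ext
      refine h₃ _ (ζ.1 a).2 fun b hb => ?_
      have e1 : G x₀ (ζ.1 a) b + G x₀ a (ζ.2 ⟨b, hb⟩) = 0 := k1 a ⟨b, hb⟩
      have e2 : B x₀ (ζ.1 a) b + t * G x₀ a (ζ.2 ⟨b, hb⟩) = 0 := k2 a ⟨b, hb⟩
      linear_combination e2 - t * e1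
    have k4 (b : V₂) : ζ.2 b = 0 := by
      by_contra hne
      have h := k1 (ζ.2 b) b
      rw [k3, ZeroMemClass.coe_zero, map_zero, zero_apply, zero_add] at h
      exact (hpos (ζ.2 b) (by simpa using hne)).ne' h
    exact Prod.ext (ContinuousLinearMap.ext k3) (ContinuousLinearMap.ext k4)) (by
    simp only [Module.finrank_prod, finrank_continuousLinearMap, Module.finrank_self, mul_one]
    rw [mul_comm (Module.finrank ℝ V₂)])
  obtain ⟨U, hUo, hxU, z, -, hz, hFz⟩ :=
    exists_smooth_implicitFunction hSo (hGs.prodMk hBs) hu h0 hinv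
  refine ⟨U ∩ W, hUo.inter hW, ⟨hxU, hx₀⟩, Set.inter_subset_right, fun x => graphMap (z x).1,
    fun x => graphMap (z x).2,
    contDiff_graphMap.comp_contDiffOn (contDiff_fst.comp_contDiffOn (hz.mono Set.inter_subset_left)),
    contDiff_graphMap.comp_contDiffOn (contDiff_snd.comp_contDiffOn (hz.mono Set.inter_subset_left)),
    fun x a h => graphMap_eq_zero hV _ h, fun x b h => graphMap_eq_zero hV.symm _ h,
    fun x hx a b => ?_⟩
  have h := hFz x hx.1
  exact ⟨DFunLike.congr_fun (DFunLike.congr_fun (congrArg Prod.fst h) a) b,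
    DFunLike.congr_fun (DFunLike.congr_fun (congrArg Prod.snd h) a) b⟩

end Split

/-! ### Simultaneous smooth diagonalization on an open subset. -/

section Diagonal

universe u

variable {X : Type*} [NormedAddCommGroup X] [NormedSpace ℝ X] [FiniteDimensional ℝ X]

/-- `e` is a smooth `G`-orthonormal frame in which `B` is diagonal. -/
structure IsDiagonalFrameOn {V : Type*} [NormedAddCommGroup V] [NormedSpace ℝ V]
    (G B : X → V →L[ℝ] V →L[ℝ] ℝ) (U : Set X) {ι : Type*} (e : ι → X → V) : Prop where
  smooth : ∀ i, ContDiffOn ℝ ∞ (e i) U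
  unit : ∀ x ∈ U, ∀ i, G x (e i x) (e i x) = 1
  orthogonal : ∀ x ∈ U, ∀ i j, i ≠ j → G x (e i x) (e j x) = 0
  diagonal : ∀ x ∈ U, ∀ i j, i ≠ j → B x (e i x) (e j x) = 0

section Blocks

variable {V V₁ V₂ : Type*} [NormedAddCommGroup V] [NormedSpace ℝ V]
  [NormedAddCommGroup V₁] [NormedSpace ℝ V₁] [NormedAddCommGroup V₂] [NormedSpace ℝ V₂]
  {G B : X → V →L[ℝ] V →L[ℝ] ℝ} {U : Set X}

theorem contDiffOn_pullForm (hG : ContDiffOn ℝ ∞ G U) {P : X → V₁ →L[ℝ] V}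
    (hP : ContDiffOn ℝ ∞ P U) : ContDiffOn ℝ ∞ (fun x => pullForm (G x) (P x)) U :=
  (((ContinuousLinearMap.compL ℝ V₁ V ℝ).flip.contDiff).comp_contDiffOn hP).clm_comp
    (hG.clm_comp hP)

theorem IsDiagonalFrameOn.mono {ι : Type*} {e : ι → X → V} (he : IsDiagonalFrameOn G B U e)
    {U' : Set X} (h : U' ⊆ U) : IsDiagonalFrameOn G B U' e :=
  ⟨fun i => (he.smooth i).mono h, fun x hx => he.unit x (h hx),
    fun x hx => he.orthogonal x (h hx), fun x hx => he.diagonal x (h hx)⟩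

/-- Frames for two complementary blocks give a frame. -/
theorem IsDiagonalFrameOn.sum_elim (hGs : ∀ x ∈ U, ∀ a b, G x a b = G x b a)
    (hBs : ∀ x ∈ U, ∀ a b, B x a b = B x b a) {P : X → V₁ →L[ℝ] V} {Q : X → V₂ →L[ℝ] V}
    (hP : ContDiffOn ℝ ∞ P U) (hQ : ContDiffOn ℝ ∞ Q U)
    (h : ∀ x ∈ U, ∀ a b, G x (P x a) (Q x b) = 0 ∧ B x (P x a) (Q x b) = 0)
    {ι₁ ι₂ : Type*} {e₁ : ι₁ → X → V₁} {e₂ : ι₂ → X → V₂}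
    (h₁ : IsDiagonalFrameOn (fun x => pullForm (G x) (P x)) (fun x => pullForm (B x) (P x)) U e₁)
    (h₂ : IsDiagonalFrameOn (fun x => pullForm (G x) (Q x)) (fun x => pullForm (B x) (Q x)) U e₂) :
    IsDiagonalFrameOn G B U
      (Sum.elim (fun i x => P x (e₁ i x)) (fun j x => Q x (e₂ j x))) where
  smooth := by
    rintro (i | j)
    · exact hP.clm_apply (h₁.smooth i)
    · exact hQ.clm_apply (h₂.smooth j)
  unit := by
    rintro x hx (i | j)
    · exact h₁.unit x hx i
    · exact h₂.unit x hx j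
  orthogonal := by
    rintro x hx (i | i) (j | j) hij
    · exact h₁.orthogonal x hx i j fun h => hij (by rw [h])
    · exact (h x hx _ _).1
    · exact (hGs x hx _ _).trans (h x hx _ _).1
    · exact h₂.orthogonal x hx i j fun h => hij (by rw [h])
  diagonal := by
    rintro x hx (i | i) (j | j) hij
    · exact h₁.diagonal x hx i j fun h => hij (by rw [h])
    · exact (h x hx _ _).2
    · exact (hBs x hx _ _).trans (h x hx _ _).2
    · exact h₂.diagonal x hx i j fun h => hij (by rw [h])

end Blocks

/-- Induction on the dimension. If `B` is a multiple of `G` throughout `W`, any line with its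
orthogonal complement splits both forms. Otherwise `B` has, at some point of `W`, a proper nonzero
eigenspace relative to `G`, and the splitting there extends smoothly to a neighbourhood. Shrinking
the open set is allowed, so eigenvalue crossings are never met. -/
theorem exists_isDiagonalFrameOn_aux (n : ℕ) :
    ∀ (V : Type u) [NormedAddCommGroup V] [NormedSpace ℝ V] [FiniteDimensional ℝ V],
      Module.finrank ℝ V = n → ∀ (G B : X → V →L[ℝ] V →L[ℝ] ℝ) (W : Set X), IsOpen W →
      W.Nonempty → ContDiffOn ℝ ∞ G W → ContDiffOn ℝ ∞ B W →
      (∀ x ∈ W, ∀ a b, G x a b = G x b a) → (∀ x ∈ W, ∀ a b, B x a b = B x b a) →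
      (∀ x ∈ W, ∀ a, a ≠ 0 → 0 < G x a a) →
      ∃ U : Set X, IsOpen U ∧ U.Nonempty ∧ U ⊆ W ∧ ∃ (ι : Type) (_ : Fintype ι) (e : ι → X → V),
        Fintype.card ι = n ∧ IsDiagonalFrameOn G B U e := by
  induction n using Nat.strong_induction_on with
  | _ n ih =>
  intro V _ _ _ hn G B W hW hWne hG hB hGs hBs hpos
  rcases Nat.eq_zero_or_pos n with rfl | hn0
  · exact ⟨W, hW, hWne, subset_rfl, Empty, inferInstance, fun i => i.elim, by simp,
      ⟨fun i => i.elim, fun _ _ i => i.elim, fun _ _ i => i.elim, fun _ _ i => i.elim⟩⟩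
  have : Nontrivial V := Module.finrank_pos_iff.1 (hn ▸ hn0)
  by_cases hsc : ∀ x ∈ W, ∃ t : ℝ, ∀ a b, B x a b = t * G x a b
  · -- `B` is a multiple of `G`: split off a line
    obtain ⟨a, ha⟩ := exists_ne (0 : V)
    obtain ⟨V₂, hV₂⟩ := Submodule.exists_isCompl (ℝ ∙ a)
    have hfr : Module.finrank ℝ V₂ + 1 = n := by
      have h1 := Submodule.finrank_add_eq_of_isCompl hV₂
      rw [finrank_span_singleton ha, hn] at h1
      omega
    have haa (x : X) (hx : x ∈ W) : G x a a ≠ 0 := (hpos x hx a ha).ne'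
    let P : X → ℝ →L[ℝ] V := fun _ => ContinuousLinearMap.toSpanSingleton ℝ a
    -- One Gram-Schmidt step: the fixed complement `V₂` is made `G`-orthogonal to `a`, with `V₂`
    -- itself as a constant parameter space for the induction.
    let Q : X → V₂ →L[ℝ] V := fun x => V₂.subtypeL -
      (ContinuousLinearMap.toSpanSingleton ℝ a) ∘L ((G x a a)⁻¹ • ((G x a) ∘L V₂.subtypeL))
    have hPs : ContDiffOn ℝ ∞ P W := contDiffOn_const
    have hGa : ContDiffOn ℝ ∞ (fun x => G x a) W := hG.clm_apply contDiffOn_const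
    have hGaa : ContDiffOn ℝ ∞ (fun x => G x a a) W := hGa.clm_apply contDiffOn_const
    have hQs : ContDiffOn ℝ ∞ Q W :=
      contDiffOn_const.sub (contDiffOn_const.clm_comp ((hGaa.inv haa).smul
        (hGa.clm_comp contDiffOn_const)))
    have hQa (x : X) (b : V₂) : Q x b = (b : V) - ((G x a a)⁻¹ * G x a b) • a := rfl
    have hPa (x : X) (s : ℝ) : P x s = s • a := rfl
    have hQinj (x : X) (b : V₂) (hb : Q x b = 0) : b = 0 := by
      rw [hQa, sub_eq_zero] at hb
      have := hV₂.disjoint.le_bot (show (b : V) ∈ (ℝ ∙ a) ⊓ V₂ from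
        ⟨by rw [hb]; exact Submodule.smul_mem _ _ (Submodule.mem_span_singleton_self a), b.2⟩)
      simpa using this
    have hcross (x : X) (hx : x ∈ W) (s : ℝ) (b : V₂) : G x (P x s) (Q x b) = 0 := by
      rw [hPa x, hQa x]
      simp only [map_smul, smul_apply, map_sub, smul_eq_mul]
      have := haa x hx
      field_simp
      ring
    obtain ⟨U, hU, hUne, hUW, ι, hι, e, hcard, he⟩ := ih (Module.finrank ℝ V₂) (by omega) V₂ rfl
      (fun x => pullForm (G x) (Q x)) (fun x => pullForm (B x) (Q x)) W hW hWne
      (contDiffOn_pullForm hG hQs) (contDiffOn_pullForm hB hQs)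
      (fun x hx b c => hGs x hx _ _) (fun x hx b c => hBs x hx _ _)
      (fun x hx b hb => hpos x hx _ fun h => hb (hQinj x b h))
    have hline : IsDiagonalFrameOn (fun x => pullForm (G x) (P x)) (fun x => pullForm (B x) (P x)) U
        (fun (_ : Unit) x => (Real.sqrt (G x a a))⁻¹) := by
      refine ⟨fun _ => ?_, fun x hx _ => ?_, fun x hx i j h => (h rfl).elim,
        fun x hx i j h => (h rfl).elim⟩
      · exact ((hGaa.mono hUW).sqrt fun x hx => haa x (hUW hx)).inv fun x hx =>
          (Real.sqrt_pos.2 (hpos x (hUW hx) a ha)).ne'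
      · rw [pullForm_apply, hPa x]
        simp only [map_smul, smul_apply, smul_eq_mul]
        have h1 := hpos x (hUW hx) a ha
        have h2 := Real.sqrt_pos.2 h1
        have h3 := Real.mul_self_sqrt h1.le
        field_simp
        nlinarith
    refine ⟨U, hU, hUne, hUW, Unit ⊕ ι, inferInstance, _, ?_, IsDiagonalFrameOn.sum_elim
      (fun x hx => hGs x (hUW hx)) (fun x hx => hBs x (hUW hx)) (hPs.mono hUW) (hQs.mono hUW)
      (fun x hx s b => ?_) hline he⟩
    · rw [Fintype.card_sum, Fintype.card_unit, hcard]
      omega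
    · obtain ⟨t, ht⟩ := hsc x (hUW hx)
      rw [ht, hcross x (hUW hx), mul_zero]
      exact ⟨rfl, rfl⟩
  · push Not at hsc
    obtain ⟨x₀, hx₀, hns⟩ := hsc
    obtain ⟨t, a₀, ha₀, ht⟩ := exists_eigenvalue (hpos x₀ hx₀) (hBs x₀ hx₀) (hGs x₀ hx₀)
    let V₁ : Submodule ℝ V := LinearMap.ker (B x₀ - t • G x₀).toLinearMap
    have hV₁ {a : V} : a ∈ V₁ ↔ ∀ b, B x₀ a b = t * G x₀ a b := by
      refine ⟨fun h b => ?_, fun h => ?_⟩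
      · have h1 : (B x₀ - t • G x₀) a = 0 := h
        have h2 : B x₀ a b - t * G x₀ a b = 0 := DFunLike.congr_fun h1 b
        linarith
      · refine ContinuousLinearMap.ext fun b => ?_
        exact sub_eq_zero.2 (h b)
    let V₂ : Submodule ℝ V :=
      { carrier := {b | ∀ a ∈ V₁, G x₀ b a = 0}
        add_mem' := fun {b c} hb hc a ha => by rw [map_add, add_apply, hb a ha, hc a ha, add_zero]
        zero_mem' := fun a _ => by simp
        smul_mem' := fun s b hb a ha => by rw [map_smul, smul_apply, hb a ha, smul_zero] }
    have hV₂ {b : V} : b ∈ V₂ ↔ ∀ a ∈ V₁, G x₀ b a = 0 := Iff.rfl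
    have hdisj : Disjoint V₁ V₂ := by
      rw [Submodule.disjoint_def]
      intro a h1 h2
      by_contra h0
      exact (hpos x₀ hx₀ a h0).ne' (hV₂.1 h2 a h1)
    have hcod : Codisjoint V₁ V₂ := by
      rw [Submodule.codisjoint_iff_exists_add_eq]
      intro ξ
      obtain ⟨c, hc1, hc2⟩ := exists_normalPart (hpos x₀ hx₀) V₁ ξ
      exact ⟨ξ - c, c, hc2, hc1, by simp⟩
    have hsum := Submodule.finrank_add_eq_of_isCompl (⟨hdisj, hcod⟩ : IsCompl V₁ V₂)
    have hne1 : 0 < Module.finrank ℝ V₁ :=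
      Module.finrank_pos_iff_exists_ne_zero.2 ⟨⟨a₀, hV₁.2 ht⟩, by simpa using ha₀⟩
    have hne2 : 0 < Module.finrank ℝ V₂ := by
      by_contra h
      have h1 : V₁ = ⊤ := Submodule.eq_top_of_finrank_eq (by omega)
      obtain ⟨a, b, hab⟩ := hns t
      exact hab (hV₁.1 (h1 ▸ Submodule.mem_top) b)
    obtain ⟨U₀, hU₀, hx₀U, hU₀W, P, Q, hP, hQ, hPi, hQi, hPQ⟩ := exists_smooth_splitting hW hG hB
      hx₀ (hpos x₀ hx₀) t hdisj (fun a ha => hV₁.1 ha)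
      (fun a ha b hb => (hGs x₀ hx₀ a b).trans (hV₂.1 hb a ha)) (fun b hb h => by
        -- The eigenvalue relation against `V₁` holds automatically by symmetry, so a relation
        -- against `V₂` makes `b` an eigenvector for `t`, and `V₁` meets `V₂` only in zero.
        have h1 : b ∈ V₁ := hV₁.2 fun c => by
          obtain ⟨c1, c2, h1, h2, rfl⟩ := Submodule.codisjoint_iff_exists_add_eq.1 hcod c
          rw [map_add, map_add, h c2 h2, hBs x₀ hx₀ b c1, hV₁.1 h1 b, hGs x₀ hx₀ c1 b]
          ring
        exact (Submodule.disjoint_def.1 hdisj) b h1 hb)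
    obtain ⟨U₁, hU₁, hU₁ne, hU₁U, ι₁, _, e₁, hc₁, he₁⟩ := ih (Module.finrank ℝ V₁) (by omega) V₁ rfl
      (fun x => pullForm (G x) (P x)) (fun x => pullForm (B x) (P x)) U₀ hU₀ ⟨x₀, hx₀U⟩
      (contDiffOn_pullForm (hG.mono hU₀W) hP) (contDiffOn_pullForm (hB.mono hU₀W) hP)
      (fun x hx b c => hGs x (hU₀W hx) _ _) (fun x hx b c => hBs x (hU₀W hx) _ _)
      (fun x hx b hb => hpos x (hU₀W hx) _ fun h => hb (hPi x b h))
    -- The second block is treated inside `U₁`, so that both frames live on `U₂`.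
    obtain ⟨U₂, hU₂, hU₂ne, hU₂U, ι₂, _, e₂, hc₂, he₂⟩ := ih (Module.finrank ℝ V₂) (by omega) V₂ rfl
      (fun x => pullForm (G x) (Q x)) (fun x => pullForm (B x) (Q x)) U₁ hU₁ hU₁ne
      (contDiffOn_pullForm (hG.mono (hU₁U.trans hU₀W)) (hQ.mono hU₁U))
      (contDiffOn_pullForm (hB.mono (hU₁U.trans hU₀W)) (hQ.mono hU₁U))
      (fun x hx b c => hGs x (hU₀W (hU₁U hx)) _ _) (fun x hx b c => hBs x (hU₀W (hU₁U hx)) _ _)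
      (fun x hx b hb => hpos x (hU₀W (hU₁U hx)) _ fun h => hb (hQi x b h))
    have hsub : U₂ ⊆ W := hU₂U.trans (hU₁U.trans hU₀W)
    refine ⟨U₂, hU₂, hU₂ne, hsub, ι₁ ⊕ ι₂, inferInstance, _, ?_, IsDiagonalFrameOn.sum_elim
      (fun x hx => hGs x (hsub hx)) (fun x hx => hBs x (hsub hx)) (hP.mono (hU₂U.trans hU₁U))
      (hQ.mono (hU₂U.trans hU₁U)) (fun x hx => hPQ x (hU₁U (hU₂U hx))) (he₁.mono hU₂U) he₂⟩
    rw [Fintype.card_sum, hc₁, hc₂, hsum, hn]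

/-- Two smooth families of symmetric forms, one of them positive definite, can be diagonalized
simultaneously and smoothly on some open subset of any nonempty open set. -/
theorem exists_isDiagonalFrameOn {V : Type u} [NormedAddCommGroup V] [NormedSpace ℝ V]
    [FiniteDimensional ℝ V] {n : ℕ} (hn : Module.finrank ℝ V = n) {G B : X → V →L[ℝ] V →L[ℝ] ℝ}
    {W : Set X} (hW : IsOpen W) (hWne : W.Nonempty) (hG : ContDiffOn ℝ ∞ G W)
    (hB : ContDiffOn ℝ ∞ B W) (hGs : ∀ x ∈ W, ∀ a b, G x a b = G x b a)
    (hBs : ∀ x ∈ W, ∀ a b, B x a b = B x b a) (hpos : ∀ x ∈ W, ∀ a, a ≠ 0 → 0 < G x a a) :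
    ∃ U : Set X, IsOpen U ∧ U.Nonempty ∧ U ⊆ W ∧ ∃ e : Fin n → X → V,
      IsDiagonalFrameOn G B U e := by
  obtain ⟨U, hU, hUne, hUW, ι, _, e, hcard, he⟩ :=
    exists_isDiagonalFrameOn_aux n V hn G B W hW hWne hG hB hGs hBs hpos
  let σ : Fin n ≃ ι := (Fintype.equivFinOfCardEq hcard).symm
  exact ⟨U, hU, hUne, hUW, fun i => e (σ i), fun i => he.smooth _, fun x hx i => he.unit x hx _,
    fun x hx i j hij => he.orthogonal x hx _ _ fun h => hij (σ.injective h),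
    fun x hx i j hij => he.diagonal x hx _ _ fun h => hij (σ.injective h)⟩

end Diagonal

/-! ### The strong maximum principle with bounded coefficients on a dense set. -/

section MaximumPrinciple

open Filter Topology
open scoped RealInnerProductSpace

/-- The Hessian of a `C²` function is nonpositive at a local maximum. -/
theorem IsLocalMax.fderiv_fderiv_apply_le_zero {E : Type*} [NormedAddCommGroup E] [NormedSpace ℝ E]
    {h : E → ℝ} {x : E} (hm : IsLocalMax h x) (hh : ContDiffAt ℝ 2 h x) (a : E) :
    fderiv ℝ (fderiv ℝ h) x a a ≤ 0 := by
  by_contra! hpos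
  let f : ℝ → ℝ := fun t => h (x + t • a)
  have hline (t : ℝ) : HasDerivAt (fun t : ℝ => x + t • a) a t := by
    simpa using ((hasDerivAt_id t).smul_const a).const_add x
  have hx0 : x + (0 : ℝ) • a = x := by simp
  have hcl : Tendsto (fun t : ℝ => x + t • a) (𝓝 0) (𝓝 x) := by
    have := (hline 0).continuousAt.tendsto
    rwa [hx0] at this
  have hd : ∀ᶠ t in 𝓝 (0 : ℝ), HasDerivAt f (fderiv ℝ h (x + t • a) a) t := by
    have h1 : ∀ᶠ y in 𝓝 x, DifferentiableAt ℝ h y := by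
      filter_upwards [hh.eventually (by simp)] with y hy
      exact hy.differentiableAt (by simp)
    filter_upwards [hcl h1] with t ht
    exact (ht : DifferentiableAt ℝ h _).hasFDerivAt.comp_hasDerivAt t (hline t)
  have hdf : deriv f =ᶠ[𝓝 0] fun t => fderiv ℝ h (x + t • a) a := by
    filter_upwards [hd] with t ht using ht.deriv
  have h2 : DifferentiableAt ℝ (fderiv ℝ h) x :=
    (hh.fderiv_right (m := 1) (by norm_num)).differentiableAt (by simp)
  have hdd : HasDerivAt (deriv f) (fderiv ℝ (fderiv ℝ h) x a a) 0 := by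
    refine HasDerivAt.congr_of_eventuallyEq ?_ hdf
    have h3 := h2.hasFDerivAt.comp_hasDerivAt_of_eq 0 (hline 0) hx0.symm
    simpa using h3.clm_apply (hasDerivAt_const 0 a)
  have hmax : IsLocalMax f 0 := by
    have := hcl hm
    filter_upwards [this] with t ht
    simpa [f] using ht
  -- A positive second derivative would make 0 a local minimum as well as a local maximum. Then `f`
  -- would be constant near 0, and its second derivative would vanish.
  have hmin : IsLocalMin f 0 := by
    refine isLocalMin_of_deriv_deriv_pos (by rwa [hdd.deriv]) hmax.deriv_eq_zero ?_
    exact hd.self_of_nhds.continuousAt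
  have hconst : f =ᶠ[𝓝 0] fun _ => f 0 := by
    filter_upwards [hmax, hmin] with t h1 h2 using le_antisymm h1 h2
  have h4 : deriv f =ᶠ[𝓝 0] fun _ => (0 : ℝ) := by
    filter_upwards [hconst.eventually_nhds] with t ht
    have : f =ᶠ[𝓝 t] fun _ => f 0 := ht
    rw [this.deriv_eq, deriv_const]
  have h5 := hdd.deriv
  rw [h4.deriv_eq, deriv_const] at h5
  exact hpos.ne h5

variable {E : Type*} [NormedAddCommGroup E] [InnerProductSpace ℝ E]

/-- The Gaussian `x ↦ exp (-α ‖x - y‖²)`. -/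
def gaussianBump (α : ℝ) (y x : E) : ℝ := Real.exp (-α * ‖x - y‖ ^ 2)

theorem contDiff_gaussianBump (α : ℝ) (y : E) {n : WithTop ℕ∞} : ContDiff ℝ n (gaussianBump α y) :=
  Real.contDiff_exp.comp (contDiff_const.mul ((contDiff_id.sub contDiff_const).norm_sq ℝ))

theorem hasFDerivAt_gaussianBump (α : ℝ) (y x : E) :
    HasFDerivAt (gaussianBump α y) ((-(2 * α) * gaussianBump α y x) • innerSL ℝ (x - y)) x := by
  have h1 : HasFDerivAt (fun x : E => ‖x - y‖ ^ 2) (2 • (innerSL ℝ (x - y))) x := by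
    simpa using ((hasFDerivAt_id x).sub_const y).norm_sq
  refine ((h1.const_mul (-α)).exp).congr_fderiv ?_
  ext a
  simp [gaussianBump]
  ring

theorem fderiv_gaussianBump_apply (α : ℝ) (y x b : E) :
    fderiv ℝ (gaussianBump α y) x b = gaussianBump α y x * (-(2 * α) * ⟪x - y, b⟫) := by
  rw [(hasFDerivAt_gaussianBump α y x).fderiv, smul_apply, innerSL_apply_apply, smul_eq_mul]
  ring

theorem fderiv_fderiv_gaussianBump_apply (α : ℝ) (y x a b : E) :
    fderiv ℝ (fderiv ℝ (gaussianBump α y)) x a b =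
      gaussianBump α y x * (4 * α ^ 2 * ⟪x - y, a⟫ * ⟪x - y, b⟫ - 2 * α * ⟪a, b⟫) := by
  have h : fderiv ℝ (gaussianBump α y) =
      fun x => (-(2 * α) * gaussianBump α y x) • innerSL ℝ (x - y) :=
    funext fun x => (hasFDerivAt_gaussianBump α y x).fderiv
  have h1 : HasFDerivAt (fun x : E => innerSL ℝ (x - y)) (innerSL ℝ) x := by
    exact (innerSL ℝ).hasFDerivAt.comp x ((hasFDerivAt_id x).sub_const y)
  have h2 := (((hasFDerivAt_gaussianBump α y x).const_mul (-(2 * α))).smul h1).fderiv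
  rw [h]
  refine (congrArg (fun A : E →L[ℝ] E →L[ℝ] ℝ => A a b) h2).trans ?_
  have h3 : -(2 * α) * gaussianBump α y x * ⟪a, b⟫ +
      -(2 * α) * (-(2 * α) * gaussianBump α y x * ⟪x - y, a⟫) * ⟪x - y, b⟫ =
      gaussianBump α y x * (4 * α ^ 2 * ⟪x - y, a⟫ * ⟪x - y, b⟫ - 2 * α * ⟪a, b⟫) := by ring
  exact h3

/-- The value `∑ D²u(eᵢ, eᵢ) + Du(b)` of a second order operator without zeroth order term. -/
def ellipticOp {n : ℕ} (e : Fin n → E) (b : E) (u : E → ℝ) (x : E) : ℝ :=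
  ∑ i, fderiv ℝ (fderiv ℝ u) x (e i) (e i) + fderiv ℝ u x b

/-- Ellipticity yields a gain of order α² |x - y|², against losses of order α from the trace and the
drift. For large α the operator is thus positive on the Gaussian away from its centre. -/
theorem ellipticOp_gaussianBump_ge {n : ℕ} {e : Fin n → E} {b : E} {k K Λ : ℝ}
    (he : ∀ i, ‖e i‖ ≤ Λ) (hb : ‖b‖ ≤ K) (hell : ∀ ξ : E, k * ‖ξ‖ ^ 2 ≤ ∑ i, ⟪ξ, e i⟫ ^ 2)
    {α : ℝ} (hα : 0 ≤ α) (y x : E) :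
    gaussianBump α y x * (2 * α * (2 * α * (k * ‖x - y‖ ^ 2) - n * Λ ^ 2 - K * ‖x - y‖)) ≤
      ellipticOp e b (gaussianBump α y) x := by
  have h1 : ellipticOp e b (gaussianBump α y) x = gaussianBump α y x *
      (4 * α ^ 2 * ∑ i, ⟪x - y, e i⟫ ^ 2 - 2 * α * ∑ i, ‖e i‖ ^ 2 - 2 * α * ⟪x - y, b⟫) := by
    rw [ellipticOp, fderiv_gaussianBump_apply]
    simp only [fderiv_fderiv_gaussianBump_apply, real_inner_self_eq_norm_sq]
    rw [← Finset.mul_sum, Finset.sum_sub_distrib, Finset.mul_sum, Finset.mul_sum]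
    simp only [sq, mul_assoc]
    ring
  rw [h1]
  refine mul_le_mul_of_nonneg_left ?_ (Real.exp_pos _).le
  have h2 : ∑ i, ‖e i‖ ^ 2 ≤ n * Λ ^ 2 := by
    calc ∑ i, ‖e i‖ ^ 2 ≤ ∑ _i : Fin n, Λ ^ 2 :=
          Finset.sum_le_sum fun i _ => pow_le_pow_left₀ (norm_nonneg _) (he i) 2
      _ = n * Λ ^ 2 := by simp
  have h3 : ⟪x - y, b⟫ ≤ K * ‖x - y‖ := by
    refine (real_inner_le_norm _ _).trans ?_
    rw [mul_comm]
    exact mul_le_mul_of_nonneg_right hb (norm_nonneg _)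
  have h4 := mul_le_mul_of_nonneg_left (hell (x - y)) (by positivity : 0 ≤ 4 * α ^ 2)
  have h5 := mul_le_mul_of_nonneg_left h2 (by positivity : 0 ≤ 2 * α)
  have h6 := mul_le_mul_of_nonneg_left h3 (by positivity : 0 ≤ 2 * α)
  nlinarith

/-- If `h` has a local maximum at `x`, then an elliptic operator with bounded coefficients applied
to `h` is almost nonpositive near `x`. -/
theorem eventually_ellipticOp_lt {h : E → ℝ} {x : E} (hm : IsLocalMax h x)
    (hh : ContDiffAt ℝ 2 h x) (n : ℕ) (K Λ : ℝ) {δ : ℝ} (hδ : 0 < δ) :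
    ∀ᶠ y in 𝓝 x, ∀ (e : Fin n → E) (b : E), (∀ i, ‖e i‖ ≤ Λ) → ‖b‖ ≤ K →
      ellipticOp e b h y < δ := by
  have c1 : ContinuousAt (fderiv ℝ h) x := (hh.fderiv_right (m := 1) (by norm_num)).continuousAt
  have c2 : ContinuousAt (fderiv ℝ (fderiv ℝ h)) x :=
    ((hh.fderiv_right (m := 1) (by norm_num)).fderiv_right (m := 0) (by norm_num)).continuousAt
  -- This bound depends on the coefficients through `Λ` and `K` only. It vanishes at `x`, where the
  -- gradient is zero, and the Hessian at `x` itself is nonpositive.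
  have c3 : ContinuousAt (fun y => n * (Λ ^ 2 * ‖fderiv ℝ (fderiv ℝ h) y -
      fderiv ℝ (fderiv ℝ h) x‖) + ‖fderiv ℝ h y‖ * K) x := by fun_prop
  have c4 := c3.eventually (p := fun t => t < δ) (gt_mem_nhds (by
    simpa [hm.fderiv_eq_zero] using hδ))
  filter_upwards [c4] with y hy e b he hb
  refine lt_of_le_of_lt ?_ hy
  rw [ellipticOp]
  refine add_le_add ?_ ?_
  · have h1 (i : Fin n) : fderiv ℝ (fderiv ℝ h) y (e i) (e i) ≤
        Λ ^ 2 * ‖fderiv ℝ (fderiv ℝ h) y - fderiv ℝ (fderiv ℝ h) x‖ := by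
      have h2 := hm.fderiv_fderiv_apply_le_zero hh (e i)
      have h3 := (le_abs_self _).trans
        ((fderiv ℝ (fderiv ℝ h) y - fderiv ℝ (fderiv ℝ h) x).le_opNorm₂ (e i) (e i))
      rw [sub_apply, sub_apply] at h3
      have h4 : ‖fderiv ℝ (fderiv ℝ h) y - fderiv ℝ (fderiv ℝ h) x‖ * ‖e i‖ * ‖e i‖ ≤
          Λ ^ 2 * ‖fderiv ℝ (fderiv ℝ h) y - fderiv ℝ (fderiv ℝ h) x‖ := by
        have h5 := pow_le_pow_left₀ (norm_nonneg _) (he i) 2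
        have h6 := mul_le_mul_of_nonneg_right h5
          (norm_nonneg (fderiv ℝ (fderiv ℝ h) y - fderiv ℝ (fderiv ℝ h) x))
        linarith
      linarith
    calc _ ≤ ∑ _i : Fin n, Λ ^ 2 * ‖fderiv ℝ (fderiv ℝ h) y - fderiv ℝ (fderiv ℝ h) x‖ :=
          Finset.sum_le_sum fun i _ => h1 i
      _ = _ := by simp
  · refine (le_abs_self _).trans (((fderiv ℝ h y).le_opNorm b).trans ?_)
    exact mul_le_mul_of_nonneg_left hb (norm_nonneg _)

variable [FiniteDimensional ℝ E]

/-- The strong maximum principle, for a `C²` function that is a subsolution, at the points of a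
dense set, of elliptic equations whose coefficients are bounded but not necessarily continuous. -/
theorem eventually_eq_of_subsolution {n : ℕ} {Ω : Set E} (hΩ : IsOpen Ω) {u : E → ℝ}
    (hu : ContDiffOn ℝ 2 u Ω) {M : ℝ} (hM : ∀ x ∈ Ω, u x ≤ M) {k K Λ : ℝ} (hk : 0 < k)
    {D : Set E} (hD : Ω ⊆ closure D)
    (hL : ∀ x ∈ D, x ∈ Ω → ∃ (e : Fin n → E) (b : E), (∀ i, ‖e i‖ ≤ Λ) ∧ ‖b‖ ≤ K ∧
      (∀ ξ : E, k * ‖ξ‖ ^ 2 ≤ ∑ i, ⟪ξ, e i⟫ ^ 2) ∧ 0 ≤ ellipticOp e b u x)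
    {x₀ : E} (hx₀ : x₀ ∈ Ω) (hux₀ : u x₀ = M) : ∀ᶠ x in 𝓝 x₀, u x = M := by
  obtain ⟨R, hR, hRΩ⟩ := Metric.isOpen_iff.1 hΩ x₀ hx₀
  by_contra hcon
  rw [Metric.eventually_nhds_iff] at hcon
  push Not at hcon
  -- The radius R / 4 ensures that the ball about `y₀` up to the nearest point of the maximum set
  -- stays within distance R / 2 of `x₀`.
  obtain ⟨y₀, hy₀, huy₀⟩ := hcon (R / 4) (by linarith)
  have hΩc {x : E} (hx : x ∈ Ω) : ContDiffAt ℝ 2 u x := (hu x hx).contDiffAt (hΩ.mem_nhds hx)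
  have hsub : Metric.closedBall x₀ (R / 2) ⊆ Ω :=
    (Metric.closedBall_subset_ball (by linarith)).trans hRΩ
  -- the point of `{u = M}` that is nearest to `y₀`
  have hA : IsCompact (Metric.closedBall x₀ (R / 2) ∩ u ⁻¹' {M}) := by
    have h1 : IsClosed (Metric.closedBall x₀ (R / 2) ∩ u ⁻¹' {M}) :=
      (hu.continuousOn.mono hsub).preimage_isClosed_of_isClosed Metric.isClosed_closedBall
        isClosed_singleton
    exact (isCompact_closedBall x₀ (R / 2)).of_isClosed_subset h1 Set.inter_subset_left
  obtain ⟨z, ⟨hz1, hz2⟩, hzmin⟩ := hA.exists_isMinOn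
    ⟨x₀, Metric.mem_closedBall_self (by linarith), hux₀⟩
    (continuous_id.dist continuous_const : Continuous fun x => dist x y₀).continuousOn
  have huz : u z = M := hz2
  set r := dist z y₀ with hr
  have hr4 : r < R / 4 := by
    have : r ≤ dist x₀ y₀ := hzmin ⟨Metric.mem_closedBall_self (by linarith), hux₀⟩
    rw [dist_comm] at hy₀
    linarith
  have hr0 : 0 < r := by
    refine dist_pos.2 fun h => huy₀ ?_
    rw [← h, huz]
  have hin {x : E} (hx : dist x y₀ < r) : u x < M := by
    have h1 : x ∈ Metric.closedBall x₀ (R / 2) := by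
      rw [Metric.mem_closedBall]
      have := dist_triangle x y₀ x₀
      linarith
    refine lt_of_le_of_ne (hM x (hsub h1)) fun h => ?_
    have : r ≤ dist x y₀ := hzmin ⟨h1, h⟩
    linarith
  -- a smaller ball that touches `{u = M}` at `z` only
  set y := midpoint ℝ y₀ z with hy
  set r' := r / 2 with hr'
  have hyz : dist z y = r' := by
    rw [hy, dist_right_midpoint (𝕜 := ℝ)]
    rw [dist_comm y₀ z, ← hr, hr', Real.norm_eq_abs, abs_of_pos (by norm_num : (0 : ℝ) < 2)]
    ring
  have hyy : dist y y₀ = r' := by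
    rw [hy, dist_midpoint_left (𝕜 := ℝ)]
    rw [dist_comm y₀ z, ← hr, hr', Real.norm_eq_abs, abs_of_pos (by norm_num : (0 : ℝ) < 2)]
    ring
  have htouch {x : E} (hx : dist x y ≤ r') (hxz : x ≠ z) : u x < M := by
    refine hin ?_
    by_contra! h
    have h1 : dist x y₀ ≤ dist x y + dist y y₀ := dist_triangle _ _ _
    have h2 : dist x y = r' := by linarith
    refine hxz ?_
    have h4 : dist y₀ y = dist y₀ x / 2 := by
      rw [dist_comm, hyy, dist_comm]; linarith
    have h5 : dist x y = dist y₀ x / 2 := by rw [h2, dist_comm]; linarith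
    have h6 := eq_midpoint_of_dist_eq_half (x := y₀) (y := y) (z := x) (by linarith) (by
      rw [dist_comm, h5])
    have h7 : midpoint ℝ y₀ x = midpoint ℝ y₀ z := by rw [← h6, hy]
    rw [← AffineEquiv.pointReflection_midpoint_left (R := ℝ) y₀ x, h7,
      AffineEquiv.pointReflection_midpoint_left]
  have hr'0 : 0 < r' := by linarith
  -- the barrier
  obtain ⟨α, hα0, hα⟩ : ∃ α : ℝ, 0 < α ∧
      1 ≤ 2 * α * (k * (r' / 2) ^ 2) - n * Λ ^ 2 - K * (2 * r') := by
    have hkr : 0 < k * (r' / 2) ^ 2 := by positivity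
    -- `α` makes the Gaussian a strict subsolution for r' / 2 ≤ |x - y| ≤ 2 r'. The sign of `K` is
    -- not yet known, hence the absolute value.
    refine ⟨(1 + n * Λ ^ 2 + |K| * (2 * r')) / (2 * (k * (r' / 2) ^ 2)), by positivity, ?_⟩
    have h1 : 2 * ((1 + n * Λ ^ 2 + |K| * (2 * r')) / (2 * (k * (r' / 2) ^ 2))) *
        (k * (r' / 2) ^ 2) = 1 + n * Λ ^ 2 + |K| * (2 * r') := by
      field_simp
    rw [h1]
    nlinarith [le_abs_self K]
  set c := Real.exp (-α * r' ^ 2) with hc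
  set s := r' / 2 with hs
  have hCΩ : Metric.closedBall z s ⊆ Ω := by
    intro x hx
    apply hRΩ
    rw [Metric.mem_closedBall] at hx hz1
    rw [Metric.mem_ball]
    have := dist_triangle x z x₀
    linarith
  have hpos (x : E) : 0 < gaussianBump α y x := Real.exp_pos _
  have hle1 (x : E) : gaussianBump α y x ≤ 1 := by
    rw [gaussianBump, Real.exp_le_one_iff]
    have : 0 ≤ α * ‖x - y‖ ^ 2 := by positivity
    linarith
  have hout {x : E} (hx : r' < dist x y) : gaussianBump α y x < c := by
    rw [gaussianBump, hc, Real.exp_lt_exp, ← dist_eq_norm]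
    have := mul_lt_mul_of_pos_left (pow_lt_pow_left₀ hx hr'0.le two_ne_zero) hα0
    linarith
  have hwz : gaussianBump α y z = c := by rw [gaussianBump, hc, ← dist_eq_norm, hyz]
  -- The part of the small sphere inside the touching ball is compact and avoids `z`, so `u` stays
  -- away from its maximum there. On the rest of the sphere the Gaussian is below `c`.
  obtain ⟨η, hη0, hη⟩ : ∃ η : ℝ, 0 < η ∧
      ∀ x ∈ Metric.sphere z s, dist x y ≤ r' → u x ≤ M - η := by
    have hcomp : IsCompact (Metric.sphere z s ∩ Metric.closedBall y r') :=
      (isCompact_sphere z s).inter_right Metric.isClosed_closedBall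
    rcases (Metric.sphere z s ∩ Metric.closedBall y r').eq_empty_or_nonempty with h | h
    · refine ⟨1, one_pos, fun x hx hxy => ?_⟩
      exact absurd (show x ∈ Metric.sphere z s ∩ Metric.closedBall y r' from ⟨hx, hxy⟩) (by simp [h])
    · obtain ⟨x₁, hx₁, hmax⟩ := hcomp.exists_isMaxOn h (hu.continuousOn.mono fun x hx =>
        hCΩ (Metric.sphere_subset_closedBall hx.1))
      refine ⟨M - u x₁, sub_pos.2 (htouch hx₁.2 fun h => ?_), fun x hx hxy => ?_⟩
      · have := hx₁.1
        rw [h, Metric.mem_sphere, dist_self] at this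
        linarith
      · rw [sub_sub_cancel]
        exact hmax ⟨hx, hxy⟩
  -- With ε < η and a Gaussian of at most 1, the perturbed function is smaller on the whole sphere
  -- than at the centre `z`, so its maximum over the closed ball is interior.
  set ε := η / 2 with hε
  have hε0 : 0 < ε := by linarith
  let h : E → ℝ := fun x => u x + ε * gaussianBump α y x
  have hhc {x : E} (hx : x ∈ Ω) : ContDiffAt ℝ 2 h x :=
    (hΩc hx).add (contDiffAt_const.mul (contDiff_gaussianBump α y).contDiffAt)
  have hhz : h z = M + ε * c := by simp only [h, huz, hwz]
  have hbd {x : E} (hx : x ∈ Metric.sphere z s) : h x < M + ε * c := by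
    have hcp : 0 < c := Real.exp_pos _
    by_cases hxy : dist x y ≤ r'
    · have h1 := hη x hx hxy
      have h2 := mul_le_mul_of_nonneg_left (hle1 x) hε0.le
      have h3 : 0 < ε * c := by positivity
      simp only [h]
      linarith
    · have h1 := hM x (hCΩ (Metric.sphere_subset_closedBall hx))
      have h2 := mul_lt_mul_of_pos_left (hout (not_le.1 hxy)) hε0
      simp only [h]
      linarith
  obtain ⟨x₁, hx₁, hx₁max⟩ := (isCompact_closedBall z s).exists_isMaxOn
    ⟨z, Metric.mem_closedBall_self (by linarith)⟩
    (fun x hx => (hhc (hCΩ hx)).continuousAt.continuousWithinAt : ContinuousOn h _)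
  have hx₁b : x₁ ∈ Metric.ball z s := by
    rw [← Metric.ball_union_sphere] at hx₁
    rcases hx₁ with h1 | h1
    · exact h1
    · have h2 := hbd h1
      have h3 : h z ≤ h x₁ := hx₁max (Metric.mem_closedBall_self (by linarith))
      linarith
  have hloc : IsLocalMax h x₁ :=
    hx₁max.isLocalMax (Filter.mem_of_superset (Metric.isOpen_ball.mem_nhds hx₁b)
      Metric.ball_subset_closedBall)
  -- contradiction at a nearby point of `D`
  set δ := ε * (Real.exp (-α * (2 * r') ^ 2) * (2 * α)) with hδ
  have hδ0 : 0 < δ := by positivity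
  have hev := (eventually_ellipticOp_lt hloc (hhc (hCΩ hx₁)) n K Λ hδ0).and
    (Metric.isOpen_ball.mem_nhds hx₁b)
  -- The interior maximum `x₁` need not lie in `D`. At points of `D` near it, every admissible
  -- operator gives less than `δ` on `h`, yet the subsolution inequality and the barrier give at
  -- least `δ`.
  have hfreq : ∃ᶠ x in 𝓝 x₁, x ∈ D := mem_closure_iff_frequently.1 (hD (hCΩ hx₁))
  obtain ⟨x, hxD, hxL, hxb⟩ := (hfreq.and_eventually hev).exists
  have hxΩ := hCΩ (Metric.ball_subset_closedBall hxb)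
  obtain ⟨e, b, he, hb, hell, hge⟩ := hL x hxD hxΩ
  have h1 := hxL e b he hb
  have hadd : ellipticOp e b h x = ellipticOp e b u x + ε * ellipticOp e b (gaussianBump α y) x := by
    have d1 : ∀ᶠ x' in 𝓝 x, fderiv ℝ h x' = fderiv ℝ u x' + ε • fderiv ℝ (gaussianBump α y) x' := by
      filter_upwards [hΩ.mem_nhds hxΩ] with x' hx'
      exact (((hΩc hx').differentiableAt (by simp)).hasFDerivAt.add
        ((contDiff_gaussianBump α y (n := 1)).differentiable (by simp) x' |>.hasFDerivAt.const_mul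
          ε)).fderiv
    have d2 : fderiv ℝ (fderiv ℝ h) x =
        fderiv ℝ (fderiv ℝ u) x + ε • fderiv ℝ (fderiv ℝ (gaussianBump α y)) x := by
      rw [Filter.EventuallyEq.fderiv_eq d1]
      have e1 : DifferentiableAt ℝ (fderiv ℝ u) x :=
        ((hΩc hxΩ).fderiv_right (m := 1) (by norm_num)).differentiableAt (by simp)
      have e2 : DifferentiableAt ℝ (fderiv ℝ (gaussianBump α y)) x :=
        ((contDiff_gaussianBump α y (n := 2)).contDiffAt.fderiv_right (m := 1)
          (by norm_num)).differentiableAt (by simp)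
      exact (e1.hasFDerivAt.add (e2.hasFDerivAt.const_smul ε)).fderiv
    rw [ellipticOp, d2, d1.self_of_nhds, ellipticOp, ellipticOp, mul_add, Finset.mul_sum]
    simp only [add_apply, smul_apply, smul_eq_mul, Finset.sum_add_distrib]
    ring
  have h2 := ellipticOp_gaussianBump_ge he hb hell hα0.le y x
  have hd1 : r' / 2 ≤ ‖x - y‖ := by
    rw [← dist_eq_norm]
    have := dist_triangle z x y
    have h3 : dist x z < s := hxb
    rw [dist_comm] at h3
    linarith
  have hd2 : ‖x - y‖ ≤ 2 * r' := by
    rw [← dist_eq_norm]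
    have := dist_triangle x z y
    have h3 : dist x z < s := hxb
    linarith
  have hK : 0 ≤ K := (norm_nonneg b).trans hb
  have h3 : 1 ≤ 2 * α * (k * ‖x - y‖ ^ 2) - n * Λ ^ 2 - K * ‖x - y‖ := by
    have a1 := mul_le_mul_of_nonneg_left hd2 hK
    have a2 : 2 * α * (k * s ^ 2) ≤ 2 * α * (k * ‖x - y‖ ^ 2) := by gcongr
    linarith
  have h4 : Real.exp (-α * (2 * r') ^ 2) ≤ gaussianBump α y x := by
    rw [gaussianBump, Real.exp_le_exp]
    have : ‖x - y‖ ^ 2 ≤ (2 * r') ^ 2 := pow_le_pow_left₀ (norm_nonneg _) hd2 2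
    nlinarith
  have h5 : Real.exp (-α * (2 * r') ^ 2) * (2 * α) ≤ ellipticOp e b (gaussianBump α y) x := by
    refine le_trans ?_ h2
    have : 2 * α ≤ 2 * α * (2 * α * (k * ‖x - y‖ ^ 2) - n * Λ ^ 2 - K * ‖x - y‖) :=
      le_mul_of_one_le_right (by positivity) h3
    exact mul_le_mul h4 this (by positivity) (hpos x).le
  have h6 := mul_le_mul_of_nonneg_left h5 hε0.le
  rw [hadd] at h1
  linarith

end MaximumPrinciple

/-! ### Expansion in an orthonormal frame. -/

section Expansion

variable {V : Type*} [TopologicalSpace V] [AddCommGroup V] [Module ℝ V] [FiniteDimensional ℝ V]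

/-- The expansion of a vector in an orthonormal frame. -/
theorem sum_apply_smul_of_orthonormal {B : V →L[ℝ] V →L[ℝ] ℝ} {n : ℕ}
    (hn : Module.finrank ℝ V = n) (e : Fin n → V)
    (he : ∀ i j, B (e i) (e j) = if i = j then 1 else 0) (x : V) :
    ∑ i, B x (e i) • e i = x := by
  have hli : LinearIndependent ℝ e := by
    rw [Fintype.linearIndependent_iff]
    intro c hc i
    have h := congrArg (fun y => B y (e i)) hc
    simpa [map_sum, he] using h
  have hmem : x ∈ Submodule.span ℝ (Set.range e) := by
    rw [hli.span_eq_top_of_card_eq_finrank' (by simp [hn])]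
    trivial
  obtain ⟨c, rfl⟩ := (Submodule.mem_span_range_iff_exists_fun ℝ).1 hmem
  refine Finset.sum_congr rfl fun i _ => ?_
  simp [map_sum, he]

end Expansion

/-! ### The Bochner formula and uniform bounds for the coefficients. -/

section Coordinates

open Filter Topology
open scoped RealInnerProductSpace

variable {E : Type*} [NormedAddCommGroup E] [InnerProductSpace ℝ E] [FiniteDimensional ℝ E]
  {G : E → E →L[ℝ] E →L[ℝ] ℝ} {s : Set E} {y : E}

/-- The Levi-Civita connection is metric. -/
theorem fderiv_inner_fields (hG : IsMetricOn G s) (hy : y ∈ s) {Y Z : E → E}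
    (hY : DifferentiableAt ℝ Y y) (hZ : DifferentiableAt ℝ Z y) (a : E) :
    fderiv ℝ (fun z => G z (Y z) (Z z)) y a =
      G y (coordCov G Y y a) (Z y) + G y (Y y) (coordCov G Z y a) := by
  have h1 := (((hG.contDiffAt hy).differentiableAt (by simp)).hasFDerivAt.clm_apply
    hY.hasFDerivAt).clm_apply hZ.hasFDerivAt
  rw [h1.fderiv]
  simp only [add_apply, ContinuousLinearMap.comp_apply, ContinuousLinearMap.flip_apply, coordCov,
    map_add, hG.fderiv_eq hy]
  ring

/-- The Hessian of `G(V, V)` for the Levi-Civita connection. -/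
theorem fderiv_fderiv_sq_norm (hG : IsMetricOn G s) (hy : y ∈ s) {V Y : E → E}
    (hV : ContDiffAt ℝ ∞ V y) (hY : ContDiffAt ℝ ∞ Y y) :
    fderiv ℝ (fderiv ℝ fun z => G z (V z) (V z)) y (Y y) (Y y) -
        fderiv ℝ (fun z => G z (V z) (V z)) y (leviCivita G y (Y y) (Y y)) =
      2 * G y (coordCov G (fun z => coordCov G V z (Y z)) y (Y y) -
        coordCov G V y (coordCov G Y y (Y y))) (V y) +
      2 * G y (coordCov G V y (Y y)) (coordCov G V y (Y y)) := by
  have hd1 : ContDiffAt ℝ ∞ (fun z => G z (V z) (V z)) y :=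
    ((hG.contDiffAt hy).clm_apply hV).clm_apply hV
  have hVd : ∀ᶠ z in 𝓝 y, DifferentiableAt ℝ V z := by
    filter_upwards [(hV.of_le (m := 1) (by exact_mod_cast le_top)).eventually (by simp)] with z hz
    exact hz.differentiableAt (by simp)
  have hf {z : E} (hz : z ∈ s) (hVz : DifferentiableAt ℝ V z) (a : E) :
      fderiv ℝ (fun z => G z (V z) (V z)) z a = 2 * G z (coordCov G V z a) (V z) := by
    rw [fderiv_inner_fields hG hz hVz hVz, hG.symm z hz (V z)]
    ring
  have hVy := hVd.self_of_nhds
  have h1 : (fun z => fderiv ℝ (fun z => G z (V z) (V z)) z (Y z)) =ᶠ[𝓝 y]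
      fun z => 2 * G z (coordCov G V z (Y z)) (V z) := by
    filter_upwards [hVd, hG.isOpen.mem_nhds hy] with z hz hzs using hf hzs hz (Y z)
  have h2 : DifferentiableAt ℝ (fderiv ℝ fun z => G z (V z) (V z)) y :=
    (hd1.fderiv_right (m := ∞) (by simp)).differentiableAt (by simp)
  have hYd := hY.differentiableAt (by simp)
  have h3 := (h2.hasFDerivAt.clm_apply hYd.hasFDerivAt).fderiv
  have hCY : DifferentiableAt ℝ (fun z => coordCov G V z (Y z)) y :=
    ((contDiffAt_coordCov hG hy hV).clm_apply hY).differentiableAt (by simp)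
  have hGC : DifferentiableAt ℝ (fun z => G z (coordCov G V z (Y z)) (V z)) y :=
    (((hG.contDiffAt hy).differentiableAt (by simp)).clm_apply hCY).clm_apply hVy
  have h4 : fderiv ℝ (fun z => fderiv ℝ (fun z => G z (V z) (V z)) z (Y z)) y (Y y) =
      2 * (G y (coordCov G (fun z => coordCov G V z (Y z)) y (Y y)) (V y) +
        G y (coordCov G V y (Y y)) (coordCov G V y (Y y))) := by
    rw [h1.fderiv_eq, fderiv_const_mul hGC, smul_apply, smul_eq_mul,
      fderiv_inner_fields hG hy hCY hVy]
  rw [h3] at h4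
  simp only [add_apply, ContinuousLinearMap.comp_apply, ContinuousLinearMap.flip_apply] at h4
  have h5 : coordCov G Y y (Y y) = fderiv ℝ Y y (Y y) + leviCivita G y (Y y) (Y y) := rfl
  rw [hf hy hVy] at h4 ⊢
  rw [h5, map_add, map_sub, map_add, sub_apply, add_apply]
  linarith

/-- A Bochner formula for the weighted rough Laplacian of `G(V, V)`. -/
theorem ellipticOp_sq_norm (hG : IsMetricOn G s) (hy : y ∈ s) {V : E → E}
    (hV : ContDiffAt ℝ ∞ V y) {n : ℕ} {Y : Fin n → E → E} (hY : ∀ i, ContDiffAt ℝ ∞ (Y i) y)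
    (c : Fin n → ℝ) (r : Fin n → E) :
    ellipticOp (fun i => c i • Y i y)
        (∑ i, c i ^ 2 • (-leviCivita G y (Y i y) (Y i y) - r i)) (fun z => G z (V z) (V z)) y =
      2 * G y (∑ i, c i ^ 2 • (coordCov G (fun z => coordCov G V z (Y i z)) y (Y i y) -
        coordCov G V y (coordCov G (Y i) y (Y i y)) - coordCov G V y (r i))) (V y) +
      2 * ∑ i, c i ^ 2 * G y (coordCov G V y (Y i y)) (coordCov G V y (Y i y)) := by
  have hVy := hV.differentiableAt (by simp)
  rw [ellipticOp, map_sum, map_sum, ← Finset.sum_add_distrib, sum_apply,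
    Finset.mul_sum, Finset.mul_sum, ← Finset.sum_add_distrib]
  refine Finset.sum_congr rfl fun i _ => ?_
  have h1 := fderiv_fderiv_sq_norm hG hy hV (hY i)
  have h2 : fderiv ℝ (fun z => G z (V z) (V z)) y (r i) = 2 * G y (coordCov G V y (r i)) (V y) := by
    rw [fderiv_inner_fields hG hy hVy hVy, hG.symm y hy (V y)]
    ring
  simp only [map_smul, map_sub, map_neg, smul_apply, sub_apply, smul_eq_mul] at h1 ⊢
  rw [h2]
  linear_combination c i ^ 2 * h1

theorem eventually_norm_lt {X Y : Type*} [TopologicalSpace X] [NormedAddCommGroup Y] {f : X → Y}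
    {x : X} (hf : ContinuousAt f x) : ∀ᶠ z in 𝓝 x, ‖f z‖ < ‖f x‖ + 1 :=
  hf.norm.eventually (gt_mem_nhds (by linarith))

/-- Compactness of the unit sphere gives the bound 2κ at `y`; half of it survives a perturbation of
`G` of norm less than κ. -/
theorem IsMetricOn.eventually_lower_bound (hG : IsMetricOn G s) (hy : y ∈ s) :
    ∃ κ : ℝ, 0 < κ ∧ ∀ᶠ z in 𝓝 y, ∀ a, κ * ‖a‖ ^ 2 ≤ G z a a := by
  obtain ⟨κ, hκ, h⟩ : ∃ κ : ℝ, 0 < κ ∧ ∀ a, 2 * κ * ‖a‖ ^ 2 ≤ G y a a := by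
    rcases subsingleton_or_nontrivial E with hE | hE
    · exact ⟨1, one_pos, fun a => by rw [Subsingleton.elim a 0]; simp⟩
    obtain ⟨a, ha, hmin⟩ := (isCompact_sphere (0 : E) 1).exists_isMinOn
      (NormedSpace.sphere_nonempty.2 zero_le_one)
      (by fun_prop : ContinuousOn (fun a => G y a a) (Metric.sphere (0 : E) 1))
    refine ⟨G y a a / 2, half_pos (hG.pos y hy a (ne_zero_of_mem_unit_sphere ⟨a, ha⟩)),
      fun b => ?_⟩
    by_cases hb : b = 0
    · simp [hb]
    have hn : ‖b‖ ≠ 0 := by simpa using hb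
    have h2 := hmin (show ‖b‖⁻¹ • b ∈ Metric.sphere (0 : E) 1 by simp [norm_smul, hn])
    simp only [Set.mem_ofPred_eq, map_smul, smul_apply, smul_eq_mul] at h2
    calc 2 * (G y a a / 2) * ‖b‖ ^ 2 = G y a a * ‖b‖ ^ 2 := by ring
      _ ≤ (‖b‖⁻¹ * (‖b‖⁻¹ * G y b b)) * ‖b‖ ^ 2 := by gcongr
      _ = G y b b := by field_simp
  refine ⟨κ, hκ, ?_⟩
  have hc : ContinuousAt (fun z => G z - G y) y :=
    (hG.contDiffAt hy).continuousAt.sub continuousAt_const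
  filter_upwards [hc.norm.eventually (gt_mem_nhds (show ‖G y - G y‖ < κ by simpa using hκ))]
    with z hz a
  have h1 := (abs_le.1 ((G z - G y).le_opNorm₂ a a)).1
  rw [sub_apply, sub_apply] at h1
  have h2 : ‖G z - G y‖ * ‖a‖ * ‖a‖ ≤ κ * ‖a‖ ^ 2 := by
    rw [mul_assoc, ← sq]
    exact mul_le_mul_of_nonneg_right hz.le (by positivity)
  have h3 := h a
  linarith

theorem norm_coordCurvature_le (G : E → E →L[ℝ] E →L[ℝ] ℝ) (y a b w : E) :
    ‖coordCurvature G y a b w‖ ≤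
      (2 * ‖fderiv ℝ (leviCivitaL G) y‖ + 2 * ‖leviCivitaL G y‖ ^ 2) * (‖a‖ * ‖b‖ * ‖w‖) := by
  have h1 (a b : E) : ‖fderiv ℝ (leviCivitaL G) y a w b‖ ≤
      ‖fderiv ℝ (leviCivitaL G) y‖ * ‖a‖ * ‖w‖ * ‖b‖ :=
    ((fderiv ℝ (leviCivitaL G) y a).le_opNorm₂ w b).trans (by
      gcongr
      exact (fderiv ℝ (leviCivitaL G) y).le_opNorm a)
  have h2 (a b : E) : ‖leviCivita G y (leviCivita G y w b) a‖ ≤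
      ‖leviCivitaL G y‖ * (‖leviCivitaL G y‖ * ‖w‖ * ‖b‖) * ‖a‖ :=
    ((leviCivitaL G y).le_opNorm₂ (leviCivitaL G y w b) a).trans (by
      gcongr
      exact (leviCivitaL G y).le_opNorm₂ w b)
  refine (norm_sub_le _ _).trans ((add_le_add (norm_add_le _ _) le_rfl).trans ?_)
  refine (add_le_add (add_le_add (norm_sub_le _ _) le_rfl) le_rfl).trans ?_
  have h3 := h1 a b
  have h4 := h1 b a
  have h5 := h2 a b
  have h6 := h2 b a
  nlinarith

/-- Local bounds for the coefficients of the weighted rough Laplacian, uniform over all orthonormal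
frames. -/
theorem eventually_coefficient_bounds (hG : IsMetricOn G s) (hy : y ∈ s) {V : E → E}
    (hV : ContDiffAt ℝ ∞ V y) {n : ℕ} (hn : Module.finrank ℝ E = n) :
    ∃ k K Λ : ℝ, 0 < k ∧ ∀ᶠ z in 𝓝 y, ∀ (e : Fin n → E) (c : Fin n → ℝ),
      (∀ i j, G z (e i) (e j) = if i = j then 1 else 0) →
      (∀ i, c i ^ 2 * (1 + G z (coordCov G V z (e i)) (coordCov G V z (e i))) = 1) →
      (∀ i, ‖c i • e i‖ ≤ Λ) ∧
      ‖∑ i, c i ^ 2 • (-leviCivita G z (e i) (e i) -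
        coordCurvature G z (V z) (coordCov G V z (e i)) (e i))‖ ≤ K ∧
      ∀ ξ : E, k * ‖ξ‖ ^ 2 ≤ ∑ i, ⟪ξ, c i • e i⟫ ^ 2 := by
  obtain ⟨κ, hκ, hlow⟩ := hG.eventually_lower_bound hy
  have hL : ContDiffAt ℝ ∞ (leviCivitaL G) y :=
    hG.contDiffOn_leviCivitaL.contDiffAt (hG.isOpen.mem_nhds hy)
  set K₁ := ‖G y‖ + 1
  set K₂ := ‖leviCivitaL G y‖ + 1
  set K₃ := ‖fderiv ℝ (leviCivitaL G) y‖ + 1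
  set K₄ := ‖V y‖ + 1
  set K₅ := ‖coordCov G V y‖ + 1
  have hK₁ : 0 < K₁ := by positivity
  have hK₂ : 0 < K₂ := by positivity
  have hK₃ : 0 < K₃ := by positivity
  have hK₄ : 0 < K₄ := by positivity
  have hK₅ : 0 < K₅ := by positivity
  -- A `G`-unit vector has norm at most κ^(-1/2).
  set Λ := (Real.sqrt κ)⁻¹ with hΛ
  have hΛ0 : 0 < Λ := inv_pos.2 (Real.sqrt_pos.2 hκ)
  have hΛκ : Λ ^ 2 = κ⁻¹ := by rw [hΛ, inv_pow, Real.sq_sqrt hκ.le]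
  -- A lower bound for the squared weights, valid because ∇v is locally bounded.
  set γ := (1 + K₁ * (K₅ * Λ) * (K₅ * Λ))⁻¹
  have hγ : 0 < γ := by positivity
  -- The summand 1 keeps `A` positive when n = 0.
  set A := n * (K₁ * Λ) ^ 2 + 1
  have hA : 0 < A := by positivity
  refine ⟨γ / A, ∑ _i : Fin n, (K₂ * Λ * Λ + (2 * K₃ + 2 * K₂ ^ 2) * (K₄ * (K₅ * Λ) * Λ)), Λ,
    by positivity, ?_⟩
  filter_upwards [hlow, eventually_norm_lt (hG.contDiffAt hy).continuousAt,
    eventually_norm_lt hL.continuousAt,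
    eventually_norm_lt (hL.fderiv_right (m := ∞) (by simp)).continuousAt,
    eventually_norm_lt hV.continuousAt,
    eventually_norm_lt (contDiffAt_coordCov hG hy hV).continuousAt, hG.isOpen.mem_nhds hy]
    with z hlow b₁ b₂ b₃ b₄ b₅ hz e c he hc
  have ne (i : Fin n) : ‖e i‖ ≤ Λ := by
    have h1 := hlow (e i)
    rw [he i i, if_pos rfl] at h1
    refine (pow_le_pow_iff_left₀ (norm_nonneg _) hΛ0.le two_ne_zero).1 ?_
    rw [hΛκ, ← one_div, le_div_iff₀ hκ]
    linarith
  have nC (i : Fin n) : ‖coordCov G V z (e i)‖ ≤ K₅ * Λ :=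
    ((coordCov G V z).le_opNorm _).trans (mul_le_mul b₅.le (ne i) (norm_nonneg _) hK₅.le)
  have nG (a b : E) : |G z a b| ≤ K₁ * ‖a‖ * ‖b‖ :=
    ((G z).le_opNorm₂ a b).trans (by gcongr)
  have hGC (i : Fin n) : 0 ≤ G z (coordCov G V z (e i)) (coordCov G V z (e i)) :=
    le_trans (by positivity) (hlow _)
  have c1 (i : Fin n) : c i ^ 2 ≤ 1 := by
    have := mul_nonneg (sq_nonneg (c i)) (hGC i)
    have := hc i
    linarith
  have cγ (i : Fin n) : γ ≤ c i ^ 2 := by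
    have h1 : G z (coordCov G V z (e i)) (coordCov G V z (e i)) ≤ K₁ * (K₅ * Λ) * (K₅ * Λ) :=
      (le_abs_self _).trans ((nG _ _).trans (by gcongr <;> exact nC i))
    have h2 : c i ^ 2 = (1 + G z (coordCov G V z (e i)) (coordCov G V z (e i)))⁻¹ :=
      eq_inv_of_mul_eq_one_left (hc i)
    rw [h2]
    exact inv_anti₀ (by have := hGC i; linarith) (by linarith)
  refine ⟨fun i => ?_, ?_, fun ξ => ?_⟩
  · rw [norm_smul, Real.norm_eq_abs]
    have : |c i| ≤ 1 := (sq_le_one_iff_abs_le_one _).1 (c1 i)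
    exact (mul_le_of_le_one_left (norm_nonneg _) this).trans (ne i)
  · refine norm_sum_le_of_le _ fun i _ => ?_
    rw [norm_smul, Real.norm_eq_abs, abs_of_nonneg (sq_nonneg _)]
    refine (mul_le_of_le_one_left (norm_nonneg _) (c1 i)).trans ((norm_sub_le _ _).trans ?_)
    rw [norm_neg]
    refine add_le_add ?_ ?_
    · refine ((leviCivitaL G z).le_opNorm₂ (e i) (e i)).trans ?_
      gcongr <;> exact ne i
    · refine (norm_coordCurvature_le _ _ _ _ _).trans ?_
      gcongr
      · exact nC i
      · exact ne i
  -- Ellipticity: the frame is orthonormal for `G` but not for the Euclidean product. Pairing the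
  -- `G`-expansion of ξ with ξ and applying Cauchy-Schwarz compares the two.
  · have h1 : ‖ξ‖ ^ 2 = ∑ i, G z ξ (e i) * ⟪ξ, e i⟫ := by
      conv_lhs => rw [← real_inner_self_eq_norm_sq]
      conv_lhs => enter [2]; rw [← sum_apply_smul_of_orthonormal hn e he ξ]
      rw [sum_inner]
      exact Finset.sum_congr rfl fun i _ => by rw [real_inner_smul_left, real_inner_comm]
    have h2 := Finset.sum_mul_sq_le_sq_mul_sq Finset.univ (fun i => G z ξ (e i))
      (fun i => ⟪ξ, e i⟫)
    rw [← h1] at h2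
    have h3 : ∑ i, G z ξ (e i) ^ 2 ≤ A * ‖ξ‖ ^ 2 := by
      have h4 (i : Fin n) : G z ξ (e i) ^ 2 ≤ (K₁ * Λ) ^ 2 * ‖ξ‖ ^ 2 := by
        rw [← sq_abs, ← mul_pow]
        refine pow_le_pow_left₀ (abs_nonneg _) ((nG _ _).trans ?_) 2
        have := mul_le_mul_of_nonneg_left (ne i) (by positivity : 0 ≤ K₁ * ‖ξ‖)
        linarith
      calc ∑ i, G z ξ (e i) ^ 2 ≤ ∑ _i : Fin n, (K₁ * Λ) ^ 2 * ‖ξ‖ ^ 2 :=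
            Finset.sum_le_sum fun i _ => h4 i
        _ = n * (K₁ * Λ) ^ 2 * ‖ξ‖ ^ 2 := by simp; ring
        _ ≤ A * ‖ξ‖ ^ 2 := by
          have : 0 ≤ ‖ξ‖ ^ 2 := by positivity
          simp only [A]
          nlinarith
    have h5 : ‖ξ‖ ^ 2 ≤ A * ∑ i, ⟪ξ, e i⟫ ^ 2 := by
      by_cases h0 : ‖ξ‖ ^ 2 = 0
      · rw [h0]
        exact mul_nonneg hA.le (Finset.sum_nonneg fun i _ => sq_nonneg _)
      · have h6 : 0 < ‖ξ‖ ^ 2 := lt_of_le_of_ne (by positivity) (Ne.symm h0)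
        have h7 := h2.trans (mul_le_mul_of_nonneg_right h3
          (Finset.sum_nonneg fun i _ => sq_nonneg (⟪ξ, e i⟫)))
        refine le_of_mul_le_mul_left ?_ h6
        linarith
    have h8 : γ * ∑ i, ⟪ξ, e i⟫ ^ 2 ≤ ∑ i, ⟪ξ, c i • e i⟫ ^ 2 := by
      rw [Finset.mul_sum]
      refine Finset.sum_le_sum fun i _ => ?_
      rw [real_inner_smul_right, mul_pow]
      exact mul_le_mul_of_nonneg_right (cγ i) (sq_nonneg _)
    refine le_trans ?_ h8
    rw [div_mul_eq_mul_div, div_le_iff₀ hA]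
    have := mul_le_mul_of_nonneg_left h5 hγ.le
    linarith

end Coordinates

/-! ### Solutions of the equation on a closed manifold. -/

section Final

open Filter Topology

variable {m : ℕ} {M : Type*} [TopologicalSpace M]
    [ChartedSpace (EuclideanSpace ℝ (Fin m)) M] [IsManifold (𝓡 m) ∞ M]
    {g : ContMDiffRiemannianMetric (𝓡 m) ∞ (EuclideanSpace ℝ (Fin m))
      (fun p : M => TangentSpace (𝓡 m) p)}
    {v : (p : M) → TangentSpace (𝓡 m) p}

theorem finrank_tangentSpace_euclidean (p : M) :
    Module.finrank ℝ (TangentSpace (𝓡 m) p) = m :=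
  finrank_euclideanSpace_fin (𝕜 := ℝ)

theorem isOpen_source_inter_preimage (p : M) {O : Set (EuclideanSpace ℝ (Fin m))} (hO : IsOpen O) :
    IsOpen ((extChartAt (𝓡 m) p).source ∩ extChartAt (𝓡 m) p ⁻¹' O) :=
  (continuousOn_extChartAt p).isOpen_inter_preimage (isOpen_extChartAt_source p) hO

theorem chartMetric_chartField (p : M) {y : EuclideanSpace ℝ (Fin m)}
    (hy : y ∈ (extChartAt (𝓡 m) p).target) (X Y : (p : M) → TangentSpace (𝓡 m) p) :
    chartMetric g.inner p y (chartField (𝓡 m) X p y) (chartField (𝓡 m) Y p y) =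
      g.inner ((extChartAt (𝓡 m) p).symm y) (X _) (Y _) := by
  have h := chartMetric_chartCoord g.inner ((extChartAt (𝓡 m) p).map_target hy)
    (X ((extChartAt (𝓡 m) p).symm y)) (Y ((extChartAt (𝓡 m) p).symm y))
  rw [(extChartAt (𝓡 m) p).right_inv hy] at h
  exact h

theorem inner_fieldOfChart {p q : M} (hq : q ∈ (extChartAt (𝓡 m) p).source)
    (a b : EuclideanSpace ℝ (Fin m) → EuclideanSpace ℝ (Fin m)) :
    g.inner q (fieldOfChart (𝓡 m) p a q) (fieldOfChart (𝓡 m) p b q) =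
      chartMetric g.inner p (extChartAt (𝓡 m) p q) (a (extChartAt (𝓡 m) p q))
        (b (extChartAt (𝓡 m) p q)) := by
  rw [← chartMetric_chartCoord g.inner hq, chartCoord_fieldOfChart hq, chartCoord_fieldOfChart hq]

/-- Expand Cᵗ C f_i in the orthonormal basis: its coefficient along f_j is g(C f_i, C f_j), so only
the i-th one survives. A frame that diagonalizes g(C ·, C ·) is therefore an eigenframe. -/
theorem exists_eigenvalue_of_orthogonal {q : M} {f : Fin m → TangentSpace (𝓡 m) q}
    (hon : ∀ i j, g.inner q (f i) (f j) = if i = j then 1 else 0)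
    (C : TangentSpace (𝓡 m) q →L[ℝ] TangentSpace (𝓡 m) q)
    (hC : ∀ i j, i ≠ j → g.inner q (C (f i)) (C (f j)) = 0) (i : Fin m) :
    ∃ c : ℝ, formTranspose (g.inner q) C (C (f i)) = c • f i := by
  refine ⟨g.inner q (C (f i)) (C (f i)), ?_⟩
  have h1 (j : Fin m) : g.inner q (formTranspose (g.inner q) C (C (f i))) (f j) =
      if j = i then g.inner q (C (f i)) (C (f i)) else 0 := by
    refine (formTranspose_spec (F := EuclideanSpace ℝ (Fin m)) (B := g.inner q) (g.pos q) C
      (C (f i)) (f j)).trans ?_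
    by_cases hij : j = i
    · rw [if_pos hij, hij]
      rfl
    · rw [if_neg hij]
      exact hC i j (Ne.symm hij)
  refine (sum_apply_smul_of_orthonormal (finrank_tangentSpace_euclidean q) f hon
    (formTranspose (g.inner q) C (C (f i)))).symm.trans ?_
  simp only [h1, ite_smul, zero_smul, Finset.sum_ite_eq', Finset.mem_univ, if_true]

section Smooth

variable (hv : ContMDiff (𝓡 m) (𝓡 m).tangent ∞ (fun p => (⟨p, v p⟩ : TangentBundle (𝓡 m) M)))
include hv

theorem contDiffAt_chartField_target (p : M) {y : EuclideanSpace ℝ (Fin m)}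
    (hy : y ∈ (extChartAt (𝓡 m) p).target) : ContDiffAt ℝ ∞ (chartField (𝓡 m) v p) y := by
  have h := contDiffAt_chartField ((extChartAt (𝓡 m) p).map_target hy) (hv _)
  rwa [(extChartAt (𝓡 m) p).right_inv hy] at h

theorem inner_covDeriv_fieldOfChart {p q : M} (hq : q ∈ (extChartAt (𝓡 m) p).source)
    (a b : EuclideanSpace ℝ (Fin m) → EuclideanSpace ℝ (Fin m)) :
    g.inner q (covDeriv g.inner v q (fieldOfChart (𝓡 m) p a q))
        (covDeriv g.inner v q (fieldOfChart (𝓡 m) p b q)) =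
      pullForm (chartMetric g.inner p (extChartAt (𝓡 m) p q))
        (coordCov (chartMetric g.inner p) (chartField (𝓡 m) v p) (extChartAt (𝓡 m) p q))
        (a (extChartAt (𝓡 m) p q)) (b (extChartAt (𝓡 m) p q)) := by
  rw [pullForm_apply, ← chartCoord_fieldOfChart hq a, ← chartCoord_fieldOfChart hq b,
    ← chartCoord_covDeriv g hq (hv q), ← chartCoord_covDeriv g hq (hv q),
    chartMetric_chartCoord g.inner hq]

theorem IsDiagonalFrameOn.isEigenframeOn {p : M} {U : Set (EuclideanSpace ℝ (Fin m))}
    (hU : IsOpen U) {e : Fin m → EuclideanSpace ℝ (Fin m) → EuclideanSpace ℝ (Fin m)}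
    (he : IsDiagonalFrameOn (chartMetric g.inner p) (fun y => pullForm (chartMetric g.inner p y)
      (coordCov (chartMetric g.inner p) (chartField (𝓡 m) v p) y)) U e) :
    IsEigenframeOn g.inner v ((extChartAt (𝓡 m) p).source ∩ extChartAt (𝓡 m) p ⁻¹' U)
      (fun i => fieldOfChart (𝓡 m) p (e i)) := by
  have hon : ∀ q ∈ (extChartAt (𝓡 m) p).source ∩ extChartAt (𝓡 m) p ⁻¹' U, ∀ i j,
      g.inner q (fieldOfChart (𝓡 m) p (e i) q) (fieldOfChart (𝓡 m) p (e j) q) =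
        if i = j then 1 else 0 := by
    intro q hq i j
    refine (inner_fieldOfChart hq.1 (e i) (e j)).trans ?_
    by_cases hij : i = j
    · rw [if_pos hij, hij]
      exact he.unit (extChartAt (𝓡 m) p q) hq.2 j
    · rw [if_neg hij]
      exact he.orthogonal (extChartAt (𝓡 m) p q) hq.2 i j hij
  have hdiag : ∀ q ∈ (extChartAt (𝓡 m) p).source ∩ extChartAt (𝓡 m) p ⁻¹' U, ∀ i j, i ≠ j →
      g.inner q (covDeriv g.inner v q (fieldOfChart (𝓡 m) p (e i) q))
        (covDeriv g.inner v q (fieldOfChart (𝓡 m) p (e j) q)) = 0 := fun q hq i j hij =>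
    (inner_covDeriv_fieldOfChart hv hq.1 (e i) (e j)).trans
        (he.diagonal (extChartAt (𝓡 m) p q) hq.2 i j hij)
  refine ⟨isOpen_source_inter_preimage p hU, fun i q hq => ?_, hon,
    fun q hq i => exists_eigenvalue_of_orthogonal (hon q hq) _ (hdiag q hq) i⟩
  exact (contMDiffAt_fieldOfChart hq.1
      (((he.smooth i) _ hq.2).contDiffAt (hU.mem_nhds hq.2))).contMDiffWithinAt

/-- Every nonempty open set contains a nonempty open set with an eigenframe. -/
theorem exists_isEigenframeOn {W : Set M} (hW : IsOpen W) (hne : W.Nonempty) :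
    ∃ U ⊆ W, U.Nonempty ∧ ∃ e, IsEigenframeOn g.inner v U e := by
  obtain ⟨p, hp⟩ := hne
  have hG := isMetricOn_chartMetric g p
  have hT : IsOpen ((extChartAt (𝓡 m) p).target ∩ (extChartAt (𝓡 m) p).symm ⁻¹' W) :=
    (continuousOn_extChartAt_symm p).isOpen_inter_preimage (isOpen_extChartAt_target p) hW
  have hTp : extChartAt (𝓡 m) p p ∈
      (extChartAt (𝓡 m) p).target ∩ (extChartAt (𝓡 m) p).symm ⁻¹' W :=
    ⟨(extChartAt (𝓡 m) p).map_source (mem_extChartAt_source p), by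
      rw [Set.mem_preimage, (extChartAt (𝓡 m) p).left_inv (mem_extChartAt_source p)]; exact hp⟩
  have hC : ContDiffOn ℝ ∞ (coordCov (chartMetric g.inner p) (chartField (𝓡 m) v p))
      ((extChartAt (𝓡 m) p).target ∩ (extChartAt (𝓡 m) p).symm ⁻¹' W) := fun y hy =>
    (contDiffAt_coordCov hG hy.1 (contDiffAt_chartField_target hv p hy.1)).contDiffWithinAt
  have hGs := hG.smooth.mono (Set.inter_subset_left (t := (extChartAt (𝓡 m) p).symm ⁻¹' W))
  obtain ⟨U, hU, ⟨y, hy⟩, hUT, e, he⟩ := exists_isDiagonalFrameOn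
    (finrank_euclideanSpace_fin (𝕜 := ℝ) (n := m)) hT ⟨_, hTp⟩ hGs (contDiffOn_pullForm hGs hC)
    (fun y hy => hG.symm y hy.1)
    (fun y hy a b => (pullForm_apply _ _ _ _).trans
      ((hG.symm y hy.1 _ _).trans (pullForm_apply _ _ _ _).symm)) (fun y hy => hG.pos y hy.1)
  have hyt := (hUT hy).1
  refine ⟨_, fun q hq => ?_, ⟨(extChartAt (𝓡 m) p).symm y, ?_⟩, _, he.isEigenframeOn hv hU⟩
  · have h := (hUT hq.2).2
    rwa [Set.mem_preimage, (extChartAt (𝓡 m) p).left_inv hq.1] at h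
  · refine ⟨(extChartAt (𝓡 m) p).map_target hyt, ?_⟩
    rw [Set.mem_preimage, (extChartAt (𝓡 m) p).right_inv hyt]
    exact hy

end Smooth

section Chart

variable (hv : ContMDiff (𝓡 m) (𝓡 m).tangent ∞ (fun p => (⟨p, v p⟩ : TangentBundle (𝓡 m) M)))
  {U : Set M} {e : Fin m → (p : M) → TangentSpace (𝓡 m) p}
  (he : IsEigenframeOn g.inner v U e) {p q : M} (hq : q ∈ (extChartAt (𝓡 m) p).source)
  (hqU : q ∈ U)
include hv he hq hqU

theorem IsEigenframeOn.chartCoord_weightedLaplacian :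
    chartCoord (𝓡 m) p q (weightedLaplacian g.inner v e q) =
      ∑ i, frameWeight g.inner v (e i) q ^ 2 •
        (coordCov (chartMetric g.inner p) (fun z => coordCov (chartMetric g.inner p)
            (chartField (𝓡 m) v p) z (chartField (𝓡 m) (e i) p z)) (extChartAt (𝓡 m) p q)
            (chartField (𝓡 m) (e i) p (extChartAt (𝓡 m) p q)) -
          coordCov (chartMetric g.inner p) (chartField (𝓡 m) v p) (extChartAt (𝓡 m) p q)
            (coordCov (chartMetric g.inner p) (chartField (𝓡 m) (e i) p) (extChartAt (𝓡 m) p q)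
              (chartField (𝓡 m) (e i) p (extChartAt (𝓡 m) p q))) -
          coordCov (chartMetric g.inner p) (chartField (𝓡 m) v p) (extChartAt (𝓡 m) p q)
            (coordCurvature (chartMetric g.inner p) (extChartAt (𝓡 m) p q)
              (chartField (𝓡 m) v p (extChartAt (𝓡 m) p q))
              (coordCov (chartMetric g.inner p) (chartField (𝓡 m) v p) (extChartAt (𝓡 m) p q)
                (chartField (𝓡 m) (e i) p (extChartAt (𝓡 m) p q)))
              (chartField (𝓡 m) (e i) p (extChartAt (𝓡 m) p q)))) := by
  have hvU : SmoothFieldOn (𝓡 m) v U := fun r _ => (hv r).contMDiffWithinAt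
  have heU (i : Fin m) : SmoothFieldOn (𝓡 m) (e i) U := he.smooth i
  rw [weightedLaplacian, map_sum]
  refine Finset.sum_congr rfl fun i _ => ?_
  rw [map_smul, map_sub, map_sub, chartCoord_nabla_nabla g he.isOpen _ (heU i) hvU hq hqU,
    nabla, chartCoord_covDeriv g hq (hv q), nabla,
    chartCoord_covDeriv g hq ((heU i).contMDiffAt he.isOpen hqU), nabla,
    chartCoord_covDeriv g hq (hv q),
    chartCoord_riemannCurvature g he.isOpen hvU ((heU i).nabla g he.isOpen hvU) (heU i) hq hqU,
    nabla, chartCoord_covDeriv g hq (hv q), chartField_extChartAt v hq,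
    chartField_extChartAt (e i) hq]

theorem IsEigenframeOn.frameWeight_chart (i : Fin m) :
    frameWeight g.inner v (e i) q ^ 2 * (1 + chartMetric g.inner p (extChartAt (𝓡 m) p q)
      (coordCov (chartMetric g.inner p) (chartField (𝓡 m) v p) (extChartAt (𝓡 m) p q)
        (chartField (𝓡 m) (e i) p (extChartAt (𝓡 m) p q)))
      (coordCov (chartMetric g.inner p) (chartField (𝓡 m) v p) (extChartAt (𝓡 m) p q)
        (chartField (𝓡 m) (e i) p (extChartAt (𝓡 m) p q)))) = 1 := by
  rw [chartField_extChartAt (e i) hq, ← chartCoord_covDeriv g hq (hv q),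
    chartMetric_chartCoord g.inner hq]
  exact frameWeight_sq_mul v (e i) q

/-- The Bochner formula for solutions of the equation. -/
theorem IsEigenframeOn.ellipticOp_sq_norm (h0 : weightedLaplacian g.inner v e q = 0) :
    ellipticOp (fun i => frameWeight g.inner v (e i) q •
          chartField (𝓡 m) (e i) p (extChartAt (𝓡 m) p q))
        (∑ i, frameWeight g.inner v (e i) q ^ 2 •
          (-leviCivita (chartMetric g.inner p) (extChartAt (𝓡 m) p q)
              (chartField (𝓡 m) (e i) p (extChartAt (𝓡 m) p q))
              (chartField (𝓡 m) (e i) p (extChartAt (𝓡 m) p q)) -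
            coordCurvature (chartMetric g.inner p) (extChartAt (𝓡 m) p q)
              (chartField (𝓡 m) v p (extChartAt (𝓡 m) p q))
              (coordCov (chartMetric g.inner p) (chartField (𝓡 m) v p) (extChartAt (𝓡 m) p q)
                (chartField (𝓡 m) (e i) p (extChartAt (𝓡 m) p q)))
              (chartField (𝓡 m) (e i) p (extChartAt (𝓡 m) p q))))
        (fun z => chartMetric g.inner p z (chartField (𝓡 m) v p z) (chartField (𝓡 m) v p z))
        (extChartAt (𝓡 m) p q) =
      2 * ∑ i, frameWeight g.inner v (e i) q ^ 2 *
        g.inner q (nabla g.inner (e i) v q) (nabla g.inner (e i) v q) := by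
  have hG := isMetricOn_chartMetric g p
  have hy := (extChartAt (𝓡 m) p).map_source hq
  rw [_root_.ellipticOp_sq_norm hG hy (contDiffAt_chartField hq (hv q))
    (fun i => contDiffAt_chartField hq
      (SmoothFieldOn.contMDiffAt (he.smooth i) he.isOpen hqU)),
    ← he.chartCoord_weightedLaplacian hv hq hqU, h0]
  simp only [map_zero, zero_apply, mul_zero, zero_add]
  refine congrArg _ (Finset.sum_congr rfl fun i _ => congrArg _ ?_)
  rw [chartField_extChartAt (e i) hq, ← chartCoord_covDeriv g hq (hv q),
    chartMetric_chartCoord g.inner hq]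
  rfl

theorem IsEigenframeOn.chartMetric_frame (i j : Fin m) :
    chartMetric g.inner p (extChartAt (𝓡 m) p q)
      (chartField (𝓡 m) (e i) p (extChartAt (𝓡 m) p q))
      (chartField (𝓡 m) (e j) p (extChartAt (𝓡 m) p q)) = if i = j then 1 else 0 := by
  rw [chartField_extChartAt (e i) hq, chartField_extChartAt (e j) hq,
    chartMetric_chartCoord g.inner hq]
  exact he.orthonormal q hqU i j

end Chart

theorem inner_self_nonneg_metric (q : M) (x : TangentSpace (𝓡 m) q) : 0 ≤ g.inner q x x := by
  by_cases h : x = 0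
  · simp [h]
  · exact (g.pos q x h).le

section Equation

variable (hv : ContMDiff (𝓡 m) (𝓡 m).tangent ∞ (fun p => (⟨p, v p⟩ : TangentBundle (𝓡 m) M)))
  (heq : SatisfiesMinimalEquation g.inner v)
include hv

theorem continuous_sq_norm : Continuous fun q => g.inner q (v q) (v q) := by
  rw [continuous_iff_continuousAt]
  intro p
  have hpp := mem_extChartAt_source (I := 𝓡 m) p
  have hy := (extChartAt (𝓡 m) p).map_source hpp
  have hV := contDiffAt_chartField hpp (hv p)
  have h1 : ContinuousAt (fun z => chartMetric g.inner p z (chartField (𝓡 m) v p z)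
      (chartField (𝓡 m) v p z)) (extChartAt (𝓡 m) p p) :=
    ((((isMetricOn_chartMetric g p).contDiffAt hy).clm_apply hV).clm_apply hV).continuousAt
  refine (ContinuousAt.comp h1 (continuousAt_extChartAt p)).congr ?_
  filter_upwards [extChartAt_source_mem_nhds (I := 𝓡 m) p] with q hq
  rw [Function.comp_apply, chartField_extChartAt v hq, chartMetric_chartCoord g.inner hq]

include heq

/-- A solution of the equation attains the maximum of its norm on an open set. -/
theorem SatisfiesMinimalEquation.eventually_sq_norm_eq {p : M}
    (hp : ∀ q, g.inner q (v q) (v q) ≤ g.inner p (v p) (v p)) :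
    ∀ᶠ q in 𝓝 p, g.inner q (v q) (v q) = g.inner p (v p) (v p) := by
  have hpp := mem_extChartAt_source (I := 𝓡 m) p
  have hG := isMetricOn_chartMetric g p
  set φ := extChartAt (𝓡 m) p with hφ
  have hy := φ.map_source hpp
  obtain ⟨k, K, Λ, hk, hbound⟩ := eventually_coefficient_bounds hG hy
    (contDiffAt_chartField hpp (hv p)) (finrank_euclideanSpace_fin (𝕜 := ℝ) (n := m))
  obtain ⟨t, ht, hto, hyt⟩ := eventually_nhds_iff.1 hbound
  have hΩ : IsOpen (t ∩ φ.target) := hto.inter (isOpen_extChartAt_target p)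
  have hu : ContDiffOn ℝ 2 (fun z => chartMetric g.inner p z (chartField (𝓡 m) v p z)
      (chartField (𝓡 m) v p z)) (t ∩ φ.target) := fun z hz => by
    have hV := contDiffAt_chartField_target hv p hz.2
    exact ((((hG.contDiffAt hz.2).clm_apply hV).clm_apply hV).of_le two_le_infty).contDiffWithinAt
  have hval {z : EuclideanSpace ℝ (Fin m)} (hz : z ∈ φ.target) :=
    chartMetric_chartField (g := g) p hz v v
  -- The points at which the differential inequality is available. The eigenframe may vary from
  -- point to point, since the maximum principle asks only for bounds common to all of them.
  let D : Set (EuclideanSpace ℝ (Fin m)) :=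
    {z | ∃ U e, IsEigenframeOn g.inner v U e ∧ φ.symm z ∈ U}
  have hD : t ∩ φ.target ⊆ closure D := by
    intro z hz
    rw [mem_closure_iff]
    intro O hO hzO
    have hW := isOpen_source_inter_preimage p (hO.inter hΩ)
    obtain ⟨U, hUW, ⟨q, hqU⟩, e, he⟩ := exists_isEigenframeOn (g := g) hv hW
      ⟨φ.symm z, φ.map_target hz.2, by rw [Set.mem_preimage, φ.right_inv hz.2]; exact ⟨hzO, hz⟩⟩
    have hqW := hUW hqU
    exact ⟨φ q, hqW.2.1, U, e, he, by rwa [φ.left_inv hqW.1]⟩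
  have hmax := eventually_eq_of_subsolution (n := m) (M := g.inner p (v p) (v p)) (k := k) (K := K)
    (Λ := Λ) hΩ hu (fun z hz => by rw [hval hz.2]; exact hp _) hk hD (by
      rintro z ⟨U, e, he, hzU⟩ hz
      have hq := φ.map_target hz.2
      obtain ⟨b1, b2, b3⟩ := ht z hz.1 (fun i => chartField (𝓡 m) (e i) p z)
        (fun i => frameWeight g.inner v (e i) (φ.symm z))
        (fun i j => by
          have := he.chartMetric_frame hv hq hzU i j
          rwa [φ.right_inv hz.2] at this)
        (fun i => by
          have := he.frameWeight_chart hv hq hzU i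
          rwa [φ.right_inv hz.2] at this)
      refine ⟨_, _, b1, b2, b3, ?_⟩
      have h := he.ellipticOp_sq_norm hv hq hzU (heq U e he _ hzU)
      rw [φ.right_inv hz.2] at h
      rw [h]
      exact mul_nonneg zero_le_two (Finset.sum_nonneg fun i _ =>
        mul_nonneg (sq_nonneg _) (inner_self_nonneg_metric _ _)))
    (x₀ := φ p) ⟨hyt, hy⟩ (by rw [hval hy, φ.left_inv hpp])
  filter_upwards [(continuousAt_extChartAt p).eventually hmax,
    extChartAt_source_mem_nhds (I := 𝓡 m) p] with q h1 hq
  rw [hval (φ.map_source hq), φ.left_inv hq] at h1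
  exact h1

/-- The set where the norm attains its maximum is closed and nonempty by compactness and continuity,
and open by the local maximum principle applied at each of its points. Connectedness finishes. -/
theorem SatisfiesMinimalEquation.sq_norm_eq [CompactSpace M] [ConnectedSpace M] (p q : M) :
    g.inner q (v q) (v q) = g.inner p (v p) (v p) := by
  have hc := continuous_sq_norm (g := g) hv
  obtain ⟨r, -, hr⟩ := isCompact_univ.exists_isMaxOn Set.univ_nonempty hc.continuousOn
  have hr' (q : M) : g.inner q (v q) (v q) ≤ g.inner r (v r) (v r) := hr (Set.mem_univ q)
  have hclopen : IsClopen {q | g.inner q (v q) (v q) = g.inner r (v r) (v r)} := by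
    refine ⟨isClosed_eq hc continuous_const, isOpen_iff_mem_nhds.2 fun q hq => ?_⟩
    have hq' : g.inner q (v q) (v q) = g.inner r (v r) (v r) := hq
    have h := heq.eventually_sq_norm_eq hv (p := q) fun q' => by rw [hq']; exact hr' q'
    filter_upwards [h] with q' h'
    exact h'.trans hq'
  have huniv := hclopen.eq_univ ⟨r, rfl⟩
  have h (q : M) : g.inner q (v q) (v q) = g.inner r (v r) (v r) := by
    have : q ∈ {q | g.inner q (v q) (v q) = g.inner r (v r) (v r)} := by rw [huniv]; trivial
    exact this
  rw [h q, h p]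

/-- For constant norm the left-hand side of the Bochner formula is zero, so each nonnegative summand
vanishes. The weights are nonzero, and ∇v is zero on a basis. -/
theorem SatisfiesMinimalEquation.covDeriv_eq_zero_of_mem [CompactSpace M] [ConnectedSpace M]
    {U : Set M} {e : Fin m → (p : M) → TangentSpace (𝓡 m) p} (he : IsEigenframeOn g.inner v U e)
    {q : M} (hqU : q ∈ U) : covDeriv g.inner v q = 0 := by
  have hqq := mem_extChartAt_source (I := 𝓡 m) q
  have hB := he.ellipticOp_sq_norm hv hqq hqU (heq U e he q hqU)
  have hconst : (fun z => chartMetric g.inner q z (chartField (𝓡 m) v q z)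
      (chartField (𝓡 m) v q z)) =ᶠ[𝓝 (extChartAt (𝓡 m) q q)]
      fun _ => g.inner q (v q) (v q) := by
    filter_upwards [extChartAt_target_mem_nhds q] with z hz
    rw [chartMetric_chartField q hz]
    exact heq.sq_norm_eq hv _ _
  have hf : fderiv ℝ (fun z => chartMetric g.inner q z (chartField (𝓡 m) v q z)
      (chartField (𝓡 m) v q z)) =ᶠ[𝓝 (extChartAt (𝓡 m) q q)] fun _ => 0 := by
    filter_upwards [hconst.eventually_nhds] with z hz
    rw [Filter.EventuallyEq.fderiv_eq hz, fderiv_fun_const]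
    rfl
  rw [ellipticOp, hf.fderiv_eq, hf.self_of_nhds, fderiv_fun_const] at hB
  simp only [Pi.zero_apply, zero_apply, Finset.sum_const_zero, zero_add] at hB
  have h1 : ∀ i ∈ Finset.univ, frameWeight g.inner v (e i) q ^ 2 *
      g.inner q (nabla g.inner (e i) v q) (nabla g.inner (e i) v q) = 0 :=
    (Finset.sum_eq_zero_iff_of_nonneg fun i _ =>
      mul_nonneg (sq_nonneg _) (inner_self_nonneg_metric _ _)).1 (by linarith)
  have h2 (i : Fin m) : covDeriv g.inner v q (e i q) = 0 := by
    have h3 := frameWeight_sq_mul (g := g) v (e i) q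
    have h4 : frameWeight g.inner v (e i) q ^ 2 ≠ 0 := by
      intro h
      rw [h, zero_mul] at h3
      exact zero_ne_one h3
    have h5 := (mul_eq_zero.1 (h1 i (Finset.mem_univ i))).resolve_left h4
    by_contra h6
    exact (g.pos q _ h6).ne' h5
  refine ContinuousLinearMap.ext fun x => ?_
  rw [← sum_apply_smul_of_orthonormal (finrank_tangentSpace_euclidean q) (fun i => e i q)
    (he.orthonormal q hqU) x, map_sum]
  simp [h2]

/-- If ∇v were nonzero at `p`, it would be nonzero on a neighbourhood by continuity, and that
neighbourhood contains a point with an eigenframe. -/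
theorem SatisfiesMinimalEquation.covDeriv_eq_zero [CompactSpace M] [ConnectedSpace M] (p : M) :
    covDeriv g.inner v p = 0 := by
  have hpp := mem_extChartAt_source (I := 𝓡 m) p
  have hy := (extChartAt (𝓡 m) p).map_source hpp
  have hc := (contDiffAt_coordCov (isMetricOn_chartMetric g p) hy
    (contDiffAt_chartField hpp (hv p))).continuousAt
  by_contra hne
  have h0 : coordCov (chartMetric g.inner p) (chartField (𝓡 m) v p) (extChartAt (𝓡 m) p p) ≠ 0 := by
    intro h
    refine hne (ContinuousLinearMap.ext fun x => ?_)
    rw [covDeriv_apply_self, h]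
    rfl
  have hev := (continuousAt_extChartAt (I := 𝓡 m) p).eventually (hc.eventually_ne h0)
  obtain ⟨W, hW, hWo, hpW⟩ := eventually_nhds_iff.1
    (hev.and (extChartAt_source_mem_nhds (I := 𝓡 m) p))
  obtain ⟨U, hUW, ⟨q, hqU⟩, e, he⟩ := exists_isEigenframeOn (g := g) hv hWo ⟨p, hpW⟩
  obtain ⟨h1, hq⟩ := hW q (hUW hqU)
  refine h1 (ContinuousLinearMap.ext fun a => ?_)
  obtain ⟨x, rfl⟩ := (isInvertible_chartCoord (I := 𝓡 m) hq).surjective a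
  rw [← chartCoord_covDeriv g hq (hv q), heq.covDeriv_eq_zero_of_mem hv he hqU]
  simp

end Equation

theorem covDeriv_zero (h : MetricField (𝓡 m) M) (p : M) :
    covDeriv h (fun q => (0 : TangentSpace (𝓡 m) q)) p = 0 := by
  have h1 : chartField (𝓡 m) (fun q => (0 : TangentSpace (𝓡 m) q)) p = fun _ => 0 := by
    funext y
    exact map_zero _
  have h2 : christoffel h p (extChartAt (𝓡 m) p p) 0 = 0 := by
    have := christoffel_smul h p (extChartAt (𝓡 m) p p) 0 0
    simpa using this
  rw [covDeriv, h1, map_zero, h2, fderiv_fun_const]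
  ext x
  simp

theorem nabla_eq_zero (hpar : ∀ p, covDeriv g.inner v p = 0) (X : (p : M) → TangentSpace (𝓡 m) p) :
    nabla g.inner X v = fun _ => 0 := by
  funext p
  rw [nabla, hpar p]
  rfl

theorem satisfiesMinimalEquation_of_parallel (hpar : ∀ p, covDeriv g.inner v p = 0) :
    SatisfiesMinimalEquation g.inner v := by
  intro U e he p hp
  refine Finset.sum_eq_zero fun i _ => ?_
  rw [nabla_eq_zero hpar, nabla_eq_zero hpar, nabla_eq_zero hpar]
  have : nabla g.inner (e i) (fun q => (0 : TangentSpace (𝓡 m) q)) p = 0 := by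
    rw [nabla, covDeriv_zero]
    rfl
  rw [this]
  simp

theorem pullbackMetric_sectionMap_of_covDeriv_eq_zero {p : M}
    (hv : ContMDiffAt (𝓡 m) (𝓡 m).tangent ∞ (fun p => (⟨p, v p⟩ : TangentBundle (𝓡 m) M)) p)
    (hp : covDeriv g.inner v p = 0) (x y : TangentSpace (𝓡 m) p) :
    pullbackMetric (𝓡 m) (sasakiMetric g.inner) (sectionMap v) p x y = g.inner p x y := by
  refine (pullbackMetric_sectionMap g hv x y).trans ?_
  rw [hp]
  exact (congrArg (g.inner p x y + ·) (DFunLike.congr_fun (map_zero (g.inner p)) _)).trans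
    (add_zero _)

theorem lift_add_horLift_mem_range_iff {p : M}
    (hv : ContMDiffAt (𝓡 m) (𝓡 m).tangent ∞ (fun p => (⟨p, v p⟩ : TangentBundle (𝓡 m) M)) p)
    (X Y X' : TangentSpace (𝓡 m) p) :
    horLift g.inner (sectionMap v p) X + verLift g.inner (sectionMap v p) Y +
        horLift g.inner (sectionMap v p) X' ∈
      LinearMap.range (mfderiv (𝓡 m) (𝓡 m).tangent (sectionMap v) p).toLinearMap ↔
      Y = covDeriv g.inner v p (X + X') :=
  (iff_of_eq (congrArg
    (· ∈ LinearMap.range (mfderiv (𝓡 m) (𝓡 m).tangent (sectionMap v) p).toLinearMap)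
    (lift_add_horLift g (sectionMap v p) X Y X'))).trans (lift_mem_range_iff g hv _ _)

/-- When ∇v = 0 the induced metric is `g`, so any orthonormal basis at the point computes the trace;
its vectors are extended with constant components. Every vertical part vanishes and the remaining
vectors are horizontal, hence tangent to the section. This needs no eigenframe at the point. -/
theorem isMinimalField_of_parallel
    (hv : ContMDiff (𝓡 m) (𝓡 m).tangent ∞ (fun p => (⟨p, v p⟩ : TangentBundle (𝓡 m) M)))
    (hpar : ∀ p, covDeriv g.inner v p = 0) : IsMinimalField g.inner v := by
  intro p
  have hpos := sasakiMetric_pos g (sectionMap v p)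
  let A : EuclideanSpace ℝ (Fin m) →L[ℝ] EuclideanSpace ℝ (Fin m) →L[ℝ] ℝ := g.inner p
  -- An orthonormal basis at `p`, obtained by diagonalizing a constant family over a dummy parameter
  -- in ℝ.
  obtain ⟨U, -, ⟨x, hx⟩, -, e, he⟩ := exists_isDiagonalFrameOn (X := ℝ)
    (finrank_euclideanSpace_fin (𝕜 := ℝ) (n := m)) (G := fun _ => A) (B := fun _ => A)
    isOpen_univ Set.univ_nonempty contDiffOn_const contDiffOn_const
    (fun _ _ a b => g.symm p a b) (fun _ _ a b => g.symm p a b) (fun _ _ a ha => g.pos p a ha)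
  have hk (i j : Fin m) : pullbackMetric (𝓡 m) (sasakiMetric g.inner) (sectionMap v) p
      (e i x) (e j x) = if i = j then 1 else 0 := by
    refine (pullbackMetric_sectionMap_of_covDeriv_eq_zero (hv p) (hpar p) _ _).trans ?_
    by_cases hij : i = j
    · rw [if_pos hij, hij]
      exact he.unit x hx j
    · rw [if_neg hij]
      exact he.orthogonal x hx i j hij
  rw [sectionMeanCurvature, meanCurvature_eq_sum _ _ _ hpos finrank_euclideanSpace_fin
    (fun i => e i x) hk]
  refine Finset.sum_eq_zero fun i _ => ?_
  have hpp := mem_extChartAt_source (I := 𝓡 m) p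
  have hU := isOpen_extChartAt_source (I := 𝓡 m) p
  have hY : SmoothFieldOn (𝓡 m) (fieldOfChart (𝓡 m) p fun _ => e i x) (extChartAt (𝓡 m) p).source :=
    fun q hq => (contMDiffAt_fieldOfChart hq contDiffAt_const).contMDiffWithinAt
  have hYp : fieldOfChart (𝓡 m) p (fun _ => e i x) p = e i x :=
    (chartCoord_self_apply (I := 𝓡 m) p _).symm.trans (chartCoord_fieldOfChart hpp _)
  have h1 := secondFundamentalForm_sectionMap g hU (v := v)
    (fun q _ => (hv q).contMDiffWithinAt) hY hpp
  rw [hYp] at h1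
  refine h1.trans ?_
  refine (normalPart_eq_zero_iff hpos).2 ?_
  refine (lift_add_horLift_mem_range_iff (hv p) _ _ _).2 ?_
  rw [nabla_eq_zero hpar, nabla, covDeriv_zero, hpar]
  rfl

end Final

end

theorem mainTheorem4 {m : ℕ} {M : Type*} [TopologicalSpace M]
    [ChartedSpace (EuclideanSpace ℝ (Fin m)) M] [IsManifold (𝓡 m) ∞ M]
    [T2Space M] [CompactSpace M] [ConnectedSpace M]
    (g : ContMDiffRiemannianMetric (𝓡 m) ∞ (EuclideanSpace ℝ (Fin m))
      (fun p : M => TangentSpace (𝓡 m) p))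
    (v : (p : M) → TangentSpace (𝓡 m) p)
    (hv : ContMDiff (𝓡 m) (𝓡 m).tangent ∞ (fun p => (⟨p, v p⟩ : TangentBundle (𝓡 m) M))) :
    (∀ (U : Set M) (e : Fin m → (p : M) → TangentSpace (𝓡 m) p),
      IsEigenframeOn g.inner v U e → ∀ p ∈ U,
        (∀ i, tangentLift g.inner v (e i) p ∈
          LinearMap.range (mfderiv (𝓡 m) (𝓡 m).tangent (sectionMap v) p).toLinearMap) ∧
        (∀ i j, sasakiMetric g.inner (sectionMap v p) (tangentLift g.inner v (e i) p)
          (tangentLift g.inner v (e j) p) = if i = j then 1 else 0) ∧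
        sectionMeanCurvature g.inner v p =
          normalComponent (𝓡 m) (sasakiMetric g.inner) (sectionMap v) p
            (frameCurvatureSum g.inner v e p) ∧
        (sectionMeanCurvature g.inner v p = 0 ↔ weightedLaplacian g.inner v e p = 0)) ∧
    (IsMinimalField g.inner v ↔ SatisfiesMinimalEquation g.inner v) ∧
    (SatisfiesMinimalEquation g.inner v ↔
      (∀ p, covDeriv g.inner v p = 0) ∨ (∀ p, v p = 0)) := by
  -- Minimality gives (*) pointwise, but the converse goes through parallelism: (*) says nothing
  -- directly at points without an eigenframe. The case v = 0 is a special case of a parallel field,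
  -- so the last equivalence always returns the first alternative.
  refine ⟨fun U e he p hp => ⟨fun i => ⟨_, he.mfderiv_frame hv hp i⟩,
    he.tangentLift_orthonormal hv hp, he.sectionMeanCurvature_eq hv hp,
    he.sectionMeanCurvature_eq_zero_iff hv hp⟩, ⟨fun h U e he p hp =>
      (he.sectionMeanCurvature_eq_zero_iff hv hp).1 (h p), fun h =>
      isMinimalField_of_parallel hv (h.covDeriv_eq_zero hv)⟩,
    fun h => Or.inl (h.covDeriv_eq_zero hv), ?_⟩
  rintro (h | h)
  · exact satisfiesMinimalEquation_of_parallel h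
  · refine satisfiesMinimalEquation_of_parallel fun p => ?_
    obtain rfl : v = fun _ => 0 := funext h
    exact covDeriv_zero g.inner p
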